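/- Let $X$ be a smooth irreducible complex projective variety, and let $\mathcal G$ be a (singular) foliation of codimension two on $X$, with tangent sheaf $T_{\mathcal G}$ and conormal sheaf $N^*_{\mathcal G}$. Let $\mathbb C(X/\mathcal G)\subseteq\mathbb C(X)$ be the field of rational first integrals of $\mathcal G$ (rational functions $f$ with $v(f)=0$ for all local sections $v$ of $T_{\mathcal G}$). Bott's partial connection on the conormal sheaf is given by $\langle\nabla_v\omega,\xi\rangle=v(\omega(\xi))-\omega([v,\xi])$ for $v$ tangent to $\mathcal G$ and any rational vector field $\xi$. For a rational section $\eta$ of $\Omega^1_{\mathcal G}=T_{\mathcal G}^*$ let $$E(\eta)=\{\omega \text{ rational section of } N^*_{\mathcal G} : \nabla\omega=\eta\otimes\omega\},$$ a vector space over $\mathbb C(X/\mathcal G)$. Assume that, for some $\eta$, the space $E(\eta)$ generates the $\mathbb C(X)$-vector space of rational sections of $N^*_{\mathcal G}$. A codimension one foliation $\mathcal F$ contains $\mathcal G$ if $T_{\mathcal G}\subseteq T_{\mathcal F}$; it is called transversely affine if it is defined by a rational $1$-form $\omega_0$ such that $d\omega_0=\omega_0\wedge\omega_1$ for some closed rational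 $1$-form $\omega_1$. Then exactly one of the following statements holds. 1. $\operatorname{trdeg}_{\mathbb C}\mathbb C(X/\mathcal G)=2$, and there are an irreducible (possibly singular) projective surface $Y$ and a dominant rational map $\pi:X\dashrightarrow Y$ such that $\mathcal G$ is defined by $\pi$ and every codimension one foliation $\mathcal F$ containing $\mathcal G$ is of the form $\pi^*\mathcal F_Y$ for some codimension one foliation $\mathcal F_Y$ on $Y$. 2. $\operatorname{trdeg}_{\mathbb C}\mathbb C(X/\mathcal G)=1$, every codimension one foliation containing $\mathcal G$ is transversely affine, and the set of codimension one foliations containing $\mathcal G$ is parametrized by $\mathbb P^1(\mathbb C(X/\mathcal G))$. 3. $\operatorname{trdeg}_{\mathbb C}\mathbb C(X/\mathcal G)=0$, the general leaf of $\mathcal G$ is Zariski dense in $X$ (that is, the leaf through every point outside the singular set of $\mathcal G$ and outside a suitable countable union of proper closed subvarieties is), every codimension one foliation containing $\mathcal G$ is transversely affine, and the set of codimension one foliations containing $\mathcal G$ is parametrized by $\mathbb P^1(\mathbb C)$. The parametrizations in 2 and 3 are given by two elements $\omega_0,\omega_1\in E(\eta)$, linearly independent over $\mathbb C(X)$: with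 $k=\mathbb C(X/\mathcal G)$, respectively $k=\mathbb C$, the assignment sending $[s:t]\in\mathbb P^1(k)$ to the foliation defined by $s\omega_0+t\omega_1$ is a bijection onto the set of codimension one foliations containing $\mathcal G$. Furthermore, if $\eta$ is not log-exact (that is, $\eta$ is not the restriction to $T_{\mathcal G}$ of $df/f$ for any non-zero $f\in\mathbb C(X)$), then statement 3 holds. -/

import Mathlib

open MvPolynomial
open scoped LinearAlgebra.Projectivization

noncomputable section

/-! ## Projective varieties -/

/-- An irreducible complex projective variety `X ⊆ ℙ^N`, given by its homogeneous prime ideal. -/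
structure ProjVariety (N : ℕ) where
  /-- the homogeneous ideal of `X` -/
  ideal : Ideal (MvPolynomial (Fin (N + 1)) ℂ)
  isPrime : ideal.IsPrime
  isHomogeneous : ∀ g ∈ ideal, ∀ d : ℕ, homogeneousComponent d g ∈ ideal
  nonempty : ∃ i, (X i : MvPolynomial (Fin (N + 1)) ℂ) ∉ ideal

namespace ProjVariety

variable {N M : ℕ} (X : ProjVariety N) (Y : ProjVariety M)

instance : X.ideal.IsPrime := X.isPrime

/-- The homogeneous coordinate ring. -/
abbrev CoordRing : Type := MvPolynomial (Fin (N + 1)) ℂ ⧸ X.ideal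

/-- The class of a polynomial in the fraction field of the homogeneous coordinate ring. -/
def cls : MvPolynomial (Fin (N + 1)) ℂ →ₐ[ℂ] FractionRing X.CoordRing :=
  (Algebra.ofId X.CoordRing (FractionRing X.CoordRing)).restrictScalars ℂ |>.comp
    (Ideal.Quotient.mkₐ ℂ X.ideal)

lemma cls_eq_zero_iff (a : MvPolynomial (Fin (N + 1)) ℂ) : X.cls a = 0 ↔ a ∈ X.ideal := by
  change algebraMap X.CoordRing (FractionRing X.CoordRing) (Ideal.Quotient.mk X.ideal a) = 0 ↔ _
  rw [FaithfulSMul.algebraMap_eq_zero_iff, Ideal.Quotient.eq_zero_iff_mem]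

/-- The field `ℂ(X)` of rational functions: quotients `a / b` of homogeneous polynomials of the
same degree with `b` not vanishing identically on `X`. -/
def functionField : IntermediateField ℂ (FractionRing X.CoordRing) where
  carrier := {z | ∃ (d : ℕ) (a b : MvPolynomial (Fin (N + 1)) ℂ),
    a.IsHomogeneous d ∧ b.IsHomogeneous d ∧ b ∉ X.ideal ∧ z = X.cls a / X.cls b}
  mul_mem' := by
    rintro _ _ ⟨d, a, b, ha, hb, hb0, rfl⟩ ⟨e, a', b', ha', hb', hb0', rfl⟩
    refine ⟨d + e, a * a', b * b', ha.mul ha', hb.mul hb', fun h => ?_, ?_⟩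
    · exact (X.isPrime.mem_or_mem h).elim hb0 hb0'
    · rw [map_mul, map_mul, div_mul_div_comm]
  add_mem' := by
    rintro _ _ ⟨d, a, b, ha, hb, hb0, rfl⟩ ⟨e, a', b', ha', hb', hb0', rfl⟩
    refine ⟨d + e, a * b' + b * a', b * b', (ha.mul hb').add (hb.mul ha'), hb.mul hb',
      fun h => ?_, ?_⟩
    · exact (X.isPrime.mem_or_mem h).elim hb0 hb0'
    · rw [← X.cls_eq_zero_iff] at hb0 hb0'
      rw [map_add, map_mul, map_mul, map_mul, div_add_div _ _ hb0 hb0']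
  algebraMap_mem' := fun c => ⟨0, C c, 1, isHomogeneous_C _ _, isHomogeneous_one _ _,
    fun h => X.isPrime.ne_top ((Ideal.eq_top_iff_one _).2 h), by
      rw [map_one, div_one]; exact (X.cls.commutes c).symm⟩
  inv_mem' := by
    rintro _ ⟨d, a, b, ha, hb, hb0, rfl⟩
    by_cases h : a ∈ X.ideal
    · refine ⟨d, a, b, ha, hb, hb0, ?_⟩
      rw [(X.cls_eq_zero_iff a).2 h, zero_div, inv_zero]
    · exact ⟨d, b, a, hb, ha, h, by rw [inv_div]⟩

/-- The field of rational functions `ℂ(X)`, as a type. -/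
def K : Type := X.functionField

instance : Field X.K := inferInstanceAs (Field X.functionField)

instance : Algebra ℂ X.K := inferInstanceAs (Algebra ℂ X.functionField)

/-- The inclusion of `ℂ(X)` into the fraction field of the homogeneous coordinate ring. -/
def incl : X.K →ₐ[ℂ] FractionRing X.CoordRing := X.functionField.val

/-- The dimension of `X`: the transcendence degree of `ℂ(X)` over `ℂ` (always finite). -/
def dim : ℕ := (Algebra.trdeg ℂ X.K).toNat

/-- The (closed) points of `X`. -/
def Point : Type :=
  {p : ℙ ℂ (Fin (N + 1) → ℂ) // ∀ g ∈ X.ideal, eval p.rep g = 0}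

variable {X} in
/-- A chosen vector of homogeneous coordinates of a point. -/
def Point.coords (p : X.Point) : Fin (N + 1) → ℂ := p.1.rep

/-- `X` is smooth (a projective manifold): at every point, the Zariski tangent space of the affine
cone, cut out by the differentials of all the equations, has dimension `dim X + 1`. -/
def IsSmooth : Prop :=
  ∀ p : X.Point, ∃ W : Submodule ℂ (Fin (N + 1) → ℂ),
    (∀ u, u ∈ W ↔ ∀ g ∈ X.ideal, ∑ i, eval p.coords (pderiv i g) * u i = 0) ∧
    Module.finrank ℂ W = X.dim + 1

/-- `z = a / b` with `a`, `b` homogeneous polynomials of the same degree and `b p ≠ 0`. -/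
def IsFraction (p : X.Point) (z : X.K) (a b : MvPolynomial (Fin (N + 1)) ℂ) : Prop :=
  (∃ d : ℕ, a.IsHomogeneous d ∧ b.IsHomogeneous d) ∧ eval p.coords b ≠ 0 ∧
    X.incl z = X.cls a / X.cls b

variable {X} in
lemma Point.not_mem (p : X.Point) {b : MvPolynomial (Fin (N + 1)) ℂ}
    (hb : eval p.coords b ≠ 0) : b ∉ X.ideal := fun h => hb (p.2 b h)

/-- The local ring `𝒪_{X,p}`, as a subring of `ℂ(X)`: rational functions regular at `p`. -/
def localRing (p : X.Point) : Subalgebra ℂ X.K where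
  carrier := {z | ∃ a b, X.IsFraction p z a b}
  mul_mem' := by
    rintro _ _ ⟨a, b, ⟨d, ha, hb⟩, hb0, hz⟩ ⟨a', b', ⟨e, ha', hb'⟩, hb0', hz'⟩
    refine ⟨a * a', b * b', ⟨d + e, ha.mul ha', hb.mul hb'⟩, ?_, ?_⟩
    · rw [map_mul]; exact mul_ne_zero hb0 hb0'
    · rw [map_mul, hz, hz', map_mul, map_mul, div_mul_div_comm]
  add_mem' := by
    rintro _ _ ⟨a, b, ⟨d, ha, hb⟩, hb0, hz⟩ ⟨a', b', ⟨e, ha', hb'⟩, hb0', hz'⟩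
    refine ⟨a * b' + b * a', b * b', ⟨d + e, (ha.mul hb').add (hb.mul ha'), hb.mul hb'⟩, ?_, ?_⟩
    · rw [map_mul]; exact mul_ne_zero hb0 hb0'
    · have h := p.not_mem hb0
      have h' := p.not_mem hb0'
      rw [← X.cls_eq_zero_iff] at h h'
      rw [map_add, hz, hz', map_add, map_mul, map_mul, map_mul, div_add_div _ _ h h']
  algebraMap_mem' := fun c => ⟨C c, 1, ⟨0, isHomogeneous_C _ _, isHomogeneous_one _ _⟩,
    by rw [map_one]; exact one_ne_zero, by
      rw [map_one, div_one]; exact (X.incl.commutes c).trans (X.cls.commutes c).symm⟩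

open Classical in
/-- The value `z(p)` of a rational function `z` regular at `p` (and `0` if it is not regular). -/
def value (z : X.K) (p : X.Point) : ℂ :=
  if h : ∃ ab : MvPolynomial (Fin (N + 1)) ℂ × MvPolynomial (Fin (N + 1)) ℂ,
      X.IsFraction p z ab.1 ab.2 then
    eval p.coords h.choose.1 / eval p.coords h.choose.2
  else 0

/-- The value does not depend on the fraction that represents the function. -/
lemma value_eq (z : X.K) (p : X.Point) {a b : MvPolynomial (Fin (N + 1)) ℂ}
    (h : X.IsFraction p z a b) : X.value z p = eval p.coords a / eval p.coords b := by
  have hex : ∃ ab : MvPolynomial (Fin (N + 1)) ℂ × MvPolynomial (Fin (N + 1)) ℂ,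
      X.IsFraction p z ab.1 ab.2 := ⟨(a, b), h⟩
  rw [value, dif_pos hex]
  obtain ⟨-, hb0', hz'⟩ := hex.choose_spec
  obtain ⟨-, hb0, hz⟩ := h
  generalize hex.choose.1 = a' at *
  generalize hex.choose.2 = b' at *
  have h1 := p.not_mem hb0
  have h2 := p.not_mem hb0'
  rw [← X.cls_eq_zero_iff] at h1 h2
  rw [hz, div_eq_div_iff h1 h2, ← map_mul, ← map_mul, ← sub_eq_zero, ← map_sub,
    X.cls_eq_zero_iff] at hz'
  have h3 := p.2 _ hz'
  change eval p.coords _ = 0 at h3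
  rw [map_sub, map_mul, map_mul, sub_eq_zero] at h3
  rw [div_eq_div_iff hb0' hb0]
  exact h3.symm

/-! ## Rational vector fields and rational `1`-forms -/

/-- Rational vector fields on `X`. -/
abbrev VF : Type := Derivation ℂ X.K X.K

/-- Rational `1`-forms on `X`. -/
abbrev Form : Type := Ω[X.K⁄ℂ]

variable {X} in
/-- The contraction `ω(v)` of a rational `1`-form with a rational vector field. -/
def pair (ω : X.Form) (v : X.VF) : X.K := v.liftKaehlerDifferential ω

/-- The stalk at `p` of the sheaf `Ω¹_X` (modulo torsion, which is zero where `X` is smooth),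
inside the rational `1`-forms. -/
def formStalk (p : X.Point) : Submodule (X.localRing p) X.Form :=
  Submodule.span (X.localRing p) {ω | ∃ f ∈ X.localRing p, ω = KaehlerDifferential.D ℂ X.K f}

/-- The stalk at `p` of the tangent sheaf `T_X`: rational vector fields which preserve the local
ring. -/
def vfStalk (p : X.Point) : Submodule (X.localRing p) X.VF where
  carrier := {v | ∀ f ∈ X.localRing p, v f ∈ X.localRing p}
  add_mem' := fun hv hw f hf => by
    rw [Derivation.add_apply]; exact add_mem (hv f hf) (hw f hf)
  zero_mem' := fun f _ => by rw [Derivation.zero_apply]; exact zero_mem _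
  smul_mem' := fun c v hv f hf => mul_mem c.2 (hv f hf)

variable {X} in
/-- The exterior derivative of a rational `1`-form, evaluated on two rational vector fields. -/
def extD (ω : X.Form) (v w : X.VF) : X.K := v (pair ω w) - w (pair ω v) - pair ω ⁅v, w⁆

variable {X} in
/-- The wedge product of two rational `1`-forms, evaluated on two rational vector fields. -/
def wedge (α β : X.Form) (v w : X.VF) : X.K := pair α v * pair β w - pair α w * pair β v

/-! ## Foliations -/

/-- A (singular) foliation on `X`: a pair of subsheaves `T_F ⊆ T_X` and `N*_F ⊆ Ω¹_X` which are the
annihilators of each other, with `T_F` closed under Lie brackets. As `T_X` and `Ω¹_X` are subsheaves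
of the constant sheaves of rational vector fields and of rational `1`-forms, a subsheaf is given by
its stalks at the points of `X`, subject to the condition that an element of a stalk belongs to the
stalks at all nearby points (in the Zariski topology). -/
@[ext]
structure Foliation where
  /-- the stalks of the tangent sheaf `T_F` -/
  T : (p : X.Point) → Submodule (X.localRing p) X.VF
  /-- the stalks of the conormal sheaf `N*_F` -/
  Nc : (p : X.Point) → Submodule (X.localRing p) X.Form
  T_open : ∀ p, ∀ v ∈ T p, ∃ (d : ℕ) (h : MvPolynomial (Fin (N + 1)) ℂ), h.IsHomogeneous d ∧
    eval p.coords h ≠ 0 ∧ ∀ q : X.Point, eval q.coords h ≠ 0 → v ∈ T q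
  Nc_open : ∀ p, ∀ ω ∈ Nc p, ∃ (d : ℕ) (h : MvPolynomial (Fin (N + 1)) ℂ), h.IsHomogeneous d ∧
    eval p.coords h ≠ 0 ∧ ∀ q : X.Point, eval q.coords h ≠ 0 → ω ∈ Nc q
  mem_T_iff : ∀ p v, v ∈ T p ↔ v ∈ X.vfStalk p ∧ ∀ ω ∈ Nc p, pair ω v = 0
  mem_Nc_iff : ∀ p ω, ω ∈ Nc p ↔ ω ∈ X.formStalk p ∧ ∀ v ∈ T p, pair ω v = 0
  involutive : ∀ p, ∀ v ∈ T p, ∀ w ∈ T p, ⁅v, w⁆ ∈ T p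

namespace Foliation

variable {X Y}
variable (F G : X.Foliation)

/-- The rational sections of the tangent sheaf `T_F`. -/
def ratT : Submodule X.K X.VF := Submodule.span X.K {v | ∃ p, v ∈ F.T p}

/-- The rational sections of the conormal sheaf `N*_F`. -/
def ratNc : Submodule X.K X.Form := Submodule.span X.K {ω | ∃ p, ω ∈ F.Nc p}

/-- The codimension of `F`: the generic rank of the conormal sheaf. -/
def codim : ℕ := Module.finrank X.K F.ratNc

/-- `G` is contained in `F`: the tangent sheaf of `F` contains the tangent sheaf of `G`. -/
def Contains : Prop := ∀ p, G.T p ≤ F.T p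

/-- The singular set of `F`: the points where `Ω¹_X / N*_F` is not locally free. -/
def IsSingularAt (p : X.Point) : Prop :=
  ¬ Module.Free (X.localRing p) (X.formStalk p ⧸ (F.Nc p).comap (X.formStalk p).subtype)

/-- The field `ℂ(X/G)` of rational first integrals: rational functions whose differential is
annihilated by every local section of the tangent sheaf. -/
def firstIntegrals : IntermediateField ℂ X.K where
  carrier := {f | ∀ p, ∀ v ∈ G.T p, v f = 0}
  mul_mem' := fun {f g} hf hg p v hv => by
    rw [Derivation.leibniz, hf p v hv, hg p v hv, smul_zero, smul_zero, add_zero]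
  add_mem' := fun {f g} hf hg p v hv => by rw [map_add, hf p v hv, hg p v hv, add_zero]
  algebraMap_mem' := fun c p v _ => v.map_algebraMap c
  inv_mem' := fun f hf p v hv => by rw [Derivation.leibniz_inv, hf p v hv, smul_zero]

/-- The codimension one foliation `F` is defined by the rational `1`-form `ω`. -/
def DefinedBy (ω : X.Form) : Prop := ω ≠ 0 ∧ F.ratNc = Submodule.span X.K {ω}

/-- `F` is (singularly) transversely affine: it is defined by a rational `1`-form `ω₀` such that
`dω₀ = ω₀ ∧ ω₁` for some closed rational `1`-form `ω₁`. -/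
def TransverselyAffine : Prop :=
  ∃ ω₀ ω₁ : X.Form, F.DefinedBy ω₀ ∧ (∀ v w, extD ω₁ v w = 0) ∧
    ∀ v w, extD ω₀ v w = wedge ω₀ ω₁ v w

/-! ### Bott's partial connection and its eigenspaces -/

/-- Bott's partial connection on the conormal sheaf, dual to `∇_v ξ = [v, ξ] mod T_G` on the normal
sheaf: `⟨∇_v ω, ξ⟩ = v⟨ω, ξ⟩ - ⟨ω, [v, ξ]⟩`. -/
def bott (v : X.VF) (ω : X.Form) (ξ : X.VF) : X.K := v (pair ω ξ) - pair ω ⁅v, ξ⁆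

/-- Rational sections of `Ω¹_G = T_G^*`. -/
abbrev LeafForm : Type := G.ratT →ₗ[X.K] X.K

/-- The eigenspace `E¹_G(η)`: the rational sections `ω` of the conormal sheaf of `G` such that
`∇ω = η ⊗ ω`; a vector space over the field of rational first integrals. -/
def eigenspace (η : G.LeafForm) : Submodule G.firstIntegrals X.Form where
  carrier := {ω | ω ∈ G.ratNc ∧ ∀ (v : G.ratT) (ξ : X.VF), bott v.1 ω ξ = η v * pair ω ξ}
  add_mem' := by
    rintro ω ω' ⟨h, h1⟩ ⟨h', h1'⟩
    refine ⟨add_mem h h', fun v ξ => ?_⟩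
    have e := h1 v ξ
    have e' := h1' v ξ
    simp only [bott, pair, map_add] at e e' ⊢
    linear_combination e + e'
  zero_mem' := ⟨zero_mem _, fun v ξ => by simp [bott, pair]⟩
  smul_mem' := by
    rintro c ω ⟨h, h1⟩
    refine ⟨G.ratNc.smul_mem (c : X.K) h, fun v ξ => ?_⟩
    have e := h1 v ξ
    have hc : v.1 (c : X.K) = 0 := by
      have key : ∀ w ∈ G.ratT, w (c : X.K) = 0 := by
        intro w hw
        induction hw using Submodule.span_induction with
        | mem w hw => obtain ⟨p, hp⟩ := hw; exact c.2 p w hp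
        | zero => rfl
        | add a b _ _ ha hb => rw [Derivation.add_apply, ha, hb, add_zero]
        | smul a b _ hb => rw [Derivation.smul_apply, hb, smul_zero]
      exact key v.1 v.2
    have hs : ∀ w : X.VF, pair (c • ω) w = (c : X.K) * pair ω w := fun w =>
      (w.liftKaehlerDifferential).map_smul (c : X.K) ω
    simp only [bott, hs, Derivation.leibniz, hc, smul_eq_mul] at e ⊢
    linear_combination (c : X.K) * e

/-- `E¹_G(η)` generates `G`: it spans the rational sections of the conormal sheaf over `ℂ(X)`. -/
def GeneratedBy (η : G.LeafForm) : Prop :=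
  Submodule.span X.K (G.eigenspace η : Set X.Form) = G.ratNc

/-- `η` is log-exact: it is the restriction of `df / f` for some rational function `f ≠ 0`. -/
def LogExact (η : G.LeafForm) : Prop :=
  ∃ f : X.K, f ≠ 0 ∧ ∀ v : G.ratT, η v = v.1 f / f

/-! ### Leaves -/

/-- `x` and `y` are joined by a differentiable path in `X ∖ sing(G)`, tangent to `G`: for every time
`t` there is a local section `v` of `T_G` at `γ t` whose value at `γ t` is the velocity of the path,
that is `(f ∘ γ)'(t) = (v f)(γ t)` for all functions `f` regular at `γ t`. -/
def TangentPath (x y : X.Point) : Prop :=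
  ∃ γ : ℝ → X.Point, γ 0 = x ∧ γ 1 = y ∧ ∀ t ∈ Set.Icc (0 : ℝ) 1,
    ¬ G.IsSingularAt (γ t) ∧ ∃ v ∈ G.T (γ t), ∀ f ∈ X.localRing (γ t),
      (∀ᶠ s in nhdsWithin t (Set.Icc (0 : ℝ) 1), f ∈ X.localRing (γ s)) ∧
      HasDerivWithinAt (fun s => X.value f (γ s)) (X.value (v f) (γ t)) (Set.Icc (0 : ℝ) 1) t

/-- The leaf of `G` through a nonsingular point `x`: the points which can be reached from `x` along
finitely many paths tangent to `G`. -/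
def leaf (x : X.Point) : Set X.Point := {y | Relation.ReflTransGen G.TangentPath x y}

/-- The general leaf of `G` is Zariski dense in `X`: so is the leaf through every nonsingular point
in the complement of a countable union of proper closed subvarieties of `X`. -/
def GeneralLeafZariskiDense : Prop :=
  ∃ h : ℕ → MvPolynomial (Fin (N + 1)) ℂ,
    (∀ k, (∃ d, (h k).IsHomogeneous d) ∧ h k ∉ X.ideal) ∧
    ∀ x : X.Point, ¬ G.IsSingularAt x → (∀ k, eval x.coords (h k) ≠ 0) →
      ∀ (d : ℕ) (g : MvPolynomial (Fin (N + 1)) ℂ), g.IsHomogeneous d →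
        (∀ y ∈ G.leaf x, eval y.coords g = 0) → g ∈ X.ideal

/-! ### Foliations of codimension one containing `G` -/

/-- The set of codimension one foliations containing `G`. -/
def CodimOneContaining : Set X.Foliation := {F | F.codim = 1 ∧ F.Contains G}

/-- The set of codimension one foliations containing `G` is parametrized by `ℙ¹(k)`: for suitable
`ω₀, ω₁` in the eigenspace `E¹_G(η)`, linearly independent over `ℂ(X)`, the assignment
`[s : t] ↦` (the foliation defined by `s ω₀ + t ω₁`) is a bijection. -/
def ParametrizedByP1 (η : G.LeafForm) (k : Type) [Field k] [Module k X.Form] : Prop :=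
  ∃ ω : Fin 2 → X.Form, (∀ i, ω i ∈ G.eigenspace η) ∧ LinearIndependent X.K ω ∧
    ∃ Φ : ℙ k (Fin 2 → k) ≃ G.CodimOneContaining,
      ∀ (c : Fin 2 → k) (hc : c ≠ 0), (Φ (Projectivization.mk k c hc)).1.DefinedBy (∑ i, c i • ω i)

end Foliation

/-! ## Dominant rational maps -/

/-- A dominant rational map `X ⇢ Y` between projective varieties, given by homogeneous polynomials
of the same degree: they satisfy the equations of `Y`, and no further ones, on `X`. -/
structure DominantMap where
  deg : ℕ
  coord : Fin (M + 1) → MvPolynomial (Fin (N + 1)) ℂ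
  isHomogeneous : ∀ i, (coord i).IsHomogeneous deg
  mem_iff : ∀ g : MvPolynomial (Fin (M + 1)) ℂ, aeval coord g ∈ X.ideal ↔ g ∈ Y.ideal

namespace DominantMap

variable {X Y}
variable (π : DominantMap X Y)

/-- The induced map from the homogeneous coordinate ring of `Y`. -/
def coordMap : Y.CoordRing →ₐ[ℂ] FractionRing X.CoordRing :=
  Ideal.Quotient.liftₐ Y.ideal (X.cls.comp (aeval π.coord)) fun a ha => by
    rw [AlgHom.comp_apply, X.cls_eq_zero_iff]; exact (π.mem_iff a).2 ha

lemma coordMap_injective : Function.Injective π.coordMap := by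
  rw [injective_iff_map_eq_zero]
  intro a
  obtain ⟨a, rfl⟩ := Ideal.Quotient.mk_surjective a
  intro h
  change X.cls (aeval π.coord a) = 0 at h
  rw [X.cls_eq_zero_iff, π.mem_iff] at h
  exact Ideal.Quotient.eq_zero_iff_mem.2 h

/-- The induced map of fraction fields of homogeneous coordinate rings. -/
def fracMap : FractionRing Y.CoordRing →ₐ[ℂ] FractionRing X.CoordRing :=
  IsFractionRing.liftAlgHom π.coordMap_injective

lemma fracMap_cls (g : MvPolynomial (Fin (M + 1)) ℂ) :
    π.fracMap (Y.cls g) = X.cls (aeval π.coord g) :=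
  IsFractionRing.lift_algebraMap (A := Y.CoordRing) (K := FractionRing Y.CoordRing)
    (g := (π.coordMap : Y.CoordRing →+* FractionRing X.CoordRing)) π.coordMap_injective
    (Ideal.Quotient.mk Y.ideal g)

lemma fracMap_mem (z : Y.K) : π.fracMap (Y.incl z) ∈ X.functionField := by
  obtain ⟨z, d, a, b, ha, hb, hb0, rfl⟩ := z
  refine ⟨π.deg * d, aeval π.coord a, aeval π.coord b, ha.aeval _ π.isHomogeneous,
    hb.aeval _ π.isHomogeneous, fun h => hb0 ((π.mem_iff b).1 h), ?_⟩
  change π.fracMap (Y.cls a / Y.cls b) = _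
  rw [map_div₀, π.fracMap_cls, π.fracMap_cls]

/-- Pull-back of rational functions, `a / b ↦ (a ∘ π) / (b ∘ π)`. -/
def pullback : Y.K →ₐ[ℂ] X.K :=
  (π.fracMap.comp Y.incl).codRestrict X.functionField.toSubalgebra π.fracMap_mem

/-- Pull-back of rational `1`-forms, `f dg ↦ π^*f d(π^*g)`. -/
def pullbackForm : Y.Form →ₗ[ℂ] X.Form :=
  letI := π.pullback.toRingHom.toAlgebra
  haveI : IsScalarTower ℂ Y.K X.K := IsScalarTower.of_algebraMap_eq fun c =>
    (π.pullback.commutes c).symm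
  (KaehlerDifferential.map ℂ ℂ Y.K X.K).restrictScalars ℂ

/-- The foliation `G` is defined by `π`: the rational sections of its conormal sheaf are generated
by the differentials of the rational functions `π^* f`. -/
def Defines (G : X.Foliation) : Prop :=
  G.ratNc = Submodule.span X.K
    (Set.range fun f : Y.K => KaehlerDifferential.D ℂ X.K (π.pullback f))

/-- `F = π^* H`: the rational sections of the conormal sheaf of `F` are generated by the pull-backs
of those of `H`. -/
def IsPullback (F : X.Foliation) (H : Y.Foliation) : Prop :=
  F.ratNc = Submodule.span X.K (π.pullbackForm '' (H.ratNc : Set Y.Form))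

end DominantMap

namespace Foliation

variable {X}
variable (G : X.Foliation)

/-- `ℂ(X/G)` has transcendence degree two, `G` is defined by a rational map to a projective surface,
and all codimension one foliations containing `G` are pull-backs from that surface. -/
def IsPullbackFromSurface : Prop :=
  Algebra.trdeg ℂ G.firstIntegrals = 2 ∧
    ∃ (M : ℕ) (Y : ProjVariety M) (π : DominantMap X Y), Y.dim = 2 ∧ π.Defines G ∧
      ∀ F ∈ G.CodimOneContaining, ∃ H : Y.Foliation, H.codim = 1 ∧ π.IsPullback F H

/-- `ℂ(X/G)` has transcendence degree one, and the codimension one foliations containing `G` are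
transversely affine and parametrized by `ℙ¹(ℂ(X/G))`. -/
def IsAffineOverFirstIntegrals (η : G.LeafForm) : Prop :=
  Algebra.trdeg ℂ G.firstIntegrals = 1 ∧
    (∀ F ∈ G.CodimOneContaining, F.TransverselyAffine) ∧ G.ParametrizedByP1 η G.firstIntegrals

/-- `ℂ(X/G)` has transcendence degree zero, the general leaf of `G` is Zariski dense, and the
codimension one foliations containing `G` are transversely affine and parametrized by `ℙ¹(ℂ)`. -/
def IsAffineWithDenseLeaves (η : G.LeafForm) : Prop :=
  Algebra.trdeg ℂ G.firstIntegrals = 0 ∧ G.GeneralLeafZariskiDense ∧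
    (∀ F ∈ G.CodimOneContaining, F.TransverselyAffine) ∧ G.ParametrizedByP1 η ℂ

end Foliation

end ProjVariety

end

/-! Write `k = ℂ(X/G)`. The conormal sheaf has rank two, so `E(η)` contains a basis `ω₀, ω₁` of its
rational sections. For a conormal form, Bott's derivative along `v ∈ T_G` is the contraction of `dω`
with `v`, so membership in `E(η)` is a condition on `dω`. If `F` contains `G`, scale a defining form
`Σ dᵢ ωᵢ` so that one `dᵢ` is `1`. Since `T_G ⊆ T_F` and `T_F` is involutive, differentiating along
`T_G` multiplies all `dᵢ` by a common factor; the entry `1` makes the factor zero, so the `dᵢ` lie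
in `k`. Conversely, nonzero `k`-combinations are integrable. This gives `ℙ¹(k)` (`exists_definedBy`,
`exists_foliation`, `parametrizedByP1`).

Differentials of algebraically independent first integrals are linearly independent conormal
sections, so `trdeg k ≤ 2`. If `z ∈ k` is not constant and `dz = Σ cᵢ ωᵢ`, then `d(dz) = 0` gives
`v(cᵢ) = -η(v) cᵢ`, so `η` is log-exact (`logExact`); failure of log-exactness therefore forces
degree zero.

Degree two: `dz₀, dz₁` are a basis of the conormal sections, `k` is the function field of a surface
`Y`, and `Σ cᵢ dzᵢ` with `cᵢ ∈ k` is pulled back from `Y` (`isPullbackFromSurface`).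

Degree one: dividing by a function reduces to `η = 0`. For a form `α` in the eigenspace, independent
of `dz`, one gets `dα = h α ∧ dz` with `h ∈ k`, and `h dz` is closed because `dh` is proportional to
`dz` (`transverselyAffine_of_firstIntegral`).

Degree zero: `k = ℂ`. Some `θ` extending `η` satisfies `dωᵢ = θ ∧ ωᵢ`, and absence of nonconstant
first integrals makes it closed (`exists_closed_form`). Density of leaves is a Wronskian argument: a
polynomial vanishing on a leaf has all its derivatives along `G` vanishing there, which for very
general points excludes every polynomial not in the ideal of `X` (`span_isDerivedTuple_eq_top`,
`generalLeafZariskiDense`). -/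

noncomputable section

/-! ## Field extensions and differentials -/

section FieldTheory

open scoped IntermediateField.algebraAdjoinAdjoin in
/-- In characteristic zero, the differentials of the elements of a transcendence basis are a basis
of the Kähler differentials. -/
lemma IsTranscendenceBasis.exists_basis_D {F E ι : Type*} [Field F] [Field E] [Algebra F E]
    [CharZero F] {z : ι → E} (hz : IsTranscendenceBasis F z) :
    ∃ b : Module.Basis ι E (Ω[E⁄F]), ∀ i, b i = KaehlerDifferential.D F E (z i) := by
  let A := Algebra.adjoin F (Set.range z)
  let A' := IntermediateField.adjoin F (Set.range z)
  -- Each map in `F[ι] ≃ A → A' → E` is formally étale: an isomorphism, a localisation, a separable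
  -- algebraic extension. Hence the basis `dXᵢ` base-changes to a basis of `Ω[E⁄F]`.
  have h1 : Algebra.FormallyEtale A A' := .of_isLocalization (nonZeroDivisors _)
  have : Algebra.IsAlgebraic A' E := hz.isAlgebraic_field
  have h2 : Algebra.FormallyEtale A' E := Algebra.FormallyEtale.of_isSeparable _ _
  let : Algebra (MvPolynomial ι F) A := (hz.1.aevalEquiv : MvPolynomial ι F →+* A).toAlgebra
  let : Algebra (MvPolynomial ι F) E := (aeval z : MvPolynomial ι F →ₐ[F] E).toRingHom.toAlgebra
  have : IsScalarTower F (MvPolynomial ι F) E :=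
    IsScalarTower.of_algebraMap_eq fun c => ((aeval z).commutes c).symm
  have : IsScalarTower F (MvPolynomial ι F) A :=
    IsScalarTower.of_algebraMap_eq fun c => (hz.1.aevalEquiv.commutes c).symm
  have : IsScalarTower (MvPolynomial ι F) A E :=
    IsScalarTower.of_algebraMap_eq fun c => (hz.1.algebraMap_aevalEquiv c).symm
  have h3 : Algebra.FormallyEtale (MvPolynomial ι F) A := by
    let e : MvPolynomial ι F ≃ₐ[MvPolynomial ι F] A :=
      AlgEquiv.ofRingEquiv (f := hz.1.aevalEquiv.toRingEquiv) fun _ => rfl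
    exact .of_equiv e
  have h4 : Algebra.FormallyEtale A E := .comp _ A' _
  have h5 : Algebra.FormallyEtale (MvPolynomial ι F) E := .comp _ A _
  refine ⟨((KaehlerDifferential.mvPolynomialBasis F ι).baseChange E).map
    (KaehlerDifferential.tensorKaehlerEquivOfFormallyEtale F (MvPolynomial ι F) E), fun i => ?_⟩
  rw [Module.Basis.map_apply, Module.Basis.baseChange_apply,
    KaehlerDifferential.mvPolynomialBasis_apply,
    KaehlerDifferential.tensorKaehlerEquivOfFormallyEtale_apply,
    KaehlerDifferential.mapBaseChange_tmul, one_smul, KaehlerDifferential.map_D]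
  congr 1
  exact aeval_X z i

/-- In characteristic zero, the differentials of algebraically independent elements are linearly
independent. -/
lemma AlgebraicIndependent.linearIndependent_D {F E ι : Type*} [Field F] [Field E] [Algebra F E]
    [CharZero F] {z : ι → E} (hz : AlgebraicIndependent F z) :
    LinearIndependent E fun i => KaehlerDifferential.D F E (z i) := by
  obtain ⟨s, hs, hb⟩ := exists_isTranscendenceBasis_superset
    ((algebraicIndependent_subtype_range hz.injective).2 hz)
  obtain ⟨b, hb⟩ := hb.exists_basis_D
  have h := b.linearIndependent
  simp only [funext hb] at h
  exact h.comp (fun i => ⟨z i, hs ⟨i, rfl⟩⟩) fun i j hij => hz.injective (congrArg Subtype.val hij)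

/-- Algebraic elements which are linearly independent over `F` remain so over `F(t)`, if `t` is
algebraically independent. -/
lemma LinearIndependent.adjoin_of_algebraicIndependent {F L E ι κ : Type*} [Field F] [Field L]
    [Field E] [Algebra F E] [Algebra F L] [Algebra L E] [IsScalarTower F L E]
    [Algebra.IsAlgebraic F L] {t : ι → E} (ht : AlgebraicIndependent F t) {e : κ → L}
    (he : LinearIndependent F e) :
    LinearIndependent (Algebra.adjoin F (Set.range t)) fun i => algebraMap L E (e i) := by
  -- Independence of `t` survives the algebraic extension `F ⊆ L`, so a relation with coefficients
  -- in `F[t]` is a polynomial identity over `L`, and each monomial gives an `F`-relation among the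
  -- `e i`.
  have hL : AlgebraicIndependent L t := ht.extendScalars L
  rw [linearIndependent_iff']
  intro s g hg i hi
  let P : κ → MvPolynomial ι F := fun i => ht.aevalEquiv.symm (g i)
  have hP : ∀ i, aeval t (P i) = (g i : E) := fun i => by
    rw [← ht.algebraMap_aevalEquiv, AlgEquiv.apply_symm_apply]; rfl
  have h0 : ∑ i ∈ s, C (e i) * MvPolynomial.map (algebraMap F L) (P i) = 0 := by
    refine (injective_iff_map_eq_zero _).1 hL _ ?_
    rw [map_sum, ← hg]
    refine Finset.sum_congr rfl fun i _ => ?_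
    rw [map_mul, aeval_C, aeval_map_algebraMap, hP, mul_comm]
    rfl
  have h1 : P i = 0 := by
    ext m
    have h2 := congrArg (coeff m) h0
    rw [coeff_sum, coeff_zero] at h2
    refine linearIndependent_iff'.1 he s (fun i => coeff m (P i)) ?_ i hi
    rw [← h2]
    refine Finset.sum_congr rfl fun i _ => ?_
    rw [coeff_C_mul, coeff_map, Algebra.smul_def, mul_comm]
  exact (map_eq_zero_iff _ ht.aevalEquiv.symm.injective).1 h1

open scoped IntermediateField.algebraAdjoinAdjoin in
/-- An algebraic extension of `F` inside a finitely generated extension of `F` is finite. -/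
theorem Module.finite_of_essFiniteType_of_isAlgebraic (F L E : Type*) [Field F] [Field L] [Field E]
    [Algebra F E] [Algebra F L] [Algebra L E] [IsScalarTower F L E] [Algebra.IsAlgebraic F L]
    [Algebra.EssFiniteType F E] : Module.Finite F L := by
  obtain ⟨ι, t, ht⟩ := exists_isTranscendenceBasis' L E
  have ht' : IsTranscendenceBasis F t := (Algebra.IsAlgebraic.isTranscendenceBasis_iff F L).2 ht
  let A := IntermediateField.adjoin F (Set.range t)
  have : Algebra.IsAlgebraic A E := ht'.isAlgebraic_field
  have : Algebra.EssFiniteType A E := .of_comp F _ _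
  have : Module.Finite A E := Algebra.finite_of_essFiniteType_of_isAlgebraic
  let b := Module.Free.chooseBasis F L
  -- `E` is finite over `F(t)`, and an `F`-basis of `L` stays independent over `F(t)`, so it is
  -- finite.
  have hb := b.linearIndependent.adjoin_of_algebraicIndependent ht'.1
  have hb' := (LinearIndependent.iff_fractionRing (Algebra.adjoin F (Set.range t)) A).1 hb
  have := hb'.finite
  exact Module.Finite.of_basis b

/-- Subextensions of finitely generated field extensions are finitely generated. -/
theorem Algebra.essFiniteType_of_tower (F L E : Type*) [Field F] [Field L] [Field E] [Algebra F E]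
    [Algebra F L] [Algebra L E] [IsScalarTower F L E] [Algebra.EssFiniteType F E] :
    Algebra.EssFiniteType F L := by
  obtain ⟨ι, s, hs⟩ := exists_isTranscendenceBasis' F L
  have : Finite ι := finite_of_algebraicIndependent (K := F) (x := fun i => algebraMap L E (s i))
    (hs.1.map' (f := IsScalarTower.toAlgHom F L E) (algebraMap L E).injective)
  let F' := IntermediateField.adjoin F (Set.range s)
  have : Algebra.IsAlgebraic F' L := hs.isAlgebraic_field
  have : Algebra.EssFiniteType F' E := .of_comp F _ _
  have : Module.Finite F' L := Module.finite_of_essFiniteType_of_isAlgebraic F' L E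
  have : Algebra.EssFiniteType F F' :=
    IntermediateField.essFiniteType_iff.2 (IntermediateField.fg_adjoin_of_finite (Set.finite_range s))
  exact .comp F F' L

end FieldTheory

/-! ## Points, affine charts and local rings -/

lemma MvPolynomial.IsHomogeneous.aeval_smul_apply {R S σ : Type*} [CommRing R] [CommRing S]
    [Algebra R S] {g : MvPolynomial σ R} {d : ℕ} (hg : g.IsHomogeneous d) (c : S) (x : σ → S) :
    MvPolynomial.aeval (c • x) g = c ^ d * MvPolynomial.aeval x g := by
  rw [aeval_def, aeval_def, eval₂_eq, eval₂_eq, Finset.mul_sum]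
  refine Finset.sum_congr rfl fun m hm => ?_
  have hd : d = ∑ i ∈ m.support, m i := hg.degree_eq_sum_deg_support hm
  rw [hd, ← Finset.prod_pow_eq_pow_sum]
  simp only [Pi.smul_apply, smul_eq_mul, mul_pow, Finset.prod_mul_distrib]
  ring

lemma MvPolynomial.IsHomogeneous.eval_smul {R σ : Type*} [CommRing R]
    {g : MvPolynomial σ R} {d : ℕ} (hg : g.IsHomogeneous d) (c : R) (x : σ → R) :
    eval (c • x) g = c ^ d * eval x g := by
  simpa only [coe_aeval_eq_eval] using! hg.aeval_smul_apply c x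

namespace ProjVariety

variable {N : ℕ} (V : ProjVariety N)

lemma eval_smul_eq_zero {x : Fin (N + 1) → ℂ} (h : ∀ g ∈ V.ideal, eval x g = 0) (c : ℂ) :
    ∀ g ∈ V.ideal, eval (c • x) g = 0 := by
  intro g hg
  rw [← sum_homogeneousComponent g, map_sum]
  refine Finset.sum_eq_zero fun d _ => ?_
  rw [(homogeneousComponent_isHomogeneous d g).eval_smul, h _ (V.isHomogeneous g hg d), mul_zero]

variable {V} in
lemma exists_point_of_vec {x : Fin (N + 1) → ℂ} (hx : x ≠ 0) (h : ∀ g ∈ V.ideal, eval x g = 0) :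
    ∃ p : V.Point, ∃ c : ℂ, c ≠ 0 ∧ p.coords = c • x := by
  obtain ⟨a, ha⟩ := Projectivization.exists_smul_eq_mk_rep ℂ x hx
  refine ⟨⟨Projectivization.mk ℂ x hx, ?_⟩, a, a.ne_zero, ha.symm⟩
  rw [← ha]
  exact V.eval_smul_eq_zero h a

lemma Point.exists_coords_ne_zero {V : ProjVariety N} (p : V.Point) : ∃ j, p.coords j ≠ 0 :=
  Function.ne_iff.1 p.1.rep_nonzero

/-- The homogeneous Nullstellensatz. -/
lemma exists_point {h : MvPolynomial (Fin (N + 1)) ℂ} {d : ℕ} (hd : h.IsHomogeneous d)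
    (hh : h ∉ V.ideal) : ∃ p : V.Point, eval p.coords h ≠ 0 := by
  obtain ⟨i, hi⟩ := V.nonempty
  -- The extra factor keeps the point found by the affine Nullstellensatz away from the origin.
  have hm : h * MvPolynomial.X i ∉ V.ideal := fun hm => (V.isPrime.mem_or_mem hm).elim hh hi
  rw [← MvPolynomial.IsPrime.vanishingIdeal_zeroLocus (K := ℂ) V.ideal,
    mem_vanishingIdeal_iff] at hm
  push Not at hm
  obtain ⟨x, hx, hne⟩ := hm
  rw [mem_zeroLocus_iff] at hx
  change eval x _ ≠ 0 at hne
  rw [map_mul, eval_X] at hne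
  have hx0 : x ≠ 0 := by rintro rfl; exact hne (by simp)
  obtain ⟨p, c, hc, hp⟩ := exists_point_of_vec hx0 hx
  refine ⟨p, ?_⟩
  rw [hp, hd.eval_smul]
  exact mul_ne_zero (pow_ne_zero _ hc) (left_ne_zero_of_mul hne)

/-- The filter of Zariski neighbourhoods of a point. -/
def zariskiNhds (p : V.Point) : Filter V.Point where
  sets := {S | ∃ (d : ℕ) (h : MvPolynomial (Fin (N + 1)) ℂ), h.IsHomogeneous d ∧
    eval p.coords h ≠ 0 ∧ ∀ q : V.Point, eval q.coords h ≠ 0 → q ∈ S}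
  univ_sets := ⟨0, 1, isHomogeneous_one _ _, by simp, fun _ _ => trivial⟩
  sets_of_superset := fun ⟨d, h, h1, h2, h3⟩ hs => ⟨d, h, h1, h2, fun q hq => hs (h3 q hq)⟩
  inter_sets := fun ⟨d, h, h1, h2, h3⟩ ⟨e, k, k1, k2, k3⟩ =>
    ⟨d + e, h * k, h1.mul k1, by rw [map_mul]; exact mul_ne_zero h2 k2, fun q hq => by
      rw [map_mul] at hq
      exact ⟨h3 q (left_ne_zero_of_mul hq), k3 q (right_ne_zero_of_mul hq)⟩⟩

/-- The filter of nonempty Zariski open subsets. -/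
def generic : Filter V.Point where
  sets := {S | ∃ (d : ℕ) (h : MvPolynomial (Fin (N + 1)) ℂ), h.IsHomogeneous d ∧
    h ∉ V.ideal ∧ ∀ q : V.Point, eval q.coords h ≠ 0 → q ∈ S}
  univ_sets := ⟨0, 1, isHomogeneous_one _ _, fun h => V.isPrime.ne_top
    ((Ideal.eq_top_iff_one _).2 h), fun _ _ => trivial⟩
  sets_of_superset := fun ⟨d, h, h1, h2, h3⟩ hs => ⟨d, h, h1, h2, fun q hq => hs (h3 q hq)⟩
  -- Irreducibility enters here: the ideal is prime, so nonempty open sets meet in a nonempty open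
  -- set.
  inter_sets := fun ⟨d, h, h1, h2, h3⟩ ⟨e, k, k1, k2, k3⟩ =>
    ⟨d + e, h * k, h1.mul k1, fun hm => (V.isPrime.mem_or_mem hm).elim h2 k2, fun q hq => by
      rw [map_mul] at hq
      exact ⟨h3 q (left_ne_zero_of_mul hq), k3 q (right_ne_zero_of_mul hq)⟩⟩

lemma eventually_zariskiNhds {p : V.Point} {P : V.Point → Prop} :
    (∀ᶠ q in V.zariskiNhds p, P q) ↔ ∃ (d : ℕ) (h : MvPolynomial (Fin (N + 1)) ℂ),
      h.IsHomogeneous d ∧ eval p.coords h ≠ 0 ∧ ∀ q : V.Point, eval q.coords h ≠ 0 → P q := Iff.rfl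

lemma eventually_generic {P : V.Point → Prop} :
    (∀ᶠ q in V.generic, P q) ↔ ∃ (d : ℕ) (h : MvPolynomial (Fin (N + 1)) ℂ),
      h.IsHomogeneous d ∧ h ∉ V.ideal ∧ ∀ q : V.Point, eval q.coords h ≠ 0 → P q := Iff.rfl

lemma generic_le_zariskiNhds (p : V.Point) : V.generic ≤ V.zariskiNhds p :=
  fun _ ⟨d, h, h1, h2, h3⟩ => ⟨d, h, h1, p.not_mem h2, h3⟩

instance : V.generic.NeBot := by
  rw [Filter.neBot_iff]
  intro h
  obtain ⟨d, h, h1, h2, h3⟩ := Filter.empty_mem_iff_bot.2 h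
  obtain ⟨p, hp⟩ := V.exists_point h1 h2
  exact h3 p hp

/-- The rational function `X_i / X_j`. -/
def aff (j i : Fin (N + 1)) : V.K :=
  ⟨V.cls (MvPolynomial.X i) / V.cls (MvPolynomial.X j), by
    by_cases hj : (MvPolynomial.X j : MvPolynomial (Fin (N + 1)) ℂ) ∈ V.ideal
    · rw [(V.cls_eq_zero_iff _).2 hj, div_zero]; exact zero_mem _
    · exact ⟨1, _, _, isHomogeneous_X _ _, isHomogeneous_X _ _, hj, rfl⟩⟩

lemma incl_aff (j i : Fin (N + 1)) :
    V.incl (V.aff j i) = V.cls (MvPolynomial.X i) / V.cls (MvPolynomial.X j) := rfl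

lemma incl_aeval_aff (j : Fin (N + 1)) {a : MvPolynomial (Fin (N + 1)) ℂ} {d : ℕ}
    (ha : a.IsHomogeneous d) :
    V.incl (aeval (V.aff j) a) = V.cls a / V.cls (MvPolynomial.X j) ^ d := by
  have h1 : V.incl (aeval (V.aff j) a) =
      aeval ((V.cls (MvPolynomial.X j))⁻¹ • fun i => V.cls (MvPolynomial.X i)) a := by
    rw [comp_aeval_apply]
    congr 2
    ext i
    simp [incl_aff, div_eq_inv_mul]
  have h2 : V.cls a = aeval (fun i => V.cls (MvPolynomial.X i)) a := by
    conv_lhs => rw [← aeval_X_left_apply a]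
    rw [comp_aeval_apply]
  rw [h1, ha.aeval_smul_apply, ← h2, inv_pow, div_eq_inv_mul]

lemma aeval_aff_eq_zero_iff {j : Fin (N + 1)}
    (hj : (MvPolynomial.X j : MvPolynomial (Fin (N + 1)) ℂ) ∉ V.ideal)
    {a : MvPolynomial (Fin (N + 1)) ℂ} {d : ℕ} (ha : a.IsHomogeneous d) :
    aeval (V.aff j) a = 0 ↔ a ∈ V.ideal := by
  rw [← V.cls_eq_zero_iff, ← map_eq_zero_iff _ (RingHom.injective V.incl.toRingHom)]
  rw [← V.cls_eq_zero_iff] at hj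
  change V.incl _ = 0 ↔ _
  rw [V.incl_aeval_aff j ha, div_eq_zero_iff, or_iff_left (pow_ne_zero _ hj)]

lemma aeval_aff_of_mem {j : Fin (N + 1)}
    (hj : (MvPolynomial.X j : MvPolynomial (Fin (N + 1)) ℂ) ∉ V.ideal)
    {a : MvPolynomial (Fin (N + 1)) ℂ} (ha : a ∈ V.ideal) : aeval (V.aff j) a = 0 := by
  rw [← sum_homogeneousComponent a, map_sum]
  refine Finset.sum_eq_zero fun d _ => ?_
  rw [V.aeval_aff_eq_zero_iff hj (homogeneousComponent_isHomogeneous d a)]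
  exact V.isHomogeneous a ha d

/-- The powers of `X_j` produced by dehomogenising cancel, since both degrees agree. This passes
from homogeneous fractions to the affine chart. -/
lemma eq_aeval_aff_div {j : Fin (N + 1)}
    (hj : (MvPolynomial.X j : MvPolynomial (Fin (N + 1)) ℂ) ∉ V.ideal)
    {z : V.K} {a b : MvPolynomial (Fin (N + 1)) ℂ} {d : ℕ} (ha : a.IsHomogeneous d)
    (hb : b.IsHomogeneous d) (hz : V.incl z = V.cls a / V.cls b) :
    z = aeval (V.aff j) a / aeval (V.aff j) b := by
  apply RingHom.injective V.incl.toRingHom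
  rw [← V.cls_eq_zero_iff] at hj
  change V.incl _ = V.incl _
  rw [hz, map_div₀, V.incl_aeval_aff j ha, V.incl_aeval_aff j hb,
    div_div_div_cancel_right₀ (pow_ne_zero _ hj)]

lemma exists_fraction (z : V.K) : ∃ (d : ℕ) (a b : MvPolynomial (Fin (N + 1)) ℂ),
    a.IsHomogeneous d ∧ b.IsHomogeneous d ∧ b ∉ V.ideal ∧ V.incl z = V.cls a / V.cls b := z.2

lemma adjoin_range_aff {j : Fin (N + 1)}
    (hj : (MvPolynomial.X j : MvPolynomial (Fin (N + 1)) ℂ) ∉ V.ideal) :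
    IntermediateField.adjoin ℂ (Set.range (V.aff j)) = ⊤ := by
  rw [eq_top_iff]
  intro z _
  obtain ⟨d, a, b, ha, hb, -, hz⟩ := V.exists_fraction z
  have h : ∀ c, aeval (V.aff j) c ∈ IntermediateField.adjoin ℂ (Set.range (V.aff j)) := fun c =>
    IntermediateField.algebra_adjoin_le_adjoin _ _ (by
      rw [Algebra.adjoin_range_eq_range_aeval]; exact ⟨c, rfl⟩)
  rw [V.eq_aeval_aff_div hj ha hb hz]
  exact div_mem (h a) (h b)

/-- Finite generation makes the space of rational forms finite-dimensional, hence reflexive, as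
`exists_form` needs. It is also inherited by subfields of `ℂ(X)`. -/
instance : Algebra.EssFiniteType ℂ V.K := by
  obtain ⟨j, hj⟩ := V.nonempty
  rw [← IntermediateField.fg_top_iff, ← V.adjoin_range_aff hj]
  exact IntermediateField.fg_adjoin_of_finite (Set.finite_range _)

/-! ### Values -/

variable {V}

lemma Point.X_not_mem {p : V.Point} {j : Fin (N + 1)} (hj : p.coords j ≠ 0) :
    (MvPolynomial.X j : MvPolynomial (Fin (N + 1)) ℂ) ∉ V.ideal :=
  p.not_mem (by rwa [eval_X])

/-- The value at `p`, as a homomorphism on the local ring. -/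
def evalAt (p : V.Point) : V.localRing p →ₐ[ℂ] ℂ where
  toFun z := V.value z p
  map_one' := by
    rw [V.value_eq _ p (a := 1) (b := 1)]
    · simp
    · exact ⟨⟨0, isHomogeneous_one _ _, isHomogeneous_one _ _⟩, by simp, by simp⟩
  map_mul' := by
    rintro ⟨z, a, b, h⟩ ⟨w, a', b', h'⟩
    rw [V.value_eq z p h, V.value_eq w p h', V.value_eq _ p (a := a * a') (b := b * b')]
    · rw [map_mul, map_mul, div_mul_div_comm]
    · obtain ⟨⟨d, ha, hb⟩, hb0, hz⟩ := h
      obtain ⟨⟨e, ha', hb'⟩, hb0', hz'⟩ := h'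
      refine ⟨⟨d + e, ha.mul ha', hb.mul hb'⟩, ?_, ?_⟩
      · rw [map_mul]; exact mul_ne_zero hb0 hb0'
      · change V.incl (z * w) = _
        rw [map_mul, hz, hz', map_mul, map_mul, div_mul_div_comm]
  map_zero' := by
    rw [V.value_eq _ p (a := 0) (b := 1)]
    · simp
    · exact ⟨⟨0, isHomogeneous_zero _ _ _, isHomogeneous_one _ _⟩, by simp, by simp⟩
  map_add' := by
    rintro ⟨z, a, b, h⟩ ⟨w, a', b', h'⟩
    rw [V.value_eq z p h, V.value_eq w p h',
      V.value_eq _ p (a := a * b' + b * a') (b := b * b')]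
    · rw [map_add, map_mul, map_mul, map_mul, div_add_div _ _ h.2.1 h'.2.1]
    · obtain ⟨⟨d, ha, hb⟩, hb0, hz⟩ := h
      obtain ⟨⟨e, ha', hb'⟩, hb0', hz'⟩ := h'
      refine ⟨⟨d + e, (ha.mul hb').add (hb.mul ha'), hb.mul hb'⟩, ?_, ?_⟩
      · rw [map_mul]; exact mul_ne_zero hb0 hb0'
      · have h := p.not_mem hb0
        have h' := p.not_mem hb0'
        rw [← V.cls_eq_zero_iff] at h h'
        change V.incl (z + w) = _
        rw [map_add, hz, hz', map_add, map_mul, map_mul, map_mul,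
          div_add_div _ _ h h']
  commutes' := fun c => by
    rw [V.value_eq _ p (a := C c) (b := 1)]
    · simp
    · refine ⟨⟨0, isHomogeneous_C _ _, isHomogeneous_one _ _⟩, by simp, ?_⟩
      rw [map_one, div_one]
      exact (V.incl.commutes c).trans (V.cls.commutes c).symm

lemma evalAt_apply (p : V.Point) (z : V.localRing p) : evalAt p z = V.value z p := rfl

lemma inv_mem_localRing {p : V.Point} {z : V.K} (hz : z ∈ V.localRing p) (h : V.value z p ≠ 0) :
    z⁻¹ ∈ V.localRing p := by
  obtain ⟨a, b, hab⟩ := hz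
  rw [V.value_eq z p hab] at h
  obtain ⟨⟨d, ha, hb⟩, hb0, hz⟩ := hab
  exact ⟨b, a, ⟨d, hb, ha⟩, (div_ne_zero_iff.1 h).1, by rw [map_inv₀, hz, inv_div]⟩

lemma value_inv {p : V.Point} {z : V.K} (hz : z ∈ V.localRing p) (h : V.value z p ≠ 0) :
    V.value z⁻¹ p = (V.value z p)⁻¹ := by
  obtain ⟨a, b, hab⟩ := hz
  have h' := h
  rw [V.value_eq z p hab] at h ⊢
  obtain ⟨⟨d, ha, hb⟩, hb0, hz⟩ := hab
  rw [V.value_eq z⁻¹ p (a := b) (b := a), inv_div]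
  exact ⟨⟨d, hb, ha⟩, (div_ne_zero_iff.1 h).1, by rw [map_inv₀, hz, inv_div]⟩

lemma value_mul {p : V.Point} {z w : V.K} (hz : z ∈ V.localRing p) (hw : w ∈ V.localRing p) :
    V.value (z * w) p = V.value z p * V.value w p :=
  map_mul (evalAt p) ⟨z, hz⟩ ⟨w, hw⟩

/-- The affine coordinates of `p` with respect to the hyperplane `X_j = 0`. -/
def Point.affCoords (p : V.Point) (j : Fin (N + 1)) : Fin (N + 1) → ℂ :=
  (p.coords j)⁻¹ • p.coords

lemma isFraction_aff {p : V.Point} {j : Fin (N + 1)} (hj : p.coords j ≠ 0) (i : Fin (N + 1)) :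
    V.IsFraction p (V.aff j i) (MvPolynomial.X i) (MvPolynomial.X j) :=
  ⟨⟨1, isHomogeneous_X _ _, isHomogeneous_X _ _⟩, by rwa [eval_X], V.incl_aff j i⟩

lemma aeval_aff_mem {p : V.Point} {j : Fin (N + 1)} (hj : p.coords j ≠ 0)
    (a : MvPolynomial (Fin (N + 1)) ℂ) : aeval (V.aff j) a ∈ V.localRing p := by
  have h : ∀ i, V.aff j i ∈ V.localRing p := fun i => ⟨_, _, isFraction_aff hj i⟩
  have : aeval (V.aff j) a = (V.localRing p).val (aeval (fun i => ⟨V.aff j i, h i⟩) a) := by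
    rw [comp_aeval_apply]; rfl
  rw [this]
  exact Subtype.mem _

lemma value_aeval_aff {p : V.Point} {j : Fin (N + 1)} (hj : p.coords j ≠ 0)
    (a : MvPolynomial (Fin (N + 1)) ℂ) :
    V.value (aeval (V.aff j) a) p = eval (p.affCoords j) a := by
  have h : ∀ i, V.aff j i ∈ V.localRing p := fun i => ⟨_, _, isFraction_aff hj i⟩
  have : aeval (V.aff j) a = (V.localRing p).val (aeval (fun i => ⟨V.aff j i, h i⟩) a) := by
    rw [comp_aeval_apply]; rfl
  rw [this]
  change evalAt p _ = _
  rw [comp_aeval_apply, ← coe_aeval_eq_eval]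
  change _ = aeval _ a
  congr 2
  ext i
  change V.value (V.aff j i) p = _
  rw [V.value_eq _ p (isFraction_aff hj i), eval_X, eval_X, div_eq_inv_mul]
  rfl

lemma eval_affCoords {p : V.Point} (j : Fin (N + 1))
    {a : MvPolynomial (Fin (N + 1)) ℂ} {d : ℕ} (ha : a.IsHomogeneous d) :
    eval (p.affCoords j) a = (p.coords j)⁻¹ ^ d * eval p.coords a :=
  ha.eval_smul _ _

lemma eventually_mem_localRing {p : V.Point} {z : V.K} (hz : z ∈ V.localRing p) :
    ∀ᶠ q in V.zariskiNhds p, z ∈ V.localRing q := by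
  obtain ⟨a, b, ⟨d, ha, hb⟩, hb0, hz⟩ := hz
  exact ⟨d, b, hb, hb0, fun q hq => ⟨a, b, ⟨d, ha, hb⟩, hq, hz⟩⟩

lemma generic_mem_localRing (z : V.K) : ∀ᶠ q in V.generic, z ∈ V.localRing q := by
  obtain ⟨d, a, b, ha, hb, hb0, hz⟩ := V.exists_fraction z
  exact ⟨d, b, hb, hb0, fun q hq => ⟨a, b, ⟨d, ha, hb⟩, hq, hz⟩⟩

lemma generic_coords_ne_zero {j : Fin (N + 1)}
    (hj : (MvPolynomial.X j : MvPolynomial (Fin (N + 1)) ℂ) ∉ V.ideal) :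
    ∀ᶠ q in V.generic, q.coords j ≠ 0 :=
  ⟨1, MvPolynomial.X j, isHomogeneous_X _ _, hj, fun q hq => by rwa [eval_X] at hq⟩

lemma eventually_coords_ne_zero {p : V.Point} {j : Fin (N + 1)} (hj : p.coords j ≠ 0) :
    ∀ᶠ q in V.zariskiNhds p, q.coords j ≠ 0 :=
  ⟨1, MvPolynomial.X j, isHomogeneous_X _ _, by rwa [eval_X], fun q hq => by rwa [eval_X] at hq⟩

/-- Every rational function is a fraction of functions regular at `p`. -/
lemma exists_mul_mem_localRing (p : V.Point) (z : V.K) :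
    ∃ c ∈ V.localRing p, c ≠ 0 ∧ c * z ∈ V.localRing p := by
  obtain ⟨j, hj⟩ := p.exists_coords_ne_zero
  obtain ⟨d, a, b, ha, hb, hb0, hz⟩ := V.exists_fraction z
  have hb1 : aeval (V.aff j) b ≠ 0 := fun h => hb0 ((V.aeval_aff_eq_zero_iff (Point.X_not_mem hj) hb).1 h)
  refine ⟨_, aeval_aff_mem hj b, hb1, ?_⟩
  rw [V.eq_aeval_aff_div (Point.X_not_mem hj) ha hb hz, mul_div_cancel₀ _ hb1]
  exact aeval_aff_mem hj a

end ProjVariety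

namespace ProjVariety

variable {N : ℕ} {V : ProjVariety N}

/-! ## Stalks of vector fields and of forms -/

lemma pair_D (f : V.K) (v : V.VF) : pair (KaehlerDifferential.D ℂ V.K f) v = v f :=
  v.liftKaehlerDifferential_comp_D f

lemma pair_add (α β : V.Form) (v : V.VF) : pair (α + β) v = pair α v + pair β v :=
  map_add v.liftKaehlerDifferential α β

lemma pair_sub (α β : V.Form) (v : V.VF) : pair (α - β) v = pair α v - pair β v :=
  map_sub v.liftKaehlerDifferential α β

lemma pair_neg (α : V.Form) (v : V.VF) : pair (-α) v = - pair α v :=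
  map_neg v.liftKaehlerDifferential α

lemma pair_smul (c : V.K) (α : V.Form) (v : V.VF) : pair (c • α) v = c * pair α v :=
  map_smul v.liftKaehlerDifferential c α

lemma pair_zero (v : V.VF) : pair (0 : V.Form) v = 0 := map_zero v.liftKaehlerDifferential

/-- Contraction with forms, as the isomorphism from vector fields to the dual of forms. -/
def vfDual : V.VF ≃ₗ[V.K] Module.Dual V.K V.Form :=
  (KaehlerDifferential.linearMapEquivDerivation ℂ V.K).symm

lemma vfDual_apply (v : V.VF) (ω : V.Form) : vfDual v ω = pair ω v := rfl

lemma pair_add_right (α : V.Form) (v w : V.VF) : pair α (v + w) = pair α v + pair α w := by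
  simp only [← vfDual_apply, map_add, LinearMap.add_apply]

lemma pair_sub_right (α : V.Form) (v w : V.VF) : pair α (v - w) = pair α v - pair α w := by
  simp only [← vfDual_apply, map_sub, LinearMap.sub_apply]

lemma pair_neg_right (α : V.Form) (v : V.VF) : pair α (-v) = - pair α v := by
  simp only [← vfDual_apply, map_neg, LinearMap.neg_apply]

lemma pair_smul_right (c : V.K) (α : V.Form) (v : V.VF) : pair α (c • v) = c * pair α v := by
  simp only [← vfDual_apply, map_smul, LinearMap.smul_apply, smul_eq_mul]

lemma pair_zero_right (α : V.Form) : pair α (0 : V.VF) = 0 := by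
  simp only [← vfDual_apply, map_zero, LinearMap.zero_apply]

/-- The annihilator of a space of rational `1`-forms. -/
def annVF (W : Submodule V.K V.Form) : Submodule V.K V.VF where
  carrier := {v | ∀ ω ∈ W, pair ω v = 0}
  add_mem' hv hw ω hω := by rw [pair_add_right, hv ω hω, hw ω hω, add_zero]
  zero_mem' ω _ := pair_zero_right ω
  smul_mem' c v hv ω hω := by rw [pair_smul_right, hv ω hω, mul_zero]

lemma mem_annVF {W : Submodule V.K V.Form} {v : V.VF} : v ∈ annVF W ↔ ∀ ω ∈ W, pair ω v = 0 :=
  Iff.rfl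

/-- Over a field a linear functional separates a vector from a subspace, and by `vfDual` every
functional on forms is contraction with a vector field. -/
lemma mem_of_forall_annVF {W : Submodule V.K V.Form} {ω : V.Form}
    (h : ∀ v ∈ annVF W, pair ω v = 0) : ω ∈ W := by
  by_contra hω
  obtain ⟨f, hf, hW⟩ := Submodule.exists_dual_map_eq_bot_of_notMem hω inferInstance
  refine hf ?_
  have := h (vfDual.symm f) fun α hα => ?_
  · rwa [← vfDual_apply, LinearEquiv.apply_symm_apply] at this
  · rw [← vfDual_apply, LinearEquiv.apply_symm_apply]
    have : f α ∈ W.map f := ⟨α, hα, rfl⟩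
    rwa [hW] at this

/-! ### Stalks in an affine chart. -/

section

variable {p : V.Point} {j : Fin (N + 1)}

/-- In the chart the polynomials need no longer be homogeneous: a denominator that is nonzero at `p`
is a unit of the local ring. -/
lemma mem_localRing_iff_exists_affine (hj : p.coords j ≠ 0) {f : V.K} :
    f ∈ V.localRing p ↔ ∃ a b : MvPolynomial (Fin (N + 1)) ℂ, eval (p.affCoords j) b ≠ 0 ∧
      f = aeval (V.aff j) a / aeval (V.aff j) b := by
  constructor
  · rintro ⟨a, b, ⟨d, ha, hb⟩, hb0, hz⟩
    refine ⟨a, b, ?_, V.eq_aeval_aff_div (Point.X_not_mem hj) ha hb hz⟩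
    rw [eval_affCoords j hb]
    exact mul_ne_zero (pow_ne_zero _ (inv_ne_zero hj)) hb0
  · rintro ⟨a, b, hb, rfl⟩
    rw [div_eq_mul_inv]
    exact mul_mem (aeval_aff_mem hj a)
      (inv_mem_localRing (aeval_aff_mem hj b) (by rwa [value_aeval_aff hj]))

lemma aeval_aff_ne_zero (hj : p.coords j ≠ 0) {b : MvPolynomial (Fin (N + 1)) ℂ}
    (hb : eval (p.affCoords j) b ≠ 0) : aeval (V.aff j) b ≠ 0 := by
  intro h
  rw [← value_aeval_aff hj, h] at hb
  exact hb (map_zero (evalAt p))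

lemma derivation_aeval_aff (v : V.VF) (j : Fin (N + 1)) (a : MvPolynomial (Fin (N + 1)) ℂ) :
    v (aeval (V.aff j) a) = ∑ i, aeval (V.aff j) (pderiv i a) * v (V.aff j i) := by
  induction a using MvPolynomial.induction_on with
  | C c => simp
  | add a b ha hb => simp [ha, hb, add_mul, Finset.sum_add_distrib]
  | mul_X a i ha =>
    rw [map_mul, v.leibniz, ha, aeval_X]
    simp only [(pderiv _).leibniz, pderiv_X, map_add, smul_eq_mul, map_mul, aeval_X, add_mul,
      Finset.sum_add_distrib, Finset.mul_sum]
    congr 1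
    · rw [Finset.sum_eq_single i]
      · simp
      · intro k _ hk
        simp [hk.symm]
      · simp
    · exact Finset.sum_congr rfl fun k _ => by ring

lemma mem_vfStalk_of_aff (hj : p.coords j ≠ 0) {v : V.VF}
    (h : ∀ i, v (V.aff j i) ∈ V.localRing p) : v ∈ V.vfStalk p := by
  intro f hf
  obtain ⟨a, b, hb, rfl⟩ := (mem_localRing_iff_exists_affine hj).1 hf
  have hv : ∀ c, v (aeval (V.aff j) c) ∈ V.localRing p := fun c => by
    rw [derivation_aeval_aff]
    exact sum_mem fun i _ => mul_mem (aeval_aff_mem hj _) (h i)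
  have hb' : (aeval (V.aff j) b)⁻¹ ∈ V.localRing p :=
    inv_mem_localRing (aeval_aff_mem hj b) (by rwa [value_aeval_aff hj])
  rw [div_eq_mul_inv, v.leibniz, v.leibniz_inv, smul_eq_mul, smul_eq_mul, smul_eq_mul]
  exact add_mem (mul_mem (aeval_aff_mem hj a) (mul_mem (neg_mem (pow_mem hb' 2)) (hv b)))
    (mul_mem hb' (hv a))

lemma mem_vfStalk_iff (hj : p.coords j ≠ 0) {v : V.VF} :
    v ∈ V.vfStalk p ↔ ∀ i, v (V.aff j i) ∈ V.localRing p := by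
  refine ⟨fun h i => h _ ?_, mem_vfStalk_of_aff hj⟩
  rw [← aeval_X (R := ℂ) (V.aff j) i]
  exact aeval_aff_mem hj _

lemma eventually_mem_vfStalk {v : V.VF} (hv : v ∈ V.vfStalk p) :
    ∀ᶠ q in V.zariskiNhds p, v ∈ V.vfStalk q := by
  obtain ⟨j, hj⟩ := p.exists_coords_ne_zero
  rw [mem_vfStalk_iff hj] at hv
  filter_upwards [eventually_coords_ne_zero hj,
    Filter.eventually_all.2 fun i => eventually_mem_localRing (hv i)] with q hq h
  exact mem_vfStalk_of_aff hq h

lemma D_mem_formStalk {f : V.K} (hf : f ∈ V.localRing p) :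
    KaehlerDifferential.D ℂ V.K f ∈ V.formStalk p := Submodule.subset_span ⟨f, hf, rfl⟩

lemma eventually_mem_formStalk {ω : V.Form} (hω : ω ∈ V.formStalk p) :
    ∀ᶠ q in V.zariskiNhds p, ω ∈ V.formStalk q := by
  induction hω using Submodule.span_induction with
  | mem ω h =>
    obtain ⟨f, hf, rfl⟩ := h
    filter_upwards [eventually_mem_localRing hf] with q hq
    exact D_mem_formStalk hq
  | zero => exact .of_forall fun q => zero_mem _
  | add a b _ _ ha hb =>
    filter_upwards [ha, hb] with q h1 h2 using add_mem h1 h2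
  | smul c a _ ha =>
    filter_upwards [ha, eventually_mem_localRing c.2] with q h1 h2
    exact (V.formStalk q).smul_mem ⟨c, h2⟩ h1

-- Clears the denominators of the finitely many `v(X_i / X_j)`. Together with its analogue for
-- forms, it lets the stalk at any one point span all rational sections.
variable (p) in
lemma exists_smul_mem_vfStalk (v : V.VF) : ∃ c : V.K, c ≠ 0 ∧ c • v ∈ V.vfStalk p := by
  obtain ⟨j, hj⟩ := p.exists_coords_ne_zero
  choose c hc hc0 hcv using fun i => V.exists_mul_mem_localRing p (v (V.aff j i))
  refine ⟨∏ i, c i, Finset.prod_ne_zero_iff.2 fun i _ => hc0 i, mem_vfStalk_of_aff hj fun i => ?_⟩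
  rw [Derivation.smul_apply, smul_eq_mul, ← Finset.prod_erase_mul _ _ (Finset.mem_univ i),
    mul_assoc]
  exact mul_mem (prod_mem fun i _ => hc i) (hcv i)

variable (p) in
lemma exists_smul_mem_formStalk (ω : V.Form) : ∃ c : V.K, c ≠ 0 ∧ c • ω ∈ V.formStalk p := by
  have hω : ω ∈ Submodule.span V.K (Set.range (KaehlerDifferential.D ℂ V.K)) := by
    rw [KaehlerDifferential.span_range_derivation]; trivial
  suffices h : ∃ c ∈ V.localRing p, c ≠ 0 ∧ c • ω ∈ V.formStalk p by
    obtain ⟨c, -, h⟩ := h; exact ⟨c, h⟩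
  induction hω using Submodule.span_induction with
  | mem ω h =>
    obtain ⟨f, rfl⟩ := h
    obtain ⟨c, hc, hc0, hcf⟩ := V.exists_mul_mem_localRing p f
    refine ⟨c * c, mul_mem hc hc, mul_ne_zero hc0 hc0, ?_⟩
    -- One factor `c` is not enough: `c df = d(cf) - f dc`, where `f` may still have a pole.
    have : (c * c) • KaehlerDifferential.D ℂ V.K f =
        c • KaehlerDifferential.D ℂ V.K (c * f) - (c * f) • KaehlerDifferential.D ℂ V.K c := by
      rw [Derivation.leibniz, smul_add, smul_smul, smul_smul, add_sub_cancel_right]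
    rw [this]
    exact sub_mem ((V.formStalk p).smul_mem ⟨c, hc⟩ (D_mem_formStalk hcf))
      ((V.formStalk p).smul_mem ⟨_, hcf⟩ (D_mem_formStalk hc))
  | zero => exact ⟨1, one_mem _, one_ne_zero, by rw [smul_zero]; exact zero_mem _⟩
  | add a b _ _ ha hb =>
    obtain ⟨c, hc, hc0, h⟩ := ha
    obtain ⟨c', hc', hc0', h'⟩ := hb
    refine ⟨c * c', mul_mem hc hc', mul_ne_zero hc0 hc0', ?_⟩
    rw [smul_add, mul_comm, mul_smul, mul_comm, mul_smul]
    exact add_mem ((V.formStalk p).smul_mem ⟨c', hc'⟩ h) ((V.formStalk p).smul_mem ⟨c, hc⟩ h')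
  | smul k a _ ha =>
    obtain ⟨c, hc, hc0, h⟩ := ha
    obtain ⟨c', hc', hc0', h'⟩ := V.exists_mul_mem_localRing p k
    refine ⟨c * c', mul_mem hc hc', mul_ne_zero hc0 hc0', ?_⟩
    rw [smul_smul, mul_assoc, mul_comm, mul_smul]
    exact (V.formStalk p).smul_mem ⟨_, h'⟩ h

end

/-! ## Foliations and their rational sections -/

namespace Foliation

variable (F G : V.Foliation)

/-- The two local sections may live at different points. Both extend to nonempty open sets, which
meet, and they annihilate each other at a common point. -/
lemma pair_eq_zero {ω : V.Form} (hω : ω ∈ F.ratNc) {v : V.VF} (hv : v ∈ F.ratT) :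
    pair ω v = 0 := by
  induction hω using Submodule.span_induction with
  | zero => exact pair_zero v
  | add a b _ _ ha hb => rw [pair_add, ha, hb, add_zero]
  | smul c a _ ha => rw [pair_smul, ha, mul_zero]
  | mem ω h =>
    obtain ⟨p, hp⟩ := h
    induction hv using Submodule.span_induction with
    | zero => exact pair_zero_right ω
    | add a b _ _ ha hb => rw [pair_add_right, ha, hb, add_zero]
    | smul c a _ ha => rw [pair_smul_right, ha, mul_zero]
    | mem v h =>
      obtain ⟨q, hq⟩ := h
      have h1 : ∀ᶠ r in V.generic, ω ∈ F.Nc r := V.generic_le_zariskiNhds p (F.Nc_open p ω hp)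
      have h2 : ∀ᶠ r in V.generic, v ∈ F.T r := V.generic_le_zariskiNhds q (F.T_open q v hq)
      obtain ⟨r, hr, hr'⟩ := (h1.and h2).exists
      exact ((F.mem_T_iff r v).1 hr').2 ω hr

/-- The mutual annihilator conditions make the stalks saturated. Hence a foliation is determined by
its rational conormal sections, and questions about it become linear algebra over `ℂ(X)`. -/
lemma mem_T {p : V.Point} {v : V.VF} : v ∈ F.T p ↔ v ∈ V.vfStalk p ∧ v ∈ F.ratT := by
  refine ⟨fun h => ⟨((F.mem_T_iff p v).1 h).1, Submodule.subset_span ⟨p, h⟩⟩, fun h => ?_⟩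
  exact (F.mem_T_iff p v).2 ⟨h.1, fun ω hω => F.pair_eq_zero (Submodule.subset_span ⟨p, hω⟩) h.2⟩

lemma mem_Nc {p : V.Point} {ω : V.Form} : ω ∈ F.Nc p ↔ ω ∈ V.formStalk p ∧ ω ∈ F.ratNc := by
  refine ⟨fun h => ⟨((F.mem_Nc_iff p ω).1 h).1, Submodule.subset_span ⟨p, h⟩⟩, fun h => ?_⟩
  exact (F.mem_Nc_iff p ω).2 ⟨h.1, fun v hv => F.pair_eq_zero h.2 (Submodule.subset_span ⟨p, hv⟩)⟩

variable (V) in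
lemma _root_.ProjVariety.nonempty_point : Nonempty V.Point := V.generic.nonempty_of_neBot

lemma mem_ratT {v : V.VF} : v ∈ F.ratT ↔ ∀ ω ∈ F.ratNc, pair ω v = 0 := by
  refine ⟨fun h ω hω => F.pair_eq_zero hω h, fun h => ?_⟩
  obtain ⟨p⟩ := V.nonempty_point
  obtain ⟨c, hc, hcv⟩ := exists_smul_mem_vfStalk p v
  rw [← Submodule.smul_mem_iff _ hc]
  refine Submodule.subset_span ⟨p, (F.mem_T_iff p _).2 ⟨hcv, fun ω hω => ?_⟩⟩
  rw [pair_smul_right, h ω (Submodule.subset_span ⟨p, hω⟩), mul_zero]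

lemma ratT_eq : F.ratT = annVF F.ratNc := Submodule.ext fun _ => F.mem_ratT

lemma mem_ratNc {ω : V.Form} : ω ∈ F.ratNc ↔ ∀ v ∈ F.ratT, pair ω v = 0 := by
  refine ⟨fun h v hv => F.pair_eq_zero h hv, fun h => ?_⟩
  rw [ratT_eq] at h
  exact mem_of_forall_annVF h

lemma eq_of_ratNc_eq {F G : V.Foliation} (h : F.ratNc = G.ratNc) : F = G := by
  ext p x
  · rw [F.mem_T, G.mem_T, F.ratT_eq, G.ratT_eq, h]
  · rw [F.mem_Nc, G.mem_Nc, h]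

lemma contains_iff : F.Contains G ↔ F.ratNc ≤ G.ratNc := by
  constructor
  · intro h ω hω
    rw [G.mem_ratNc]
    intro v hv
    refine F.pair_eq_zero hω ?_
    refine Submodule.span_mono ?_ hv
    rintro v ⟨p, hp⟩
    exact ⟨p, h p hp⟩
  · intro h p v hv
    rw [G.mem_T, G.mem_ratT] at hv
    exact F.mem_T.2 ⟨hv.1, F.mem_ratT.2 fun ω hω => hv.2 ω (h hω)⟩

/-- Involutivity is given on stalks, so denominators are cleared first; the Leibniz terms this
creates are multiples of `v` and `w`. -/
lemma lie_mem_ratT {v w : V.VF} (hv : v ∈ F.ratT) (hw : w ∈ F.ratT) : ⁅v, w⁆ ∈ F.ratT := by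
  obtain ⟨p⟩ := V.nonempty_point
  obtain ⟨c, hc, hcv⟩ := exists_smul_mem_vfStalk p v
  obtain ⟨d, hd, hdw⟩ := exists_smul_mem_vfStalk p w
  have h := F.involutive p _ (F.mem_T.2 ⟨hcv, F.ratT.smul_mem c hv⟩) _
    (F.mem_T.2 ⟨hdw, F.ratT.smul_mem d hw⟩)
  have h1 : ⁅c • v, d • w⁆ ∈ F.ratT := Submodule.subset_span ⟨p, h⟩
  have h2 : ⁅c • v, d • w⁆ = (c * d) • ⁅v, w⁆ + (c * v d) • w - (d * w c) • v := by
    ext f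
    simp only [Derivation.commutator_apply, Derivation.smul_apply, Derivation.add_apply,
      Derivation.sub_apply, smul_eq_mul, Derivation.leibniz]
    ring
  rw [h2] at h1
  have h3 := (Submodule.sub_mem_iff_left _ (F.ratT.smul_mem _ hv)).1 h1
  have h4 := (Submodule.add_mem_iff_left _ (F.ratT.smul_mem _ hw)).1 h3
  exact (Submodule.smul_mem_iff _ (mul_ne_zero hc hd)).1 h4

/-- The foliation with a given space of rational sections of the conormal sheaf. -/
def ofConormal (W : Submodule V.K V.Form)
    (hW : ∀ v ∈ annVF W, ∀ w ∈ annVF W, ⁅v, w⁆ ∈ annVF W) : V.Foliation where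
  T p :=
    { carrier := {v | v ∈ V.vfStalk p ∧ v ∈ annVF W}
      add_mem' := fun h h' => ⟨add_mem h.1 h'.1, add_mem h.2 h'.2⟩
      zero_mem' := ⟨zero_mem _, zero_mem _⟩
      smul_mem' := fun c _ h => ⟨(V.vfStalk p).smul_mem c h.1, (annVF W).smul_mem (c : V.K) h.2⟩ }
  Nc p :=
    { carrier := {ω | ω ∈ V.formStalk p ∧ ω ∈ W}
      add_mem' := fun h h' => ⟨add_mem h.1 h'.1, add_mem h.2 h'.2⟩
      zero_mem' := ⟨zero_mem _, zero_mem _⟩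
      smul_mem' := fun c _ h => ⟨(V.formStalk p).smul_mem c h.1, W.smul_mem (c : V.K) h.2⟩ }
  T_open p v hv := V.eventually_zariskiNhds.1 <| by
    filter_upwards [eventually_mem_vfStalk hv.1] with q hq using ⟨hq, hv.2⟩
  Nc_open p ω hω := V.eventually_zariskiNhds.1 <| by
    filter_upwards [eventually_mem_formStalk hω.1] with q hq using ⟨hq, hω.2⟩
  mem_T_iff p v := by
    refine ⟨fun h => ⟨h.1, fun ω hω => h.2 ω hω.2⟩, fun h => ⟨h.1, fun ω hω => ?_⟩⟩
    obtain ⟨c, hc, hcω⟩ := exists_smul_mem_formStalk p ω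
    have h1 := h.2 (c • ω) ⟨hcω, W.smul_mem c hω⟩
    rw [pair_smul] at h1
    exact (mul_eq_zero.1 h1).resolve_left hc
  mem_Nc_iff p ω := by
    refine ⟨fun h => ⟨h.1, fun v hv => hv.2 ω h.2⟩,
      fun h => ⟨h.1, mem_of_forall_annVF fun v hv => ?_⟩⟩
    obtain ⟨c, hc, hcv⟩ := exists_smul_mem_vfStalk p v
    have h1 := h.2 (c • v) ⟨hcv, (annVF W).smul_mem c hv⟩
    rw [pair_smul_right] at h1
    exact (mul_eq_zero.1 h1).resolve_left hc
  involutive p v hv w hw := ⟨fun f hf => by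
      rw [Derivation.commutator_apply]
      exact sub_mem (hv.1 _ (hw.1 f hf)) (hw.1 _ (hv.1 f hf)), hW v hv.2 w hw.2⟩

lemma ratNc_ofConormal (W : Submodule V.K V.Form)
    (hW : ∀ v ∈ annVF W, ∀ w ∈ annVF W, ⁅v, w⁆ ∈ annVF W) : (ofConormal W hW).ratNc = W := by
  apply le_antisymm
  · rw [ratNc, Submodule.span_le]
    rintro ω ⟨p, hp⟩
    exact hp.2
  · intro ω hω
    obtain ⟨p⟩ := V.nonempty_point
    obtain ⟨c, hc, hcω⟩ := exists_smul_mem_formStalk p ω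
    rw [← Submodule.smul_mem_iff _ hc]
    exact Submodule.subset_span ⟨p, hcω, W.smul_mem c hω⟩

lemma mem_firstIntegrals {f : V.K} : f ∈ G.firstIntegrals ↔ ∀ v ∈ G.ratT, v f = 0 := by
  refine ⟨fun h v hv => ?_, fun h p v hv => h v (G.mem_T.1 hv).2⟩
  induction hv using Submodule.span_induction with
  | mem w hw => obtain ⟨p, hp⟩ := hw; exact h p w hp
  | zero => rfl
  | add a b _ _ ha hb => rw [Derivation.add_apply, ha, hb, add_zero]
  | smul a b _ hb => rw [Derivation.smul_apply, hb, smul_zero]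

lemma mem_firstIntegrals_iff_D {f : V.K} :
    f ∈ G.firstIntegrals ↔ KaehlerDifferential.D ℂ V.K f ∈ G.ratNc := by
  rw [mem_firstIntegrals, mem_ratNc]
  simp only [pair_D]

end Foliation

end ProjVariety

namespace ProjVariety

variable {N : ℕ} {V : ProjVariety N}

/-! ## Exterior derivatives -/

lemma lie_smul_left (c : V.K) (v w : V.VF) : ⁅c • v, w⁆ = c • ⁅v, w⁆ - w c • v := by
  ext f
  simp only [Derivation.commutator_apply, Derivation.smul_apply, Derivation.sub_apply,
    smul_eq_mul, Derivation.leibniz]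
  ring

lemma extD_swap (ω : V.Form) (v w : V.VF) : extD ω w v = -extD ω v w := by
  rw [extD, extD, ← lie_skew w v, pair_neg_right]
  ring

lemma extD_self (ω : V.Form) (v : V.VF) : extD ω v v = 0 := by
  rw [extD, lie_self, pair_zero_right]
  ring

lemma extD_add_left (ω : V.Form) (v v' w : V.VF) :
    extD ω (v + v') w = extD ω v w + extD ω v' w := by
  simp only [extD, add_lie, pair_add_right, Derivation.add_apply, map_add]
  ring

lemma extD_smul_left (ω : V.Form) (c : V.K) (v w : V.VF) :
    extD ω (c • v) w = c * extD ω v w := by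
  simp only [extD, lie_smul_left, pair_sub_right, pair_smul_right, Derivation.smul_apply,
    Derivation.leibniz, smul_eq_mul]
  ring

lemma extD_add_right (ω : V.Form) (v w w' : V.VF) :
    extD ω v (w + w') = extD ω v w + extD ω v w' := by
  rw [extD_swap, extD_add_left, extD_swap ω v w, extD_swap ω v w']
  ring

lemma extD_smul_right (ω : V.Form) (c : V.K) (v w : V.VF) :
    extD ω v (c • w) = c * extD ω v w := by
  rw [extD_swap, extD_smul_left, extD_swap ω v w]
  ring

lemma extD_add (α β : V.Form) (v w : V.VF) : extD (α + β) v w = extD α v w + extD β v w := by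
  simp only [extD, pair_add, map_add]
  ring

lemma extD_smul (c : V.K) (α : V.Form) (v w : V.VF) :
    extD (c • α) v w = c * extD α v w + (v c * pair α w - w c * pair α v) := by
  simp only [extD, pair_smul, Derivation.leibniz, smul_eq_mul]
  ring

lemma extD_zero (v w : V.VF) : extD (0 : V.Form) v w = 0 := by
  simp only [extD, pair_zero, map_zero, sub_zero]

lemma extD_neg (α : V.Form) (v w : V.VF) : extD (-α) v w = -extD α v w := by
  simp only [extD, pair_neg, map_neg]
  ring

lemma extD_D (f : V.K) (v w : V.VF) : extD (KaehlerDifferential.D ℂ V.K f) v w = 0 := by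
  rw [extD, pair_D, pair_D, pair_D, Derivation.commutator_apply, sub_self]

/-- `d ∘ d = 0`. -/
lemma extD_cocycle (ω : V.Form) (u v w : V.VF) :
    u (extD ω v w) - v (extD ω u w) + w (extD ω u v)
      - extD ω ⁅u, v⁆ w + extD ω ⁅u, w⁆ v - extD ω ⁅v, w⁆ u = 0 := by
  have h : pair ω ⁅⁅u, v⁆, w⁆ - pair ω ⁅⁅u, w⁆, v⁆ + pair ω ⁅⁅v, w⁆, u⁆ = 0 := by
    rw [← pair_sub_right, ← pair_add_right, ← pair_zero_right ω]
    congr 1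
    ext f
    simp only [Derivation.commutator_apply, Derivation.sub_apply, Derivation.add_apply, map_sub,
      Derivation.zero_apply]
    ring
  simp only [extD, map_sub, Derivation.commutator_apply]
  linear_combination h

lemma exists_dual {ι : Type*} [DecidableEq ι] {ω : ι → V.Form} (h : LinearIndependent V.K ω) :
    ∃ ξ : ι → V.VF, ∀ i j, pair (ω i) (ξ j) = if i = j then 1 else 0 := by
  have hf : ∀ j, ∃ f : Module.Dual V.K V.Form, ∀ i, f (ω i) = if i = j then 1 else 0 := fun j => by
    obtain ⟨f, hf⟩ := LinearMap.exists_extend ((Module.Basis.span h).coord j)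
    refine ⟨f, fun i => ?_⟩
    have := LinearMap.congr_fun hf (Module.Basis.span h i)
    rw [LinearMap.comp_apply, Module.Basis.coord_apply, Module.Basis.repr_self,
      Finsupp.single_apply, Submodule.subtype_apply, Module.Basis.span_apply] at this
    exact this
  choose f hf using hf
  refine ⟨fun j => vfDual.symm (f j), fun i j => ?_⟩
  rw [← vfDual_apply, LinearEquiv.apply_symm_apply, hf]

lemma annVF_span_singleton {ω : V.Form} {v : V.VF} :
    v ∈ annVF (Submodule.span V.K {ω}) ↔ pair ω v = 0 := by
  refine ⟨fun h => h ω (Submodule.mem_span_singleton_self ω), fun h α hα => ?_⟩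
  obtain ⟨c, rfl⟩ := Submodule.mem_span_singleton.1 hα
  rw [pair_smul, h, mul_zero]

namespace Foliation

variable {F G : V.Foliation}

/-! ## Eigenspaces of Bott's connection -/

variable {η : G.LeafForm}

/-- Because `ω(v) = 0`, the term `ξ(ω(v))` drops out of `dω(v, ξ)`, and what remains is Bott's
formula. -/
lemma extD_of_mem_eigenspace {ω : V.Form} (hω : ω ∈ G.eigenspace η) {v : V.VF} (hv : v ∈ G.ratT)
    (ξ : V.VF) : extD ω v ξ = η ⟨v, hv⟩ * pair ω ξ := by
  rw [← hω.2 ⟨v, hv⟩ ξ, extD, bott, G.pair_eq_zero hω.1 hv, map_zero, sub_zero]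

lemma mem_eigenspace_iff {ω : V.Form} : ω ∈ G.eigenspace η ↔ ω ∈ G.ratNc ∧
    ∀ (v : G.ratT) (ξ : V.VF), extD ω v ξ = η v * pair ω ξ := by
  refine ⟨fun h => ⟨h.1, fun v ξ => extD_of_mem_eigenspace h v.2 ξ⟩, fun h => ⟨h.1, fun v ξ => ?_⟩⟩
  rw [← h.2, extD, bott, G.pair_eq_zero h.1 v.2, map_zero, sub_zero]

/-- A basis of the rational sections of the conormal sheaf which consists of eigenvectors of Bott's
connection. -/
structure IsEigenbasis (η : G.LeafForm) (ω : Fin 2 → V.Form) : Prop where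
  mem : ∀ i, ω i ∈ G.eigenspace η
  linearIndependent : LinearIndependent V.K ω
  span_eq : Submodule.span V.K (Set.range ω) = G.ratNc

lemma isEigenbasis_of_linearIndependent (hG : G.codim = 2) {ω : Fin 2 → V.Form}
    (hω : ∀ i, ω i ∈ G.eigenspace η) (hli : LinearIndependent V.K ω) : IsEigenbasis η ω := by
  refine ⟨hω, hli, ?_⟩
  have hle : Submodule.span V.K (Set.range ω) ≤ G.ratNc := by
    rw [Submodule.span_le]; rintro _ ⟨i, rfl⟩; exact (hω i).1
  have : Module.Finite V.K G.ratNc := Module.finite_of_finrank_pos (by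
    change 0 < G.codim; rw [hG]; exact two_pos)
  refine Submodule.eq_of_le_of_finrank_eq hle ?_
  rw [finrank_span_eq_card hli, Fintype.card_fin]
  exact hG.symm

lemma exists_isEigenbasis (hG : G.codim = 2) (hη : G.GeneratedBy η) :
    ∃ ω : Fin 2 → V.Form, IsEigenbasis η ω := by
  obtain ⟨b, hb, hspan, hli⟩ := exists_linearIndependent V.K (G.eigenspace η : Set V.Form)
  rw [hη] at hspan
  have hcard : Nat.card b = 2 := by
    rw [← Module.finrank_eq_nat_card_basis (Module.Basis.span hli), Subtype.range_coe, hspan]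
    exact hG
  have : Finite b := Nat.finite_of_card_ne_zero (by rw [hcard]; exact two_ne_zero)
  let e : Fin 2 ≃ b := (Finite.equivFinOfCardEq hcard).symm
  exact ⟨_, isEigenbasis_of_linearIndependent hG (fun i => hb (e i).2)
    (hli.comp e e.injective)⟩

namespace IsEigenbasis

variable {ω : Fin 2 → V.Form} (hω : IsEigenbasis η ω)

include hω

lemma exists_eq_sum {α : V.Form} (hα : α ∈ G.ratNc) : ∃ c : Fin 2 → V.K, α = ∑ i, c i • ω i := by
  rw [← hω.span_eq, Submodule.mem_span_range_iff_exists_fun] at hα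
  obtain ⟨c, hc⟩ := hα
  exact ⟨c, hc.symm⟩

lemma sum_inj {c d : Fin 2 → V.K} (h : ∑ i, c i • ω i = ∑ i, d i • ω i) : c = d :=
  hω.linearIndependent.fintypeLinearCombination_injective h

lemma sum_mem (c : Fin 2 → V.K) : ∑ i, c i • ω i ∈ G.ratNc :=
  Submodule.sum_mem _ fun i _ => G.ratNc.smul_mem _ (hω.mem i).1

lemma sum_mem_eigenspace {c : Fin 2 → V.K} (hc : ∀ i, c i ∈ G.firstIntegrals) :
    ∑ i, c i • ω i ∈ G.eigenspace η :=
  Submodule.sum_mem _ fun i _ => (G.eigenspace η).smul_mem (⟨c i, hc i⟩ : G.firstIntegrals) (hω.mem i)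

lemma sum_ne_zero {c : Fin 2 → V.K} (hc : c ≠ 0) : ∑ i, c i • ω i ≠ 0 := by
  intro h
  exact hc (hω.sum_inj (d := 0) (by rw [h]; simp))

lemma exists_span_pair {c : Fin 2 → V.K} (hc : c ≠ 0) :
    ∃ i, ∀ α ∈ G.ratNc, ∃ a b : V.K, α = a • (∑ i, c i • ω i) + b • ω i := by
  obtain ⟨l, hl⟩ := Function.ne_iff.1 hc
  -- `1 - l` is the other index of `Fin 2`; as `c l ≠ 0`, the form `ω l` is recovered from the sum
  -- and the other `ω`.
  refine ⟨1 - l, fun α hα => ?_⟩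
  obtain ⟨d, rfl⟩ := hω.exists_eq_sum hα
  have hl' : c l ≠ 0 := hl
  refine ⟨d l / c l, d (1 - l) - d l / c l * c (1 - l), ?_⟩
  fin_cases l
  · simp only [Fin.sum_univ_two, smul_add, smul_smul, Fin.zero_eta, sub_zero, sub_smul] at hl' ⊢
    rw [div_mul_cancel₀ _ hl']
    abel
  · simp only [Fin.sum_univ_two, smul_add, smul_smul, Fin.mk_one, sub_self, sub_smul] at hl' ⊢
    rw [div_mul_cancel₀ _ hl']
    abel

/-- Forms in the eigenspace are integrable. -/
lemma lie_mem_annVF {c : Fin 2 → V.K} (hc0 : c ≠ 0) (hc : ∀ i, c i ∈ G.firstIntegrals)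
    {v w : V.VF} (hv : pair (∑ i, c i • ω i) v = 0) (hw : pair (∑ i, c i • ω i) w = 0) :
    pair (∑ i, c i • ω i) ⁅v, w⁆ = 0 := by
  obtain ⟨i, hi⟩ := hω.exists_span_pair hc0
  have hα := hω.sum_mem_eigenspace hc
  generalize ∑ i, c i • ω i = α at *
  have hT : ∀ u, pair α u = 0 → pair (ω i) u = 0 → u ∈ G.ratT := fun u h1 h2 => by
    rw [G.mem_ratT]
    intro β hβ
    obtain ⟨a, b, rfl⟩ := hi β hβ
    rw [pair_add, pair_smul, pair_smul, h1, h2, mul_zero, mul_zero, add_zero]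
  -- The kernel of `α` is `T_G` plus one direction. If `w ∉ T_G`, then `ωᵢ(w) v - ωᵢ(v) w` is
  -- tangent to `G`, and contracting `dα` with it and `w` gives a multiple of `α(w) = 0`.
  have key : extD α v w = 0 := by
    by_cases h : pair (ω i) w = 0
    · rw [extD_swap, extD_of_mem_eigenspace hα (hT w hw h), hv, mul_zero, neg_zero]
    · have hu : pair (ω i) w • v + (-pair (ω i) v) • w ∈ G.ratT := by
        apply hT
        · rw [pair_add_right, pair_smul_right, pair_smul_right, hv, hw, mul_zero, mul_zero,
            add_zero]
        · rw [pair_add_right, pair_smul_right, pair_smul_right]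
          ring
      have h1 := extD_of_mem_eigenspace hα hu w
      rw [extD_add_left, extD_smul_left, extD_smul_left, extD_self, mul_zero, add_zero, hw,
        mul_zero] at h1
      exact (mul_eq_zero.1 h1).resolve_left h
  rw [extD, hv, hw, map_zero, map_zero, sub_zero, zero_sub, neg_eq_zero] at key
  exact key

lemma exists_foliation {c : Fin 2 → V.K} (hc0 : c ≠ 0) (hc : ∀ i, c i ∈ G.firstIntegrals) :
    ∃ F ∈ G.CodimOneContaining, F.DefinedBy (∑ i, c i • ω i) := by
  let W := Submodule.span V.K {∑ i, c i • ω i}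
  have hW : ∀ v ∈ annVF W, ∀ w ∈ annVF W, ⁅v, w⁆ ∈ annVF W := fun v hv w hw => by
    rw [annVF_span_singleton] at hv hw ⊢
    exact hω.lie_mem_annVF hc0 hc hv hw
  have h := ratNc_ofConormal W hW
  refine ⟨ofConormal W hW, ⟨?_, ?_⟩, hω.sum_ne_zero hc0, h⟩
  · rw [codim, h]
    exact finrank_span_singleton (hω.sum_ne_zero hc0)
  · rw [contains_iff, h, Submodule.span_singleton_le_iff_mem]
    exact hω.sum_mem c

/-- Codimension one foliations containing `G` are defined by forms in the eigenspace. -/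
lemma exists_definedBy (hF : F ∈ G.CodimOneContaining) :
    ∃ c : Fin 2 → V.K, c ≠ 0 ∧ (∀ i, c i ∈ G.firstIntegrals) ∧ F.DefinedBy (∑ i, c i • ω i) := by
  obtain ⟨hF1, hF2⟩ := hF
  rw [contains_iff] at hF2
  obtain ⟨⟨α, hα⟩, hα0, hspan⟩ := finrank_eq_one_iff'.1 hF1
  have hα0' : α ≠ 0 := fun h => hα0 (Subtype.ext h)
  have hαspan : ∀ β ∈ F.ratNc, ∃ c : V.K, c • α = β := fun β hβ => by
    obtain ⟨c, hc⟩ := hspan ⟨β, hβ⟩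
    exact ⟨c, congrArg Subtype.val hc⟩
  obtain ⟨c, rfl⟩ := hω.exists_eq_sum (hF2 hα)
  have hc0 : c ≠ 0 := by rintro rfl; exact hα0' (by simp)
  obtain ⟨l, hl⟩ := Function.ne_iff.1 hc0
  have hl' : c l ≠ 0 := hl
  -- The entry `d l = 1` has zero derivative, which will kill the proportionality factor `r`.
  let d : Fin 2 → V.K := fun i => (c l)⁻¹ * c i
  have hdl : d l = 1 := inv_mul_cancel₀ hl'
  have hd0 : d ≠ 0 := fun h => by rw [h] at hdl; exact zero_ne_one hdl
  have hdα : ∑ i, d i • ω i = (c l)⁻¹ • ∑ i, c i • ω i := by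
    rw [Finset.smul_sum]; exact Finset.sum_congr rfl fun i _ => mul_smul _ _ _
  have hdF : F.ratNc = Submodule.span V.K {∑ i, d i • ω i} := by
    apply le_antisymm
    · intro β hβ
      obtain ⟨e, rfl⟩ := hαspan β hβ
      rw [Submodule.mem_span_singleton]
      exact ⟨e * c l, by rw [hdα, smul_smul, mul_inv_cancel_right₀ hl']⟩
    · rw [Submodule.span_singleton_le_iff_mem, hdα]
      exact F.ratNc.smul_mem _ hα
  refine ⟨d, hd0, fun i => ?_, hω.sum_ne_zero hd0, hdF⟩
  rw [mem_firstIntegrals]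
  intro v hv
  have hvF : v ∈ F.ratT := by
    rw [mem_ratT] at hv ⊢; exact fun ω h => hv ω (hF2 h)
  -- With `α = Σ dᵢ ωᵢ`, Bott's derivative of `α` along `v` is `Σ v(dᵢ) ωᵢ + η(v) α`. It annihilates
  -- `T_F` because `v ∈ T_F` and `T_F` is involutive; so the first summand does too.
  have h1 : ∑ i, v (d i) • ω i ∈ F.ratNc := by
    rw [mem_ratNc]
    intro ξ hξ
    have hd : ∑ i, d i • ω i ∈ F.ratNc := hdF ▸ Submodule.mem_span_singleton_self _
    have h2 := F.pair_eq_zero hd (F.lie_mem_ratT hvF hξ)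
    have h3 := F.pair_eq_zero hd hξ
    have h4 : v (pair (∑ i, d i • ω i) ξ) = 0 := by rw [h3, map_zero]
    have h5 := fun i => (hω.mem i).2 ⟨v, hv⟩ ξ
    simp only [bott] at h5
    simp only [Fin.sum_univ_two, pair_add, pair_smul, map_add, Derivation.leibniz,
      smul_eq_mul] at h2 h3 h4 ⊢
    linear_combination h4 - h2 - d 0 * h5 0 - d 1 * h5 1 - η ⟨v, hv⟩ * h3
  rw [hdF, Submodule.mem_span_singleton] at h1
  obtain ⟨r, hr⟩ := h1
  have h2 : (fun i => r * d i) = fun i => v (d i) := hω.sum_inj (by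
    rw [← hr, Finset.smul_sum]; exact Finset.sum_congr rfl fun i _ => mul_smul _ _ _)
  have hr0 : r = 0 := by
    have := congrFun h2 l
    rwa [hdl, mul_one, ← map_one (algebraMap ℂ V.K), v.map_algebraMap] at this
  rw [← congrFun h2 i, hr0, zero_mul]

/-- The codimension one foliations containing `G` are parametrized by `ℙ¹(ℂ(X/G))`. -/
theorem parametrizedByP1 (k : Type) [Field k] [Module k V.Form] (φ : k →+* V.K)
    (hφ : ∀ (c : k) (α : V.Form), c • α = φ c • α)
    (hk : ∀ z : V.K, z ∈ G.firstIntegrals ↔ ∃ c : k, φ c = z) :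
    G.ParametrizedByP1 η k := by
  refine ⟨ω, hω.mem, hω.linearIndependent, ?_⟩
  have hsum : ∀ c : Fin 2 → k, ∑ i, c i • ω i = ∑ i, φ (c i) • ω i := fun c =>
    Finset.sum_congr rfl fun i _ => hφ (c i) (ω i)
  have h0 : ∀ {c : Fin 2 → k}, c ≠ 0 → (fun i => φ (c i)) ≠ 0 := fun hc h =>
    hc (funext fun i => (map_eq_zero _).1 (congrFun h i))
  have hex : ∀ p : ℙ k (Fin 2 → k), ∃ F : G.CodimOneContaining,
      F.1.DefinedBy (∑ i, p.rep i • ω i) := fun p => by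
    obtain ⟨F, hF, h⟩ := hω.exists_foliation (h0 p.rep_nonzero) fun i => (hk _).2 ⟨_, rfl⟩
    exact ⟨⟨F, hF⟩, by rwa [hsum]⟩
  choose Φ hΦ using hex
  have hmk : ∀ (c : Fin 2 → k) (hc : c ≠ 0),
      (Φ (Projectivization.mk k c hc)).1.DefinedBy (∑ i, c i • ω i) := fun c hc => by
    obtain ⟨a, ha⟩ := Projectivization.exists_smul_eq_mk_rep k c hc
    have h := hΦ (Projectivization.mk k c hc)
    have ha' : φ a ≠ 0 := (map_ne_zero _).2 a.ne_zero
    have : ∑ i, (Projectivization.mk k c hc).rep i • ω i =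
        φ a • ∑ i, c i • ω i := by
      rw [← ha, hsum, hsum, Finset.smul_sum]
      exact Finset.sum_congr rfl fun i _ => by rw [smul_smul, ← map_mul]; rfl
    rw [this] at h
    refine ⟨(smul_ne_zero_iff.1 h.1).2, h.2.trans ?_⟩
    exact Submodule.span_singleton_smul_eq (IsUnit.mk0 _ ha') _
  refine ⟨Equiv.ofBijective Φ ⟨fun p q hpq => ?_, fun F => ?_⟩, hmk⟩
  · have hp := hΦ p
    have hq := hΦ q
    rw [hpq] at hp
    have hm : ∑ i, p.rep i • ω i ∈ Submodule.span V.K {∑ i, q.rep i • ω i} := by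
      rw [← hq.2, hp.2]; exact Submodule.mem_span_singleton_self _
    obtain ⟨r, hr⟩ := Submodule.mem_span_singleton.1 hm
    rw [hsum, hsum, Finset.smul_sum] at hr
    have hr' : (fun i => r * φ (q.rep i)) = fun i => φ (p.rep i) :=
      hω.sum_inj (by rw [← hr]; exact Finset.sum_congr rfl fun i _ => mul_smul _ _ _)
    -- The factor `r` lies a priori in `ℂ(X)`; a nonzero coordinate of `q` shows that it comes from
    -- `k`.
    obtain ⟨l, hl⟩ := Function.ne_iff.1 q.rep_nonzero
    have hl' : φ (q.rep l) ≠ 0 := (map_ne_zero _).2 hl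
    have hrk : r = φ (p.rep l / q.rep l) := by
      rw [map_div₀, eq_div_iff hl']; exact congrFun hr' l
    rw [← p.mk_rep, ← q.mk_rep, Projectivization.mk_eq_mk_iff']
    refine ⟨p.rep l / q.rep l, funext fun i => φ.injective ?_⟩
    rw [← congrFun hr' i, hrk]
    exact map_mul _ _ _
  · obtain ⟨c, hc0, hc, hcF⟩ := hω.exists_definedBy F.2
    choose d hd using fun i => (hk _).1 (hc i)
    have hd0 : d ≠ 0 := by rintro rfl; exact hc0 (funext fun i => by rw [← hd i]; simp)
    refine ⟨Projectivization.mk k d hd0, Subtype.ext (eq_of_ratNc_eq ?_)⟩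
    have := (hmk d hd0).2
    rw [hsum] at this
    simp only [hd] at this
    rw [this, hcF.2]

end IsEigenbasis

end Foliation

end ProjVariety

namespace ProjVariety

variable {N : ℕ} {V : ProjVariety N}

/-! ### Wedge identities and frames. -/

instance : CharZero V.K := charZero_of_injective_algebraMap (algebraMap ℂ V.K).injective

lemma extD_eq_zero_of_D {α : V.Form} {f g : V.K} (h : α = f • KaehlerDifferential.D ℂ V.K g)
    (hf : ∃ c : V.K, KaehlerDifferential.D ℂ V.K f = c • KaehlerDifferential.D ℂ V.K g)
    (v w : V.VF) : extD α v w = 0 := by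
  obtain ⟨c, hc⟩ := hf
  have hD : ∀ u : V.VF, u f = c * u g := fun u => by rw [← pair_D, hc, pair_smul, pair_D]
  rw [h, extD_smul, extD_D, pair_D, pair_D, hD, hD]
  ring

/-- If `dω = θ ∧ ω` then `dθ ∧ ω = 0`. -/
lemma extD_wedge_eq_zero {ω θ : V.Form} (h : ∀ v w, extD ω v w = wedge θ ω v w) (x y z : V.VF) :
    extD θ x y * pair ω z - extD θ x z * pair ω y + extD θ y z * pair ω x = 0 := by
  have hc := extD_cocycle ω x y z
  have h1 := h x y
  have h2 := h x z
  have h3 := h y z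
  rw [h, h, h, h, h, h] at hc
  simp only [extD, wedge, map_sub, Derivation.leibniz, smul_eq_mul] at hc h1 h2 h3 ⊢
  linear_combination hc + pair θ z * h1 - pair θ y * h2 + pair θ x * h3

/-- Splits `v` and `w` into their components along `ξ` and remainders. When `ξ` is dual to an
eigenbasis the remainders lie in `T_G`, so `dτ` is known from its contractions with `T_G` and the
single value `dτ(ξ₀, ξ₁)`. -/
lemma extD_expand (τ : V.Form) (ω : Fin 2 → V.Form) (ξ : Fin 2 → V.VF) (v w : V.VF) :
    extD τ v w =
    extD τ (ξ 0) (ξ 1) * wedge (ω 0) (ω 1) v w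
      + extD τ (v - (pair (ω 0) v • ξ 0 + pair (ω 1) v • ξ 1)) w
      - extD τ (w - (pair (ω 0) w • ξ 0 + pair (ω 1) w • ξ 1))
        (pair (ω 0) v • ξ 0 + pair (ω 1) v • ξ 1) := by
  have h1 : ∀ u x : V.VF, extD τ (u - x) = fun y => extD τ u y - extD τ x y := fun u x => by
    ext y
    rw [eq_sub_iff_add_eq, ← extD_add_left, sub_add_cancel]
  simp only [h1, extD_add_left, extD_add_right, extD_smul_left, extD_smul_right, extD_self, wedge]
  rw [extD_swap τ (ξ 0) w, extD_swap τ (ξ 1) w, extD_swap τ (ξ 1) (ξ 0)]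
  ring

/-- A linear functional on rational vector fields is the contraction with a form. -/
lemma exists_form (φ : V.VF →ₗ[V.K] V.K) : ∃ θ : V.Form, ∀ v, pair θ v = φ v := by
  refine ⟨(Module.evalEquiv V.K V.Form).symm (φ ∘ₗ vfDual.symm.toLinearMap), fun v => ?_⟩
  rw [← vfDual_apply, ← Module.Dual.eval_apply V.K V.Form, ← Module.evalEquiv_toLinearMap]
  change Module.evalEquiv V.K V.Form _ _ = _
  rw [LinearEquiv.apply_symm_apply]
  simp

namespace Foliation

variable {F G : V.Foliation} {η : G.LeafForm}

/-! ## Log-exactness -/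

namespace IsEigenbasis

variable {ω : Fin 2 → V.Form} (hω : IsEigenbasis η ω)

include hω

/-- If there is a non-constant first integral then `η` is log-exact. -/
lemma logExact {z : V.K} (hz : z ∈ G.firstIntegrals) (hD : KaehlerDifferential.D ℂ V.K z ≠ 0) :
    G.LogExact η := by
  obtain ⟨ξ, hξ⟩ := exists_dual hω.linearIndependent
  obtain ⟨c, hc⟩ := hω.exists_eq_sum (G.mem_firstIntegrals_iff_D.1 hz)
  have hc0 : c ≠ 0 := by rintro rfl; exact hD (by rw [hc]; simp)
  obtain ⟨l, hl⟩ := Function.ne_iff.1 hc0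
  have hl' : c l ≠ 0 := hl
  -- Evaluating `d(Σ cᵢ ωᵢ) = 0` on `v` and `ξ l` gives `v(c l) = -η(v) c l`, so the logarithmic
  -- derivative of the inverse of `c l` is `η`.
  refine ⟨(c l)⁻¹, inv_ne_zero hl', fun v => ?_⟩
  have h1 := extD_D z v.1 (ξ l)
  have h2 : v.1 (c l) + η v * c l = 0 := by
    rw [hc, Fin.sum_univ_two, extD_add, extD_smul, extD_smul,
      extD_of_mem_eigenspace (hω.mem 0) v.2, extD_of_mem_eigenspace (hω.mem 1) v.2,
      G.pair_eq_zero (hω.mem 0).1 v.2, G.pair_eq_zero (hω.mem 1).1 v.2, hξ, hξ] at h1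
    fin_cases l
    · simp at h1 ⊢
      linear_combination h1
    · simp at h1 ⊢
      linear_combination h1
  rw [Derivation.leibniz_inv, smul_eq_mul]
  field_simp
  linear_combination h2

/-- The derivative of `f⁻¹` contributes `-df/f`, which cancels `η`; log-exact eigenvalues thus
reduce to zero. -/
lemma smul_inv {f : V.K} (hf : f ≠ 0) (h : ∀ v : G.ratT, η v = v.1 f / f) :
    IsEigenbasis (0 : G.LeafForm) fun i => f⁻¹ • ω i := by
  refine ⟨fun i => mem_eigenspace_iff.2 ⟨G.ratNc.smul_mem _ (hω.mem i).1, fun v ξ => ?_⟩, ?_, ?_⟩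
  · rw [extD_smul, extD_of_mem_eigenspace (hω.mem i) v.2, G.pair_eq_zero (hω.mem i).1 v.2, h,
      Derivation.leibniz_inv, LinearMap.zero_apply, smul_eq_mul]
    field_simp
    ring
  · exact hω.linearIndependent.units_smul fun _ => (Units.mk0 f hf)⁻¹
  · rw [← hω.span_eq]
    apply le_antisymm
    · rw [Submodule.span_le]
      rintro _ ⟨i, rfl⟩
      exact Submodule.smul_mem _ _ (Submodule.subset_span ⟨i, rfl⟩)
    · rw [Submodule.span_le]
      rintro _ ⟨i, rfl⟩
      have : f⁻¹ • ω i ∈ Submodule.span V.K (Set.range fun i => f⁻¹ • ω i) :=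
        Submodule.subset_span ⟨i, rfl⟩
      rwa [Submodule.smul_mem_iff _ (inv_ne_zero hf)] at this

variable {ξ : Fin 2 → V.VF} (hξ : ∀ i j, pair (ω i) (ξ j) = if i = j then 1 else 0)

include hξ

lemma sub_mem_ratT (v : V.VF) : v - (pair (ω 0) v • ξ 0 + pair (ω 1) v • ξ 1) ∈ G.ratT := by
  rw [G.mem_ratT]
  intro α hα
  obtain ⟨c, rfl⟩ := hω.exists_eq_sum hα
  simp [Fin.sum_univ_two, pair_add, pair_smul, pair_sub_right, pair_add_right, pair_smul_right, hξ]
  ring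

lemma extD_eq_of_forall_ratT {τ : V.Form} (h : ∀ t ∈ G.ratT, ∀ w, extD τ t w = 0) (v w : V.VF) :
    extD τ v w = extD τ (ξ 0) (ξ 1) * wedge (ω 0) (ω 1) v w := by
  rw [extD_expand _ ω ξ, h _ (hω.sub_mem_ratT hξ v), h _ (hω.sub_mem_ratT hξ w), add_zero, sub_zero]

/-- Differentiating the constants `ωᵢ(ξⱼ)` along `t` shows that the dual frame of the normal sheaf
has eigenvalue `-η`. -/
lemma pair_lie {t : V.VF} (ht : t ∈ G.ratT) (i j : Fin 2) :
    pair (ω i) ⁅t, ξ j⁆ = if i = j then -η ⟨t, ht⟩ else 0 := by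
  have h := (hω.mem i).2 ⟨t, ht⟩ (ξ j)
  rw [bott, hξ] at h
  have h0 : t (if i = j then 1 else 0) = 0 := by
    split_ifs
    · exact t.map_one_eq_zero
    · exact map_zero t
  rw [h0] at h
  rw [← neg_inj, ← zero_sub, h]
  split_ifs <;> simp

end IsEigenbasis

/-! ## Transversely affine foliations -/

section

variable {ω : Fin 2 → V.Form}

/-- For `η = 0` the contraction of `dω₀` with `T_G` vanishes, leaving only an `ω₀ ∧ ω₁` component.
Brackets of `T_G` with the dual frame stay in `T_G`, so `d(dω₀) = 0` says that its coefficient is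
constant along `G`. -/
lemma IsEigenbasis.exists_firstIntegral_extD (hω : IsEigenbasis (0 : G.LeafForm) ω) :
    ∃ h ∈ G.firstIntegrals, ∀ v w, extD (ω 0) v w = h * wedge (ω 0) (ω 1) v w := by
  obtain ⟨ξ, hξ⟩ := exists_dual hω.linearIndependent
  have h0 : ∀ t ∈ G.ratT, ∀ w, extD (ω 0) t w = 0 := fun t ht w => by
    rw [extD_of_mem_eigenspace (hω.mem 0) ht, LinearMap.zero_apply, zero_mul]
  refine ⟨extD (ω 0) (ξ 0) (ξ 1), ?_, hω.extD_eq_of_forall_ratT hξ h0⟩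
  rw [mem_firstIntegrals]
  intro t ht
  have hlie : ∀ j, ⁅t, ξ j⁆ ∈ G.ratT := fun j => by
    have h := hω.sub_mem_ratT hξ ⁅t, ξ j⁆
    rw [hω.pair_lie hξ ht, hω.pair_lie hξ ht] at h
    simpa using h
  have hc := extD_cocycle (ω 0) t (ξ 0) (ξ 1)
  rw [h0 t ht, h0 t ht, h0 _ (hlie 0), h0 _ (hlie 1),
    extD_swap (ω 0) t ⁅ξ 0, ξ 1⁆, h0 t ht] at hc
  simpa using hc

/-- If `ℂ(X/G)` is algebraic over `ℂ(z)` then all foliations containing `G` are transversely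
affine. -/
lemma transverselyAffine_of_firstIntegral (hG : G.codim = 2) (hω : IsEigenbasis η ω) {z : V.K}
    (hz : z ∈ G.firstIntegrals) (hD : KaehlerDifferential.D ℂ V.K z ≠ 0)
    (hk : ∀ h ∈ G.firstIntegrals,
      ∃ c : V.K, KaehlerDifferential.D ℂ V.K h = c • KaehlerDifferential.D ℂ V.K z)
    (hF : F ∈ G.CodimOneContaining) : F.TransverselyAffine := by
  obtain ⟨f, hf, hηf⟩ := hω.logExact hz hD
  have hω' := hω.smul_inv hf hηf
  obtain ⟨c, hc0, hc, hFα⟩ := hω'.exists_definedBy hF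
  have hα := hω'.sum_mem_eigenspace hc
  generalize ∑ i, c i • f⁻¹ • ω i = α at hFα hα
  have hz' : KaehlerDifferential.D ℂ V.K z ∈ G.eigenspace (0 : G.LeafForm) :=
    mem_eigenspace_iff.2 ⟨G.mem_firstIntegrals_iff_D.1 hz, fun v ξ => by
      rw [extD_D, LinearMap.zero_apply, zero_mul]⟩
  -- If independent, `α` and `dz` form an eigenbasis and `dα = α ∧ (h dz)` with `h dz` closed.
  -- Otherwise `F` is defined by the closed form `dz`.
  by_cases hli : LinearIndependent V.K ![α, KaehlerDifferential.D ℂ V.K z]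
  · have hb : IsEigenbasis (0 : G.LeafForm) ![α, KaehlerDifferential.D ℂ V.K z] :=
      isEigenbasis_of_linearIndependent hG (fun i => by fin_cases i <;> assumption) hli
    obtain ⟨h, hh, hd⟩ := hb.exists_firstIntegral_extD
    refine ⟨α, h • KaehlerDifferential.D ℂ V.K z, hFα,
      extD_eq_zero_of_D rfl (hk h hh), fun v w => ?_⟩
    refine (hd v w).trans ?_
    simp only [wedge, Matrix.cons_val_zero, Matrix.cons_val_one, pair_smul]
    ring
  · rw [LinearIndependent.pair_iff' hFα.1] at hli
    push Not at hli
    obtain ⟨a, ha⟩ := hli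
    have ha0 : a ≠ 0 := by rintro rfl; exact hD (by rw [← ha, zero_smul])
    refine ⟨_, 0, ⟨hD, ?_⟩, extD_zero, fun v w => ?_⟩
    · rw [hFα.2, ← ha]
      exact (Submodule.span_singleton_smul_eq (IsUnit.mk0 _ ha0) _).symm
    · rw [extD_D, wedge, pair_zero, pair_zero, mul_zero, mul_zero, sub_zero]

/-- If all first integrals are constant, there is a closed form `θ` with `dω = θ ∧ ω` for all `ω` in
the eigenspace. -/
lemma IsEigenbasis.exists_closed_form (hω : IsEigenbasis η ω)
    (hk : ∀ h ∈ G.firstIntegrals, ∃ c : ℂ, algebraMap ℂ V.K c = h) :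
    ∃ θ : V.Form, (∀ v w, extD θ v w = 0) ∧ ∀ i v w, extD (ω i) v w = wedge θ (ω i) v w := by
  obtain ⟨ξ, hξ⟩ := exists_dual hω.linearIndependent
  -- The extension is arbitrary off `T_G`. The corrections in `θ` impose `θ(ξ₀) = -B` and `θ(ξ₁) =
  -- A`, as dictated by `dωᵢ(ξ₀, ξ₁) = -ωᵢ([ξ₀, ξ₁])`.
  obtain ⟨ηl, hηl⟩ := LinearMap.exists_extend η
  have hηl' : ∀ t (ht : t ∈ G.ratT), ηl t = η ⟨t, ht⟩ := fun t ht =>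
    LinearMap.congr_fun hηl ⟨t, ht⟩
  let A := pair (ω 0) ⁅ξ 0, ξ 1⁆
  let B := pair (ω 1) ⁅ξ 0, ξ 1⁆
  obtain ⟨ρ, hρ⟩ := exists_form ηl
  let θ : V.Form := ρ + (-B - ηl (ξ 0)) • ω 0 + (A - ηl (ξ 1)) • ω 1
  have hθ : ∀ v, pair θ v = ηl v + (-B - ηl (ξ 0)) * pair (ω 0) v
      + (A - ηl (ξ 1)) * pair (ω 1) v := fun v => by
    simp only [θ, pair_add, pair_smul, hρ]
  have hθT : ∀ t (ht : t ∈ G.ratT), pair θ t = η ⟨t, ht⟩ := fun t ht => by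
    rw [hθ, G.pair_eq_zero (hω.mem 0).1 ht, G.pair_eq_zero (hω.mem 1).1 ht, hηl' t ht]
    ring
  have hθ0 : pair θ (ξ 0) = -B := by rw [hθ, hξ, hξ]; simp
  have hθ1 : pair θ (ξ 1) = A := by rw [hθ, hξ, hξ]; simp
  have hdω : ∀ i v w, extD (ω i) v w = wedge θ (ω i) v w := by
    intro i v w
    have h01 : extD (ω i) (ξ 0) (ξ 1) = -pair (ω i) ⁅ξ 0, ξ 1⁆ := by
      rw [extD, hξ, hξ]
      have h1 : ∀ (u : V.VF) (P : Prop) [Decidable P], u (if P then 1 else 0) = 0 := fun u P _ => by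
        split_ifs
        · exact u.map_one_eq_zero
        · exact map_zero u
      rw [h1, h1]
      ring
    rw [extD_expand _ ω ξ, extD_of_mem_eigenspace (hω.mem i) (hω.sub_mem_ratT hξ v),
      extD_of_mem_eigenspace (hω.mem i) (hω.sub_mem_ratT hξ w), h01, ← hθT, ← hθT]
    simp only [wedge, pair_sub_right, pair_add_right, pair_smul_right, hξ, hθ0, hθ1]
    fin_cases i
    · simp [A, B]; ring
    · simp [A, B]; ring
  -- From `dθ ∧ ωᵢ = 0`, the form `dθ(t, ·)` is a multiple of both `ω₀` and `ω₁`, hence zero. So `dθ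
  -- = c ω₀ ∧ ω₁`, and closedness of `θ` means `c = 0`.
  have hdθT : ∀ t ∈ G.ratT, ∀ w, extD θ t w = 0 := by
    intro t ht w
    have h1 : ∀ i w, extD θ t w = extD θ t (ξ i) * pair (ω i) w := fun i w => by
      have h := extD_wedge_eq_zero (hdω i) t w (ξ i)
      rw [hξ, if_pos rfl, G.pair_eq_zero (hω.mem i).1 ht] at h
      linear_combination h
    have h2 : extD θ t (ξ 0) = 0 := by rw [h1 1, hξ]; simp
    rw [h1 0, h2, zero_mul]
  have hdθ := hω.extD_eq_of_forall_ratT hξ hdθT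
  set c := extD θ (ξ 0) (ξ 1) with hcdef
  by_cases hc : c = 0
  · exact ⟨θ, fun v w => by rw [hdθ, hc, zero_mul], hdω⟩
  exfalso
  -- This is `d(dθ) = 0`; each of `ω₀` and `ω₁` contributes one `η`.
  have htc : ∀ t (ht : t ∈ G.ratT), t c = -2 * η ⟨t, ht⟩ * c := by
    intro t ht
    have h := extD_cocycle θ t (ξ 0) (ξ 1)
    rw [hdθT t ht, hdθT t ht, extD_swap θ t, hdθT t ht, hdθ ⁅t, ξ 0⁆, hdθ ⁅t, ξ 1⁆, ← hcdef] at h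
    simp only [wedge, hξ, hω.pair_lie hξ ht] at h
    simp at h
    linear_combination h
  -- Formally `θ'` replaces `θ` when `ωᵢ` is scaled by `√c`: it has the same derivative, but it
  -- vanishes on `T_G`.
  let θ' : V.Form := θ + (2 * c)⁻¹ • KaehlerDifferential.D ℂ V.K c
  have hpθ' : ∀ v, pair θ' v = pair θ v + v c / (2 * c) := fun v => by
    simp only [θ', pair_add, pair_smul, pair_D]
    ring
  have hθ'T : ∀ t ∈ G.ratT, pair θ' t = 0 := fun t ht => by
    rw [hpθ', hθT t ht, htc t ht]
    field_simp
    ring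
  have hdθ' : ∀ v w, extD θ' v w = extD θ v w := fun v w => by
    have h2 : ∀ u : V.VF, u (2 : V.K) = 0 := fun u => by
      rw [← map_ofNat (algebraMap ℂ V.K) 2, u.map_algebraMap]
    simp only [θ', extD_add, extD_smul, extD_D, pair_D, Derivation.leibniz_inv, Derivation.leibniz,
      smul_eq_mul, h2]
    ring
  have hθ'ω : ∀ v, pair θ' v = pair θ' (ξ 0) * pair (ω 0) v + pair θ' (ξ 1) * pair (ω 1) v := by
    intro v
    have h := hθ'T _ (hω.sub_mem_ratT hξ v)
    rw [pair_sub_right, pair_add_right, pair_smul_right, pair_smul_right] at h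
    linear_combination h
  have hta : ∀ i t (ht : t ∈ G.ratT), t (pair θ' (ξ i)) = -η ⟨t, ht⟩ * pair θ' (ξ i) := by
    intro i t ht
    have h := hdθT t ht (ξ i)
    rw [← hdθ', extD, hθ'T t ht, map_zero, hθ'ω ⁅t, ξ i⁆, hω.pair_lie hξ ht,
      hω.pair_lie hξ ht] at h
    fin_cases i
    · simp at h ⊢; linear_combination h
    · simp at h ⊢; linear_combination h
  -- Along `T_G` the coefficient `θ'(ξᵢ)` varies like `√c`, so its square over `c` is a first
  -- integral, hence constant: it is a constant times `√c` in every direction.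
  have hder : ∀ i (u : V.VF), u (pair θ' (ξ i)) = pair θ' (ξ i) * u c / (2 * c) := by
    intro i u
    obtain ⟨β, hβ⟩ := hk (pair θ' (ξ i) * pair θ' (ξ i) * c⁻¹) (by
      rw [mem_firstIntegrals]
      intro t ht
      simp only [Derivation.leibniz, Derivation.leibniz_inv, smul_eq_mul, hta i t ht, htc t ht]
      field_simp
      ring)
    have h := u.map_algebraMap β
    rw [hβ] at h
    simp only [Derivation.leibniz, Derivation.leibniz_inv, smul_eq_mul] at h
    by_cases h0 : pair θ' (ξ i) = 0
    · rw [h0]; simp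
    · field_simp at h ⊢
      refine mul_left_cancel₀ h0 ?_
      linear_combination h
  -- Formally `θ' = Σ bᵢ √c ωᵢ` with constants `bᵢ`, and `d(√c ωᵢ) = θ' ∧ √c ωᵢ`, so `dθ' = θ' ∧ θ'
  -- = 0`. Evaluation on `(ξ₀, ξ₁)` expresses this without square roots.
  have hfin : c = 0 := by
    have h := hdθ' (ξ 0) (ξ 1)
    rw [extD, hder, hder, hθ'ω ⁅ξ 0, ξ 1⁆] at h
    have hA : A = pair θ' (ξ 1) - ξ 1 c / (2 * c) := by rw [hpθ', hθ1]; ring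
    have hB : B = ξ 0 c / (2 * c) - pair θ' (ξ 0) := by rw [hpθ', hθ0]; ring
    change _ - (_ * A + _ * B) = c at h
    rw [hA, hB] at h
    rw [← h]
    ring
  exact hc hfin

/-- Defining forms are now `ℂ`-combinations of the `ωᵢ`, so one `θ` serves them all; the sign comes
from `θ ∧ α = α ∧ (-θ)`. -/
lemma transverselyAffine_of_const (hω : IsEigenbasis η ω)
    (hk : ∀ h ∈ G.firstIntegrals, ∃ c : ℂ, algebraMap ℂ V.K c = h)
    (hF : F ∈ G.CodimOneContaining) : F.TransverselyAffine := by
  obtain ⟨θ, hθ, hd⟩ := hω.exists_closed_form hk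
  obtain ⟨c, hc0, hc, hFα⟩ := hω.exists_definedBy hF
  refine ⟨_, -θ, hFα, fun v w => by rw [extD_neg, hθ, neg_zero], fun v w => ?_⟩
  have h0 : ∀ i (u : V.VF), u (c i) = 0 := fun i u => by
    obtain ⟨b, hb⟩ := hk _ (hc i)
    rw [← hb, u.map_algebraMap]
  simp only [Fin.sum_univ_two, extD_add, extD_smul, h0, hd, wedge, pair_add, pair_smul, pair_neg]
  ring

end

end Foliation

end ProjVariety

namespace ProjVariety

variable {N : ℕ} {V : ProjVariety N}

/-! ## Rational maps defined by a finitely generated field of rational functions -/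

lemma exists_common_fraction {m : ℕ} (y : Fin m → V.K) :
    ∃ (d : ℕ) (a : Fin m → MvPolynomial (Fin (N + 1)) ℂ) (b : MvPolynomial (Fin (N + 1)) ℂ),
      0 < d ∧ (∀ i, (a i).IsHomogeneous d) ∧ b.IsHomogeneous d ∧ b ∉ V.ideal ∧
        ∀ i, V.incl (y i) = V.cls (a i) / V.cls b := by
  obtain ⟨j, hj⟩ := V.nonempty
  choose d a b ha hb hb0 hy using fun i => V.exists_fraction (y i)
  have hprod : ∏ i, b i ∉ V.ideal := fun h => by
    obtain ⟨i, -, hi⟩ := V.isPrime.prod_mem_iff.1 h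
    exact hb0 i hi
  -- The spare factor `X_j` makes the common degree positive even when all `d i` vanish or `m = 0`.
  refine ⟨1 + ∑ i, d i, fun i => MvPolynomial.X j * (a i * ∏ l ∈ Finset.univ.erase i, b l),
    MvPolynomial.X j * ∏ i, b i, by omega, fun i => ?_, ?_, fun h => ?_, fun i => ?_⟩
  · refine (isHomogeneous_X ℂ j).mul ?_
    rw [← Finset.add_sum_erase _ _ (Finset.mem_univ i)]
    exact (ha i).mul (IsHomogeneous.prod _ _ _ fun l _ => hb l)
  · exact (isHomogeneous_X ℂ j).mul (IsHomogeneous.prod _ _ _ fun l _ => hb l)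
  · exact (V.isPrime.mem_or_mem h).elim hj hprod
  · rw [← V.cls_eq_zero_iff] at hj
    have h1 : V.cls (∏ l ∈ Finset.univ.erase i, b l) ≠ 0 := fun h => by
      rw [V.cls_eq_zero_iff] at h
      obtain ⟨l, -, hl⟩ := V.isPrime.prod_mem_iff.1 h
      exact hb0 l hl
    rw [hy, ← Finset.mul_prod_erase _ _ (Finset.mem_univ i), map_mul, map_mul, map_mul, map_mul,
      mul_div_mul_left _ _ hj, mul_div_mul_right _ _ h1]

/-- Substituting forms of degree `d` multiplies degrees by `d`, and for `d > 0` distinct degrees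
stay distinct. This makes the ideal of the image homogeneous. -/
lemma homogeneousComponent_aeval {n : ℕ} {d : ℕ} (hd : 0 < d)
    {c : Fin (n + 1) → MvPolynomial (Fin (N + 1)) ℂ} (hc : ∀ i, (c i).IsHomogeneous d)
    (g : MvPolynomial (Fin (n + 1)) ℂ) (e : ℕ) :
    homogeneousComponent (d * e) (aeval c g) = aeval c (homogeneousComponent e g) := by
  conv_lhs => rw [← sum_homogeneousComponent g]
  rw [map_sum, map_sum]
  have h : ∀ i, homogeneousComponent (d * e) (aeval c (homogeneousComponent i g)) =
      if i = e then aeval c (homogeneousComponent e g) else 0 := fun i => by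
    rw [homogeneousComponent_of_mem ((homogeneousComponent_isHomogeneous i g).aeval c hc)]
    by_cases hi : i = e
    · subst hi; simp
    · rw [if_neg hi, if_neg]
      exact fun h => hi (Nat.eq_of_mul_eq_mul_left hd h).symm
  simp only [h]
  by_cases he : e ∈ Finset.range (g.totalDegree + 1)
  · rw [Finset.sum_ite_eq' _ e, if_pos he]
  · rw [Finset.sum_ite_eq' _ e, if_neg he, homogeneousComponent_eq_zero, map_zero]
    simpa using he

/-- The closure of the image of the rational map given by homogeneous polynomials of the same
positive degree. -/
def image {n d : ℕ} (hd : 0 < d) (c : Fin (n + 1) → MvPolynomial (Fin (N + 1)) ℂ)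
    (hc : ∀ i, (c i).IsHomogeneous d) (hne : ∃ i, c i ∉ V.ideal) : ProjVariety n where
  ideal := V.ideal.comap (aeval c : MvPolynomial (Fin (n + 1)) ℂ →ₐ[ℂ] _)
  isPrime := V.isPrime.comap _
  isHomogeneous g hg e := by
    rw [Ideal.mem_comap] at hg ⊢
    rw [← homogeneousComponent_aeval hd hc]
    exact V.isHomogeneous _ hg _
  nonempty := by
    obtain ⟨i, hi⟩ := hne
    exact ⟨i, by rwa [Ideal.mem_comap, aeval_X]⟩

/-- The rational map onto the closure of its image. -/
def toImage {n d : ℕ} (hd : 0 < d) (c : Fin (n + 1) → MvPolynomial (Fin (N + 1)) ℂ)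
    (hc : ∀ i, (c i).IsHomogeneous d) (hne : ∃ i, c i ∉ V.ideal) :
    DominantMap V (V.image hd c hc hne) where
  deg := d
  coord := c
  isHomogeneous := hc
  mem_iff _ := Iff.rfl

lemma DominantMap.incl_pullback {n : ℕ} {Y : ProjVariety n} (π : DominantMap V Y) (z : Y.K) :
    V.incl (π.pullback z) = π.fracMap (Y.incl z) := rfl

lemma DominantMap.pullbackForm_D {n : ℕ} {Y : ProjVariety n} (π : DominantMap V Y) (z : Y.K) :
    π.pullbackForm (KaehlerDifferential.D ℂ Y.K z) =
      KaehlerDifferential.D ℂ V.K (π.pullback z) := by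
  let := π.pullback.toRingHom.toAlgebra
  have : IsScalarTower ℂ Y.K V.K := IsScalarTower.of_algebraMap_eq fun c =>
    (π.pullback.commutes c).symm
  exact KaehlerDifferential.map_D ℂ ℂ Y.K V.K z

lemma DominantMap.pullbackForm_smul {n : ℕ} {Y : ProjVariety n} (π : DominantMap V Y) (f : Y.K)
    (ω : Y.Form) : π.pullbackForm (f • ω) = π.pullback f • π.pullbackForm ω := by
  let := π.pullback.toRingHom.toAlgebra
  have : IsScalarTower ℂ Y.K V.K := IsScalarTower.of_algebraMap_eq fun c =>
    (π.pullback.commutes c).symm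
  exact map_smul (KaehlerDifferential.map ℂ ℂ Y.K V.K) f ω

/-- Every field of rational functions on a projective variety is the function field of the image of
a rational map. -/
theorem exists_dominantMap (L : IntermediateField ℂ V.K) :
    ∃ (n : ℕ) (Y : ProjVariety n) (π : DominantMap V Y), π.pullback.fieldRange = L := by
  have hfg : L.FG := IntermediateField.essFiniteType_iff.1 (Algebra.essFiniteType_of_tower ℂ L V.K)
  obtain ⟨t, ht⟩ := hfg
  let y : Fin t.card → V.K := fun i => (t.equivFin.symm i : V.K)
  have hy : Set.range y = t := by
    ext z
    constructor
    · rintro ⟨i, rfl⟩; exact (t.equivFin.symm i).2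
    · exact fun hz => ⟨t.equivFin ⟨z, hz⟩, by simp [y]⟩
  obtain ⟨d, a, b, hd, ha, hb, hb0, hab⟩ := exists_common_fraction y
  -- The map is `[1 : y₁ : … : yₘ]` for generators `yᵢ` of `L`, with denominators cleared: its
  -- affine coordinates pull back to the generators.
  let c : Fin (t.card + 1) → MvPolynomial (Fin (N + 1)) ℂ := Fin.cons b a
  have hc : ∀ i, (c i).IsHomogeneous d := Fin.cases hb ha
  have hne : ∃ i, c i ∉ V.ideal := ⟨0, hb0⟩
  let π := toImage hd c hc hne
  have haff : ∀ i, V.incl (π.pullback ((V.image hd c hc hne).aff 0 i)) =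
      V.cls (c i) / V.cls b := fun i => by
    rw [π.incl_pullback, incl_aff, map_div₀, π.fracMap_cls, π.fracMap_cls, aeval_X, aeval_X]
    rfl
  refine ⟨_, _, π, ?_⟩
  have hX : (MvPolynomial.X 0 : MvPolynomial (Fin (t.card + 1)) ℂ) ∉
      (V.image hd c hc hne).ideal := fun h => by
    change aeval c _ ∈ V.ideal at h
    rw [aeval_X] at h
    exact hb0 h
  rw [AlgHom.fieldRange_eq_map, ← (V.image hd c hc hne).adjoin_range_aff hX,
    IntermediateField.adjoin_map, ← ht]
  have hinj := RingHom.injective V.incl.toRingHom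
  apply le_antisymm
  · rw [IntermediateField.adjoin_le_iff]
    rintro _ ⟨_, ⟨i, rfl⟩, rfl⟩
    induction i using Fin.cases with
    | zero =>
      rw [← V.cls_eq_zero_iff] at hb0
      have h1 : π.pullback ((V.image hd c hc hne).aff 0 0) = 1 :=
        hinj ((haff 0).trans ((div_self hb0).trans (map_one V.incl).symm))
      change π.pullback _ ∈ _
      rw [h1]
      exact one_mem _
    | succ i =>
      apply IntermediateField.subset_adjoin
      rw [← hy]
      exact ⟨i, hinj ((hab i).trans (haff i.succ).symm)⟩
  · rw [IntermediateField.adjoin_le_iff]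
    intro z hz
    rw [← hy] at hz
    obtain ⟨i, rfl⟩ := hz
    apply IntermediateField.subset_adjoin
    exact ⟨_, ⟨i.succ, rfl⟩, hinj ((haff i.succ).trans (hab i).symm)⟩

namespace Foliation

variable {F G : V.Foliation} {η : G.LeafForm}

/-! ## The transcendence degree of the field of first integrals -/

/-- The differentials `dzᵢ` are independent sections of the conormal sheaf, whose rank is two. -/
lemma exists_isTranscendenceBasis_firstIntegrals (hG : G.codim = 2) :
    ∃ n ≤ 2, ∃ z : Fin n → G.firstIntegrals, IsTranscendenceBasis ℂ z ∧
      LinearIndependent V.K fun i => KaehlerDifferential.D ℂ V.K (z i : V.K) := by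
  obtain ⟨ι, z, hz⟩ := exists_isTranscendenceBasis' ℂ G.firstIntegrals
  have hli := (hz.1.map' G.firstIntegrals.val.injective).linearIndependent_D
  have : Module.Finite V.K G.ratNc := Module.finite_of_finrank_pos (by
    change 0 < G.codim; rw [hG]; exact two_pos)
  have hli' : LinearIndependent V.K fun i =>
      (⟨_, G.mem_firstIntegrals_iff_D.1 (z i).2⟩ : G.ratNc) :=
    LinearIndependent.of_comp G.ratNc.subtype hli
  have : Finite ι := hli'.finite
  have := Fintype.ofFinite ι
  have hcard : Fintype.card ι ≤ 2 := by
    rw [← hG]; exact hli'.fintype_card_le_finrank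
  let e := Fintype.equivFin ι
  exact ⟨_, hcard, z ∘ e.symm, hz.comp_equiv e.symm, hli.comp e.symm e.symm.injective⟩

lemma mem_eigenspace_zero_D {z : V.K} (hz : z ∈ G.firstIntegrals) :
    KaehlerDifferential.D ℂ V.K z ∈ G.eigenspace (0 : G.LeafForm) :=
  mem_eigenspace_iff.2 ⟨G.mem_firstIntegrals_iff_D.1 hz, fun v ξ => by
    rw [extD_D, LinearMap.zero_apply, zero_mul]⟩

/-- The surface `Y` is a model of `ℂ(X/G)`. As `dz₀, dz₁` form an eigenbasis with `η = 0`, every `F`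
is given by `Σ cᵢ dzᵢ` with `cᵢ` first integrals, and all these data come from `Y`. -/
lemma isPullbackFromSurface (hG : G.codim = 2) {z : Fin 2 → G.firstIntegrals}
    (hz : IsTranscendenceBasis ℂ z)
    (hli : LinearIndependent V.K fun i => KaehlerDifferential.D ℂ V.K (z i : V.K)) :
    G.IsPullbackFromSurface := by
  have htr : Algebra.trdeg ℂ G.firstIntegrals = 2 := by
    rw [← hz.cardinalMk_eq_trdeg]; simp
  have hω := isEigenbasis_of_linearIndependent hG (fun i => mem_eigenspace_zero_D (z i).2) hli
  obtain ⟨n, Y, π, hπ⟩ := exists_dominantMap G.firstIntegrals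
  have hmem : ∀ f, π.pullback f ∈ G.firstIntegrals := fun f => hπ ▸ ⟨f, rfl⟩
  have hsurj : ∀ f ∈ G.firstIntegrals, ∃ g, π.pullback g = f := fun f hf => by
    rw [← hπ] at hf; exact hf
  have hinj : Function.Injective π.pullback := RingHom.injective π.pullback.toRingHom
  let e : Y.K ≃ₐ[ℂ] G.firstIntegrals := AlgEquiv.ofBijective
    (π.pullback.codRestrict G.firstIntegrals.toSubalgebra hmem)
    ⟨fun a b h => hinj (congrArg Subtype.val h), fun f => by
      obtain ⟨g, hg⟩ := hsurj f f.2; exact ⟨g, Subtype.ext hg⟩⟩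
  have he : ∀ g, (e g : V.K) = π.pullback g := fun g => rfl
  refine ⟨htr, n, Y, π, ?_, ?_, fun F hF => ?_⟩
  · rw [dim, e.trdeg_eq, htr]; simp
  · apply le_antisymm
    · rw [← hω.span_eq]
      refine Submodule.span_mono ?_
      rintro _ ⟨i, rfl⟩
      obtain ⟨g, hg⟩ := hsurj _ (z i).2
      exact ⟨g, by simp only [hg]⟩
    · rw [Submodule.span_le]
      rintro _ ⟨f, rfl⟩
      exact G.mem_firstIntegrals_iff_D.1 (hmem f)
  · obtain ⟨c, hc0, hc, hFα⟩ := hω.exists_definedBy hF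
    choose u hu using fun i => hsurj _ (z i).2
    choose r hr using fun i => hsurj _ (hc i)
    have hu' : IsTranscendenceBasis ℂ u := by
      have := e.symm.isTranscendenceBasis hz
      convert this using 1
      funext i
      rw [Function.comp_apply, AlgEquiv.eq_symm_apply]
      exact Subtype.ext (hu i)
    obtain ⟨b, hb⟩ := hu'.exists_basis_D
    have htop : annVF (⊤ : Submodule Y.K Y.Form) = ⊥ := by
      rw [eq_bot_iff]
      intro v hv
      ext f
      rw [← pair_D]
      exact hv _ trivial
    -- `P` is the foliation of `Y` by points: every function is a first integral, so
    -- `exists_foliation` applied to it produces `H`.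
    let P : Y.Foliation := ofConormal ⊤ fun v hv w hw => by
      rw [htop, Submodule.mem_bot] at hv ⊢
      rw [hv, zero_lie]
    have hP : P.ratNc = ⊤ := ratNc_ofConormal _ _
    have hPT : ∀ g : Y.K, g ∈ P.firstIntegrals := fun g => by
      rw [mem_firstIntegrals_iff_D, hP]; trivial
    have hP2 : P.codim = 2 := by
      rw [codim, hP, finrank_top, Module.finrank_eq_card_basis b, Fintype.card_fin]
    have hY := isEigenbasis_of_linearIndependent hP2 (fun i => mem_eigenspace_zero_D (hPT (u i)))
      (by rw [← funext hb]; exact b.linearIndependent)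
    have hr0 : r ≠ 0 := by
      rintro rfl
      exact hc0 (funext fun i => by rw [← hr i]; simp)
    obtain ⟨H, hH, hHα⟩ := hY.exists_foliation hr0 fun i => hPT (r i)
    have hpull : π.pullbackForm (∑ i, r i • KaehlerDifferential.D ℂ Y.K (u i)) =
        ∑ i, c i • KaehlerDifferential.D ℂ V.K (z i : V.K) := by
      rw [map_sum]
      exact Finset.sum_congr rfl fun i _ => by
        rw [π.pullbackForm_smul, π.pullbackForm_D, hr, hu]
    refine ⟨H, hH.1, ?_⟩
    change F.ratNc = _
    rw [hFα.2, hHα.2]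
    apply le_antisymm
    · rw [Submodule.span_singleton_le_iff_mem]
      exact Submodule.subset_span ⟨_, Submodule.mem_span_singleton_self _, hpull⟩
    · rw [Submodule.span_le]
      rintro _ ⟨α, hα, rfl⟩
      obtain ⟨s, rfl⟩ := Submodule.mem_span_singleton.1 hα
      rw [SetLike.mem_coe, π.pullbackForm_smul, hpull]
      exact Submodule.smul_mem _ _ (Submodule.mem_span_singleton_self _)

lemma isAffineOverFirstIntegrals (hG : G.codim = 2) {ω : Fin 2 → V.Form}
    (hω : IsEigenbasis η ω) {z : G.firstIntegrals}
    (hz : IsTranscendenceBasis ℂ fun _ : Fin 1 => z)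
    (hD : KaehlerDifferential.D ℂ V.K (z : V.K) ≠ 0) :
    G.IsAffineOverFirstIntegrals η := by
  have htr : Algebra.trdeg ℂ G.firstIntegrals = 1 := by
    rw [← hz.cardinalMk_eq_trdeg]; simp
  refine ⟨htr, fun F hF => ?_, hω.parametrizedByP1 G.firstIntegrals
    (algebraMap G.firstIntegrals V.K) (fun _ _ => rfl)
    fun z => ⟨fun h => ⟨⟨z, h⟩, rfl⟩, by rintro ⟨c, rfl⟩; exact c.2⟩⟩
  refine transverselyAffine_of_firstIntegral hG hω z.2 hD (fun h hh => ?_) hF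
  -- Already in the differentials of `ℂ(X/G)`, where `dz` is a basis, `dh` is a multiple of `dz`;
  -- this maps to the forms on `X`.
  obtain ⟨b, hb⟩ := hz.exists_basis_D
  have hsum := b.sum_repr (KaehlerDifferential.D ℂ G.firstIntegrals ⟨h, hh⟩)
  rw [Fin.sum_univ_one, hb] at hsum
  have h1 := congrArg (KaehlerDifferential.map ℂ ℂ G.firstIntegrals V.K) hsum
  rw [map_smul, KaehlerDifferential.map_D, KaehlerDifferential.map_D] at h1
  exact ⟨_, h1.symm⟩

lemma firstIntegrals_eq_const {z : Fin 0 → G.firstIntegrals} (hz : IsTranscendenceBasis ℂ z)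
    {h : V.K} (hh : h ∈ G.firstIntegrals) : ∃ c : ℂ, algebraMap ℂ V.K c = h := by
  have : Algebra.IsAlgebraic ℂ G.firstIntegrals := hz.isEmpty_iff_isAlgebraic.1 inferInstance
  obtain ⟨c, hc⟩ := (IsAlgClosed.algebraMap_bijective_of_isIntegral
    (k := ℂ) (K := G.firstIntegrals)).2 ⟨h, hh⟩
  exact ⟨c, congrArg Subtype.val hc⟩

end Foliation

end ProjVariety

namespace ProjVariety

variable {N : ℕ} {V : ProjVariety N}

/-! ## Generic smoothness of foliations -/

lemma D_aeval_aff (j : Fin (N + 1)) (a : MvPolynomial (Fin (N + 1)) ℂ) :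
    KaehlerDifferential.D ℂ V.K (aeval (V.aff j) a) =
      ∑ i, aeval (V.aff j) (pderiv i a) • KaehlerDifferential.D ℂ V.K (V.aff j i) := by
  rw [← sub_eq_zero, ← Submodule.mem_bot V.K]
  refine mem_of_forall_annVF fun v _ => ?_
  have hsum : ∀ f : Fin (N + 1) → V.Form, pair (∑ i, f i) v = ∑ i, pair (f i) v := fun f =>
    map_sum v.liftKaehlerDifferential f _
  rw [pair_sub, hsum, pair_D, derivation_aeval_aff]
  simp only [pair_smul, pair_D, sub_self]

/-- By the chain and quotient rules the differentials of the affine coordinates generate the stalk.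
-/
lemma formStalk_le {p : V.Point} {j : Fin (N + 1)} (hj : p.coords j ≠ 0)
    {S : Submodule (V.localRing p) V.Form}
    (hS : ∀ i, KaehlerDifferential.D ℂ V.K (V.aff j i) ∈ S) : V.formStalk p ≤ S := by
  have hpoly : ∀ a, KaehlerDifferential.D ℂ V.K (aeval (V.aff j) a) ∈ S := fun a => by
    rw [D_aeval_aff]
    exact sum_mem fun i _ => S.smul_mem ⟨_, aeval_aff_mem hj (pderiv i a)⟩ (hS i)
  refine Submodule.span_le.2 ?_
  rintro _ ⟨f, hf, rfl⟩
  obtain ⟨a, b, hb, rfl⟩ := (mem_localRing_iff_exists_affine hj).1 hf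
  have hb' : (aeval (V.aff j) b)⁻¹ ∈ V.localRing p :=
    inv_mem_localRing (aeval_aff_mem hj b) (by rwa [value_aeval_aff hj])
  rw [div_eq_mul_inv, Derivation.leibniz, Derivation.leibniz_inv, smul_smul]
  exact add_mem (S.smul_mem ⟨_, mul_mem (aeval_aff_mem hj a) (neg_mem (pow_mem hb' 2))⟩ (hpoly b))
    (S.smul_mem ⟨_, hb'⟩ (hpoly a))

/-- If a lattice `F` in a vector space is spanned, modulo a subspace `W`, by elements which are
linearly independent modulo `W`, then `F / (F ∩ W)` is free. -/
lemma free_quotient_comap {R K E κ : Type*} [CommRing R] [Field K] [Algebra R K] [AddCommGroup E]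
    [Module R E] [Module K E] [IsScalarTower R K E] [Fintype κ]
    (hRK : Function.Injective (algebraMap R K)) {F M : Submodule R E} {W : Submodule K E}
    (hM : ∀ y ∈ F, y ∈ M ↔ y ∈ W) {x : κ → E} (hxF : ∀ s, x s ∈ F)
    (hli : LinearIndependent K fun s => W.mkQ (x s))
    (hF : F ≤ Submodule.span R (Set.range x) ⊔ W.restrictScalars R) :
    Module.Free R (F ⧸ M.comap F.subtype) := by
  have hmk : ∀ y : F, (M.comap F.subtype).mkQ y = 0 ↔ (y : E) ∈ W := fun y => by
    rw [Submodule.mkQ_apply, Submodule.Quotient.mk_eq_zero, Submodule.mem_comap]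
    exact hM _ y.2
  refine Module.Free.of_basis (Module.Basis.mk
    (v := fun s => (M.comap F.subtype).mkQ ⟨x s, hxF s⟩) ?_ ?_)
  · rw [Fintype.linearIndependent_iff]
    intro g hg s
    have h1 : (M.comap F.subtype).mkQ (∑ s, g s • ⟨x s, hxF s⟩) = 0 := by
      rw [map_sum, ← hg]
      exact Finset.sum_congr rfl fun s _ => map_smul _ _ _
    rw [hmk] at h1
    have h2 : ∑ s, algebraMap R K (g s) • W.mkQ (x s) = 0 := by
      rw [← Submodule.Quotient.mk_eq_zero W, ← Submodule.mkQ_apply] at h1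
      rw [← h1]
      simp only [Submodule.coe_sum, map_sum, Submodule.coe_smul, ← map_smul, algebraMap_smul]
    refine hRK ?_
    rw [map_zero]
    exact Fintype.linearIndependent_iff.1 hli _ h2 s
  · rintro y -
    obtain ⟨⟨z, hz⟩, rfl⟩ := Submodule.mkQ_surjective _ y
    obtain ⟨σ, hσ, τ, hτ, hστ⟩ := Submodule.mem_sup.1 (hF hz)
    obtain ⟨g, rfl⟩ := (Submodule.mem_span_range_iff_exists_fun _).1 hσ
    have h1 : (M.comap F.subtype).mkQ ⟨z, hz⟩ =
        ∑ s, g s • (M.comap F.subtype).mkQ ⟨x s, hxF s⟩ := by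
      have h2 : (M.comap F.subtype).mkQ (⟨z, hz⟩ - ∑ s, g s • ⟨x s, hxF s⟩) = 0 := by
        rw [hmk, Submodule.coe_sub, Submodule.coe_sum]
        have : z - ∑ s, g s • x s = τ := sub_eq_iff_eq_add'.2 hστ.symm
        simpa only [Submodule.coe_smul, this, Submodule.restrictScalars_mem] using hτ
      rw [map_sub, map_sum, sub_eq_zero] at h2
      simpa only [map_smul] using h2
    rw [h1]
    exact Submodule.sum_mem _ fun s _ => Submodule.smul_mem _ _ (Submodule.subset_span ⟨s, rfl⟩)

namespace Foliation

variable (G : V.Foliation)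

/-- Some of the `d(X_i / X_j)` form a basis of all forms modulo the conormal ones over `ℂ(X)`.
Wherever the coefficients expressing the others are regular, they are also a basis of the quotient
of stalks. -/
lemma generic_not_isSingularAt : ∀ᶠ q in V.generic, ¬ G.IsSingularAt q := by
  obtain ⟨j, hj⟩ := V.nonempty
  let x : Fin (N + 1) → V.Form ⧸ G.ratNc := fun i =>
    G.ratNc.mkQ (KaehlerDifferential.D ℂ V.K (V.aff j i))
  obtain ⟨κ, a, ha, hspan, hli⟩ := exists_linearIndependent' V.K x
  have : Finite κ := Finite.of_injective a ha
  have := Fintype.ofFinite κ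
  have hx : ∀ i, ∃ c : κ → V.K, ∑ s, c s • x (a s) = x i := fun i => by
    have : x i ∈ Submodule.span V.K (Set.range (x ∘ a)) := by
      rw [hspan]; exact Submodule.subset_span ⟨i, rfl⟩
    exact (Submodule.mem_span_range_iff_exists_fun V.K).1 this
  choose c hc using hx
  filter_upwards [generic_coords_ne_zero hj,
    Filter.eventually_all.2 fun i => Filter.eventually_all.2 fun s =>
      generic_mem_localRing (c i s)] with q hq hcq
  rw [IsSingularAt, not_not]
  refine free_quotient_comap (W := G.ratNc) Subtype.val_injective
    (fun y hy => by rw [mem_Nc]; exact ⟨fun h => h.2, fun h => ⟨hy, h⟩⟩) (fun s => ?_) hli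
    (formStalk_le hq fun i => ?_)
  · refine D_mem_formStalk ?_
    rw [← aeval_X (R := ℂ) (V.aff j) (a s)]
    exact aeval_aff_mem hq _
  · rw [Submodule.mem_sup]
    refine ⟨∑ s, (⟨c i s, hcq i s⟩ : V.localRing q) •
      KaehlerDifferential.D ℂ V.K (V.aff j (a s)), ?_, KaehlerDifferential.D ℂ V.K (V.aff j i) -
        ∑ s, c i s • KaehlerDifferential.D ℂ V.K (V.aff j (a s)), ?_, ?_⟩
    · exact Submodule.sum_mem _ fun s _ =>
        Submodule.smul_mem _ _ (Submodule.subset_span ⟨s, rfl⟩)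
    · rw [Submodule.restrictScalars_mem, ← Submodule.Quotient.mk_eq_zero, ← Submodule.mkQ_apply,
        map_sub, map_sum]
      simp only [map_smul]
      rw [sub_eq_zero]
      exact (hc i).symm
    · exact add_sub_cancel _ _

end Foliation

/-! ## Polynomial vector fields and Wronskians -/

/-- If `R ≠ 0` is a space of vectors which is closed under some derivations, then it contains a
nonzero vector killed by all of them. -/
lemma exists_const_vector {k K ι : Type*} [Field k] [Field K] [Algebra k K] [Fintype ι]
    {S : Set (Derivation k K K)} {R : Submodule K (ι → K)}
    (hS : ∀ c ∈ R, ∀ v ∈ S, (fun i => v (c i)) ∈ R) (hR : R ≠ ⊥) :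
    ∃ c ∈ R, c ≠ 0 ∧ ∀ i, ∀ v ∈ S, v (c i) = 0 := by
  classical
  let A : Set (ι → K) := {c | c ∈ R ∧ c ≠ 0}
  have hA : A.Nonempty := by
    obtain ⟨c, hc, h0⟩ := (Submodule.ne_bot_iff _).1 hR
    exact ⟨c, hc, h0⟩
  -- A vector of minimal support, scaled so that one entry is `1`, is constant: its derivatives lie
  -- in `R` and have strictly smaller support.
  let f : (ι → K) → ℕ := fun c => (Finset.univ.filter fun i => c i ≠ 0).card
  obtain ⟨hc, hc0⟩ : Function.argminOn f A hA ∈ A := Function.argminOn_mem f A hA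
  have hmin : ∀ d ∈ A, f (Function.argminOn f A hA) ≤ f d := fun d hd =>
    Function.argminOn_le f A hd
  generalize Function.argminOn f A hA = c at *
  obtain ⟨l, hl⟩ := Function.ne_iff.1 hc0
  have hl' : c l ≠ 0 := hl
  have hd : (c l)⁻¹ • c ∈ R := R.smul_mem _ hc
  refine ⟨(c l)⁻¹ • c, hd, smul_ne_zero (inv_ne_zero hl') hc0, fun i v hv => ?_⟩
  by_contra hi
  have hlt : f (fun i => v (((c l)⁻¹ • c) i)) < f c := by
    refine Finset.card_lt_card ⟨fun i hi => ?_, fun h => ?_⟩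
    · simp only [Finset.mem_filter, Finset.mem_univ, true_and] at hi ⊢
      intro h0
      apply hi
      rw [Pi.smul_apply, h0, smul_zero, map_zero]
    · have := h (Finset.mem_filter.2 ⟨Finset.mem_univ l, hl'⟩)
      simp only [Finset.mem_filter, Finset.mem_univ, true_and, Pi.smul_apply, smul_eq_mul] at this
      rw [inv_mul_cancel₀ hl'] at this
      exact this v.map_one_eq_zero
  exact absurd (hmin _ ⟨hS _ hd v hv, fun h => hi (congrFun h i)⟩) (not_le.2 hlt)

/-- The derivation of the polynomial ring with the given values on the variables. -/
abbrev polyDer (P : Fin (N + 1) → MvPolynomial (Fin (N + 1)) ℂ) :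
    Derivation ℂ (MvPolynomial (Fin (N + 1)) ℂ) (MvPolynomial (Fin (N + 1)) ℂ) :=
  mkDerivation ℂ P

lemma polyDer_eq_sum (P : Fin (N + 1) → MvPolynomial (Fin (N + 1)) ℂ)
    (g : MvPolynomial (Fin (N + 1)) ℂ) : polyDer P g = ∑ i, pderiv i g * P i := by
  rw [polyDer]
  have : mkDerivation ℂ P = ∑ i, P i • pderiv (R := ℂ) i := by
    refine derivation_ext fun l => ?_
    rw [mkDerivation_X]
    have h1 : (∑ i, P i • pderiv (R := ℂ) i) (MvPolynomial.X l) =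
        ∑ i, (P i • pderiv (R := ℂ) i) (MvPolynomial.X l) := by
      rw [← Derivation.coeFnAddMonoidHom_apply, map_sum, Finset.sum_apply]
      rfl
    rw [h1, Finset.sum_eq_single l]
    · simp
    · intro i _ hi
      simp [hi.symm]
    · simp
  rw [this, ← Derivation.coeFnAddMonoidHom_apply, map_sum, Finset.sum_apply]
  exact Finset.sum_congr rfl fun i _ => mul_comm _ _

namespace Foliation

variable (G : V.Foliation)

/-- The vector field `v` is tangent to `G` and given by polynomials `P` in the affine coordinates
`X_i / X_j`. -/
def IsPolyTangent (j : Fin (N + 1)) (v : V.VF)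
    (P : Fin (N + 1) → MvPolynomial (Fin (N + 1)) ℂ) : Prop :=
  v ∈ G.ratT ∧ ∀ i, v (V.aff j i) = aeval (V.aff j) (P i)

variable {G} {j : Fin (N + 1)}

lemma IsPolyTangent.aeval_polyDer {v : V.VF} {P : Fin (N + 1) → MvPolynomial (Fin (N + 1)) ℂ}
    (h : G.IsPolyTangent j v P) (g : MvPolynomial (Fin (N + 1)) ℂ) :
    aeval (V.aff j) (polyDer P g) = v (aeval (V.aff j) g) := by
  rw [polyDer_eq_sum, derivation_aeval_aff, map_sum]
  exact Finset.sum_congr rfl fun i _ => by rw [map_mul, h.2]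

lemma exists_isPolyTangent (hj : (MvPolynomial.X j : MvPolynomial (Fin (N + 1)) ℂ) ∉ V.ideal)
    {v : V.VF} (hv : v ∈ G.ratT) : ∃ c : V.K, c ≠ 0 ∧ ∃ P, G.IsPolyTangent j (c • v) P := by
  choose d a b ha hb hb0 hz using fun i => V.exists_fraction (v (V.aff j i))
  have hb1 : ∀ i, aeval (V.aff j) (b i) ≠ 0 := fun i h =>
    hb0 i ((V.aeval_aff_eq_zero_iff hj (hb i)).1 h)
  refine ⟨∏ i, aeval (V.aff j) (b i), Finset.prod_ne_zero_iff.2 fun i _ => hb1 i,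
    fun i => (∏ l ∈ Finset.univ.erase i, b l) * a i, G.ratT.smul_mem _ hv, fun i => ?_⟩
  rw [Derivation.smul_apply, smul_eq_mul, V.eq_aeval_aff_div hj (ha i) (hb i) (hz i),
    ← Finset.prod_erase_mul _ _ (Finset.mem_univ i), mul_assoc, mul_div_cancel₀ _ (hb1 i), map_mul,
    map_prod]

variable (G j) in
/-- The tuples of polynomials obtained from a given one by repeated differentiation along polynomial
vector fields tangent to `G`. -/
inductive IsDerivedTuple {m : ℕ} (g₀ : Fin m → MvPolynomial (Fin (N + 1)) ℂ) :
    (Fin m → MvPolynomial (Fin (N + 1)) ℂ) → Prop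
  | base : IsDerivedTuple g₀ g₀
  | step {g v P} : IsDerivedTuple g₀ g → G.IsPolyTangent j v P →
      IsDerivedTuple g₀ fun i => polyDer P (g i)

/-- The generalized Wronskian: if all first integrals are constant and the functions `g₀` are
linearly independent over `ℂ`, then their derivatives along `G` have full rank. -/
lemma span_isDerivedTuple_eq_top
    (hj : (MvPolynomial.X j : MvPolynomial (Fin (N + 1)) ℂ) ∉ V.ideal)
    (hk : ∀ h ∈ G.firstIntegrals, ∃ c : ℂ, algebraMap ℂ V.K c = h) {m : ℕ}
    {g₀ : Fin m → MvPolynomial (Fin (N + 1)) ℂ}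
    (hg : LinearIndependent ℂ fun i => aeval (V.aff j) (g₀ i)) :
    Submodule.span V.K {r : Fin m → V.K | ∃ g, G.IsDerivedTuple j g₀ g ∧
      r = fun i => aeval (V.aff j) (g i)} = ⊤ := by
  by_contra hne
  obtain ⟨φ, hφ0, hφ⟩ := Submodule.exists_le_ker_of_lt_top _ (lt_top_iff_ne_top.2 hne)
  let S : Set V.VF := {v | ∃ P, G.IsPolyTangent j v P}
  -- `R` consists of the relations satisfied by all derived tuples. Differentiating such a relation
  -- and removing the relation for the next derived tuple keeps it in `R`, so `R ≠ 0` would contain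
  -- a vector of first integrals, a `ℂ`-relation among the `g₀ i`.
  let R : Submodule V.K (Fin m → V.K) :=
    { carrier := {c | ∀ g, G.IsDerivedTuple j g₀ g → ∑ i, c i * aeval (V.aff j) (g i) = 0}
      add_mem' := fun {c d} hc hd g h => by
        simp only [Pi.add_apply, add_mul, Finset.sum_add_distrib, hc g h, hd g h, add_zero]
      zero_mem' := fun g h => by simp
      smul_mem' := fun a c hc g h => by
        simp only [Pi.smul_apply, smul_eq_mul, mul_assoc, ← Finset.mul_sum, hc g h, mul_zero] }
  have hRS : ∀ c ∈ R, ∀ v ∈ S, (fun i => v (c i)) ∈ R := by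
    rintro c hc v ⟨P, hP⟩ g hg
    have h1 := congrArg v (hc g hg)
    have h2 := hc _ (hg.step hP)
    rw [map_zero, map_sum] at h1
    simp only [Derivation.leibniz, smul_eq_mul, Finset.sum_add_distrib, hP.aeval_polyDer] at h1 h2
    rw [h2, zero_add] at h1
    rw [← h1]
    exact Finset.sum_congr rfl fun i _ => mul_comm _ _
  have hR0 : R ≠ ⊥ := by
    rw [Submodule.ne_bot_iff]
    refine ⟨fun i => φ (Pi.single i 1), fun g hg => ?_, fun h => hφ0 ?_⟩
    · have h1 : φ (fun i => aeval (V.aff j) (g i)) = 0 := hφ (Submodule.subset_span ⟨g, hg, rfl⟩)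
      rw [← h1, φ.pi_apply_eq_sum_univ]
      exact Finset.sum_congr rfl fun i _ => by
        have h2 : (Pi.single i 1 : Fin m → V.K) = fun l => if i = l then 1 else 0 :=
          funext fun l => by simp [Pi.single_apply, eq_comm]
        rw [smul_eq_mul, mul_comm, ← h2]
    · exact LinearMap.pi_ext' fun i => LinearMap.ext_ring (by simpa using congrFun h i)
  obtain ⟨c, hc, hc0, hconst⟩ := exists_const_vector hRS hR0
  have hcG : ∀ i, c i ∈ G.firstIntegrals := fun i => by
    rw [mem_firstIntegrals]
    intro v hv
    obtain ⟨a, ha, P, hP⟩ := exists_isPolyTangent hj hv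
    have := hconst i _ ⟨P, hP⟩
    rw [Derivation.smul_apply, smul_eq_mul] at this
    exact (mul_eq_zero.1 this).resolve_left ha
  choose b hb using fun i => hk _ (hcG i)
  refine hc0 (funext fun i => ?_)
  have h1 := hc g₀ .base
  simp only [← hb, ← Algebra.smul_def] at h1
  rw [← hb, Fintype.linearIndependent_iff.1 hg b h1 i, map_zero]
  rfl

/-- Full rank over `ℂ(X)` is witnessed by finitely many identities writing the unit vectors through
derived tuples; these can be evaluated wherever their coefficients are regular. -/
lemma generic_eq_zero_of_isDerivedTuple
    (hj : (MvPolynomial.X j : MvPolynomial (Fin (N + 1)) ℂ) ∉ V.ideal)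
    (hk : ∀ h ∈ G.firstIntegrals, ∃ c : ℂ, algebraMap ℂ V.K c = h) {m : ℕ}
    {g₀ : Fin m → MvPolynomial (Fin (N + 1)) ℂ}
    (hg : LinearIndependent ℂ fun i => aeval (V.aff j) (g₀ i)) :
    ∀ᶠ q in V.generic, ∀ c : Fin m → ℂ, (∀ g, G.IsDerivedTuple j g₀ g →
      ∑ i, c i * eval (q.affCoords j) (g i) = 0) → c = 0 := by
  have htop := span_isDerivedTuple_eq_top hj hk hg
  have h1 : ∀ l : Fin m, ∃ (n : ℕ) (μ : Fin n → V.K)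
      (g : Fin n → Fin m → MvPolynomial (Fin (N + 1)) ℂ), (∀ t, G.IsDerivedTuple j g₀ (g t)) ∧
      ∀ i, ∑ t, μ t * aeval (V.aff j) (g t i) = if i = l then 1 else 0 := fun l => by
    have : (Pi.single l 1 : Fin m → V.K) ∈ Submodule.span V.K {r : Fin m → V.K | ∃ g,
      G.IsDerivedTuple j g₀ g ∧ r = fun i => aeval (V.aff j) (g i)} := htop ▸ trivial
    obtain ⟨n, μ, r, hr⟩ := Submodule.mem_span_set'.1 this
    choose g hg hgr using fun t => (r t).2
    refine ⟨n, μ, g, hg, fun i => ?_⟩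
    have h2 := congrFun hr i
    rw [Pi.single_apply, Finset.sum_apply] at h2
    rw [← h2]
    exact Finset.sum_congr rfl fun t _ => by rw [Pi.smul_apply, hgr]; rfl
  choose n μ g hg hμ using h1
  filter_upwards [generic_coords_ne_zero hj,
    Filter.eventually_all.2 fun l => Filter.eventually_all.2 fun t =>
      generic_mem_localRing (μ l t)] with q hq hμq c hc
  funext l
  have h2 : ∀ i, ∑ t, V.value (μ l t) q * eval (q.affCoords j) (g l t i) =
      if i = l then 1 else 0 := fun i => by
    have h3 : ∑ t, (⟨μ l t, hμq l t⟩ : V.localRing q) * ⟨_, aeval_aff_mem hq (g l t i)⟩ =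
        if i = l then 1 else 0 := by
      apply Subtype.ext
      rw [AddSubmonoidClass.coe_finsetSum]
      refine (hμ l i).trans ?_
      split_ifs <;> rfl
    have h4 := congrArg (evalAt q) h3
    rw [map_sum] at h4
    simp only [map_mul, evalAt_apply, value_aeval_aff hq] at h4
    rw [h4]
    split_ifs
    · exact map_one (evalAt q)
    · exact map_zero (evalAt q)
  have h3 : c l = ∑ i, c i * ∑ t, V.value (μ l t) q * eval (q.affCoords j) (g l t i) := by
    simp only [h2]
    simp
  rw [h3]
  simp only [Finset.mul_sum]
  rw [Finset.sum_comm]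
  refine Finset.sum_eq_zero fun t _ => ?_
  have h4 := hc _ (hg l t)
  calc ∑ i, c i * (V.value (μ l t) q * eval (q.affCoords j) (g l t i))
      = V.value (μ l t) q * ∑ i, c i * eval (q.affCoords j) (g l t i) := by
        rw [Finset.mul_sum]; exact Finset.sum_congr rfl fun i _ => by ring
    _ = 0 := by rw [h4, mul_zero]

end Foliation

end ProjVariety

namespace ProjVariety

variable {N : ℕ} {V : ProjVariety N}

/-! ## Flows of polynomial vector fields -/

lemma contDiff_eval (g : MvPolynomial (Fin (N + 1)) ℂ) :
    ContDiff ℝ 1 fun x : Fin (N + 1) → ℂ => eval x g := by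
  induction g using MvPolynomial.induction_on with
  | C c => simpa using contDiff_const
  | add a b ha hb => simpa using ha.add hb
  | mul_X a i ha => simpa using ha.mul (contDiff_apply ℝ ℂ i)

lemma hasDerivAt_eval {P : Fin (N + 1) → MvPolynomial (Fin (N + 1)) ℂ}
    {α : ℝ → Fin (N + 1) → ℂ} {t : ℝ} (hα : HasDerivAt α (fun i => eval (α t) (P i)) t)
    (g : MvPolynomial (Fin (N + 1)) ℂ) :
    HasDerivAt (fun s => eval (α s) g) (eval (α t) (polyDer P g)) t := by
  induction g using MvPolynomial.induction_on with
  | C c => simpa using hasDerivAt_const t c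
  | add a b ha hb =>
    simp only [map_add]
    exact ha.add hb
  | mul_X a i ha =>
    have hi := (hasDerivAt_pi.1 hα) i
    have := ha.mul hi
    simp only [map_mul, eval_X, Derivation.leibniz, mkDerivation_X, map_add, smul_eq_mul]
    refine this.congr_deriv ?_
    ring

/-- The zero locus of an ideal which is stable under a polynomial vector field is invariant under
the flow. -/
lemma eval_eq_zero_of_flow {P : Fin (N + 1) → MvPolynomial (Fin (N + 1)) ℂ}
    {I : Ideal (MvPolynomial (Fin (N + 1)) ℂ)} (hI : ∀ g ∈ I, polyDer P g ∈ I)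
    {α : ℝ → Fin (N + 1) → ℂ} {T : ℝ}
    (hα : ∀ t ∈ Set.Icc 0 T, HasDerivAt α (fun i => eval (α t) (P i)) t)
    (h0 : ∀ g ∈ I, eval (α 0) g = 0) : ∀ t ∈ Set.Icc 0 T, ∀ g ∈ I, eval (α t) g = 0 := by
  obtain ⟨n, g, rfl⟩ := Submodule.fg_iff_exists_fin_generating_family.1 (IsNoetherian.noetherian I)
  have hg : ∀ a, g a ∈ Submodule.span (MvPolynomial (Fin (N + 1)) ℂ) (Set.range g) := fun a =>
    Submodule.subset_span ⟨a, rfl⟩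
  -- Along the flow the generators satisfy a linear system `g' = M g` with `M` bounded on the
  -- compact interval; Gronwall's inequality keeps the zero initial value at zero.
  choose M hM using fun a => (Submodule.mem_span_range_iff_exists_fun _).1 (hI _ (hg a))
  have hcont : ContinuousOn α (Set.Icc 0 T) := fun t ht => (hα t ht).continuousAt.continuousWithinAt
  choose K hK using fun a b => isCompact_Icc.exists_bound_of_continuousOn
    ((contDiff_eval (M a b)).continuous.comp_continuousOn hcont)
  have hder : ∀ t ∈ Set.Icc 0 T, HasDerivAt (fun s a => eval (α s) (g a))
      (fun a => ∑ b, eval (α t) (M a b) * eval (α t) (g b)) t := fun t ht =>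
    hasDerivAt_pi.2 fun a => by
      refine (hasDerivAt_eval (hα t ht) (g a)).congr_deriv ?_
      rw [← hM, map_sum]
      exact Finset.sum_congr rfl fun b _ => by rw [smul_eq_mul, map_mul]
  have key := eq_zero_of_abs_deriv_le_mul_abs_self_of_eq_zero_right (K := ∑ a, ∑ b, K a b)
    (fun t ht => (hder t ht).continuousAt.continuousWithinAt)
    (fun t ht => (hder t (Set.Ico_subset_Icc_self ht)).hasDerivWithinAt)
    (funext fun a => h0 _ (hg a)) fun t ht => ?_
  · intro t ht f hf
    obtain ⟨c, rfl⟩ := (Submodule.mem_span_range_iff_exists_fun _).1 hf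
    rw [map_sum]
    refine Finset.sum_eq_zero fun a _ => ?_
    rw [smul_eq_mul, map_mul, show eval (α t) (g a) = 0 from congrFun (key t ht) a, mul_zero]
  · have hK' := fun a b => hK a b t (Set.Ico_subset_Icc_self ht)
    have hK0 : ∀ a b, 0 ≤ K a b := fun a b => (norm_nonneg _).trans (hK' a b)
    refine (pi_norm_le_iff_of_nonneg (mul_nonneg (Finset.sum_nonneg fun a _ =>
      Finset.sum_nonneg fun b _ => hK0 a b) (norm_nonneg _))).2 fun a => ?_
    calc ‖∑ b, eval (α t) (M a b) * eval (α t) (g b)‖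
        ≤ ∑ b, K a b * ‖fun a => eval (α t) (g a)‖ := norm_sum_le_of_le _ fun b _ => by
          rw [norm_mul]
          exact mul_le_mul (hK' a b) (norm_le_pi_norm (fun a => eval (α t) (g a)) b)
            (norm_nonneg _) (hK0 a b)
      _ = (∑ b, K a b) * ‖fun a => eval (α t) (g a)‖ := by rw [Finset.sum_mul]
      _ ≤ _ := mul_le_mul_of_nonneg_right (Finset.single_le_sum
          (f := fun a => ∑ b, K a b) (fun a _ => Finset.sum_nonneg fun b _ => hK0 a b)
          (Finset.mem_univ a)) (norm_nonneg _)

lemma Point.eq_of_affCoords_eq {p q : V.Point} {j : Fin (N + 1)} (hp : p.coords j ≠ 0)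
    (h : p.affCoords j = q.affCoords j) : p = q := by
  refine Subtype.ext ?_
  rw [← p.1.mk_rep, ← q.1.mk_rep, Projectivization.mk_eq_mk_iff']
  refine ⟨p.coords j * (q.coords j)⁻¹, ?_⟩
  change _ • q.coords = p.coords
  rw [mul_smul]
  change p.coords j • q.affCoords j = p.coords
  rw [← h, affCoords, smul_inv_smul₀ hp]

lemma exists_point_of_affCoords {j : Fin (N + 1)}
    (hj : (MvPolynomial.X j : MvPolynomial (Fin (N + 1)) ℂ) ∉ V.ideal) {x : Fin (N + 1) → ℂ}
    (hx : ∀ g, aeval (V.aff j) g = 0 → eval x g = 0) :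
    ∃ p : V.Point, p.coords j ≠ 0 ∧ p.affCoords j = x := by
  have hxj : x j = 1 := by
    have h1 := hx (MvPolynomial.X j - 1) ?_
    · rwa [map_sub, eval_X, map_one, sub_eq_zero] at h1
    · rw [map_sub, aeval_X, map_one, sub_eq_zero, ← V.incl.toRingHom.injective.eq_iff]
      change V.incl _ = V.incl _
      rw [incl_aff, map_one]
      exact div_self (by rwa [Ne, V.cls_eq_zero_iff])
  have hx0 : x ≠ 0 := by rintro rfl; exact zero_ne_one hxj
  obtain ⟨p, c, hc, hp⟩ := exists_point_of_vec hx0 fun g hg => hx g (V.aeval_aff_of_mem hj hg)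
  have hpj : p.coords j = c := by rw [hp, Pi.smul_apply, hxj, smul_eq_mul, mul_one]
  exact ⟨p, hpj ▸ hc, by rw [Point.affCoords, hpj, hp, inv_smul_smul₀ hc]⟩

lemma eval_affCoords_eq_zero {p : V.Point} {j : Fin (N + 1)} (hj : p.coords j ≠ 0)
    {g : MvPolynomial (Fin (N + 1)) ℂ} (hg : aeval (V.aff j) g = 0) :
    eval (p.affCoords j) g = 0 := by
  rw [← value_aeval_aff hj, hg]
  exact map_zero (evalAt p)

lemma value_div_aeval_aff {p : V.Point} {j : Fin (N + 1)} (hj : p.coords j ≠ 0)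
    (a : MvPolynomial (Fin (N + 1)) ℂ) {b : MvPolynomial (Fin (N + 1)) ℂ}
    (hb : eval (p.affCoords j) b ≠ 0) :
    V.value (aeval (V.aff j) a / aeval (V.aff j) b) p =
      eval (p.affCoords j) a / eval (p.affCoords j) b := by
  have hb' := hb
  rw [← value_aeval_aff hj] at hb'
  rw [div_eq_mul_inv, value_mul (aeval_aff_mem hj a) (inv_mem_localRing (aeval_aff_mem hj b) hb'),
    value_inv (aeval_aff_mem hj b) hb', value_aeval_aff hj, value_aeval_aff hj, div_eq_mul_inv]

namespace Foliation

variable {G : V.Foliation} {j : Fin (N + 1)}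

/-- Rescaling by `t` lets a flow of duration `t` be run over `[0, 1]`, as `TangentPath` requires. -/
lemma IsPolyTangent.smul {v : V.VF} {P : Fin (N + 1) → MvPolynomial (Fin (N + 1)) ℂ}
    (h : G.IsPolyTangent j v P) (c : ℂ) :
    G.IsPolyTangent j (algebraMap ℂ V.K c • v) fun i => MvPolynomial.C c * P i :=
  ⟨G.ratT.smul_mem _ h.1, fun i => by
    rw [Derivation.smul_apply, h.2, map_mul, smul_eq_mul, aeval_C]⟩

lemma IsPolyTangent.tangentPath {v : V.VF} {P : Fin (N + 1) → MvPolynomial (Fin (N + 1)) ℂ}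
    (h : G.IsPolyTangent j v P) {γ : ℝ → V.Point} {α : ℝ → Fin (N + 1) → ℂ}
    (hγ : ∀ t ∈ Set.Icc (0 : ℝ) 1, ¬ G.IsSingularAt (γ t) ∧ (γ t).coords j ≠ 0 ∧
      (γ t).affCoords j = α t ∧ HasDerivAt α (fun i => eval (α t) (P i)) t) :
    G.TangentPath (γ 0) (γ 1) := by
  refine ⟨γ, rfl, rfl, fun t ht => ?_⟩
  obtain ⟨hs, hj, hα, hd⟩ := hγ t ht
  refine ⟨hs, v, (mem_T G).2 ⟨mem_vfStalk_of_aff hj fun i => ?_, h.1⟩, fun f hf => ?_⟩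
  · rw [h.2]
    exact aeval_aff_mem hj _
  obtain ⟨a, b, hb, rfl⟩ := (mem_localRing_iff_exists_affine hj).1 hf
  have hB := aeval_aff_ne_zero hj hb
  rw [hα] at hb
  have hev : ∀ᶠ s in nhdsWithin t (Set.Icc (0 : ℝ) 1), s ∈ Set.Icc (0 : ℝ) 1 ∧
      eval ((γ s).affCoords j) b ≠ 0 := by
    filter_upwards [self_mem_nhdsWithin, nhdsWithin_le_nhds
      ((hasDerivAt_eval hd b).continuousAt.eventually_ne hb)] with s hs hsb
    exact ⟨hs, by rwa [(hγ s hs).2.2.1]⟩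
  refine ⟨hev.mono fun s hs => (mem_localRing_iff_exists_affine (hγ s hs.1).2.1).2
    ⟨a, b, hs.2, rfl⟩, ?_⟩
  have hv : v (aeval (V.aff j) a / aeval (V.aff j) b) =
      aeval (V.aff j) (polyDer P a * b - a * polyDer P b) / aeval (V.aff j) (b ^ 2) := by
    rw [Derivation.leibniz_div, map_sub, map_mul, map_mul, map_pow, h.aeval_polyDer,
      h.aeval_polyDer, smul_eq_mul, smul_eq_mul, smul_eq_mul]
    field_simp
  have hquot := ((hasDerivAt_eval hd a).div (hasDerivAt_eval hd b) hb).hasDerivWithinAt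
    (s := Set.Icc (0 : ℝ) 1)
  rw [hv, value_div_aeval_aff hj _ (by rw [map_pow, hα]; exact pow_ne_zero 2 hb), hα, map_sub,
    map_mul, map_mul, map_pow]
  refine hquot.congr_of_eventuallyEq (hev.mono fun s hs => ?_) ?_
  · change V.value _ _ = eval (α s) a / eval (α s) b
    rw [value_div_aeval_aff (hγ s hs.1).2.1 a hs.2, (hγ s hs.1).2.2.1]
  · change V.value _ _ = eval (α t) a / eval (α t) b
    rw [value_div_aeval_aff hj a (by rwa [hα]), hα]

/-- A polynomial vector field tangent to `G` can be integrated, for a short time, inside the leaves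
of `G`. -/
lemma IsPolyTangent.exists_flow
    (hj : (MvPolynomial.X j : MvPolynomial (Fin (N + 1)) ℂ) ∉ V.ideal) {v : V.VF}
    {P : Fin (N + 1) → MvPolynomial (Fin (N + 1)) ℂ} (h : G.IsPolyTangent j v P)
    {d : ℕ} {u : MvPolynomial (Fin (N + 1)) ℂ} (hud : u.IsHomogeneous d)
    (hu : ∀ q : V.Point, eval q.coords u ≠ 0 → ¬ G.IsSingularAt q ∧ q.coords j ≠ 0) {p : V.Point}
    (hp : eval p.coords u ≠ 0) :
    ∃ (α : ℝ → Fin (N + 1) → ℂ) (T : ℝ), 0 < T ∧ α 0 = p.affCoords j ∧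
      (∀ t ∈ Set.Icc 0 T, HasDerivAt α (fun i => eval (α t) (P i)) t) ∧
      ∀ t ∈ Set.Icc 0 T, ∃ q : V.Point, eval q.coords u ≠ 0 ∧ q.affCoords j = α t ∧
        G.TangentPath p q := by
  have hpj := (hu p hp).2
  have hdiff : ContDiff ℝ 1 fun (x : Fin (N + 1) → ℂ) i => eval x (P i) :=
    contDiff_pi.2 fun i => contDiff_eval (P i)
  have hdiff' := hdiff.contDiffAt (x := p.affCoords j)
  obtain ⟨α, hα0, ε, hε, hα⟩ :=
    hdiff'.exists_forall_mem_closedBall_exists_eq_forall_mem_Ioo_hasDerivAt₀ 0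
  have hcont : ContinuousAt (fun t => eval (α t) u) 0 :=
    (hasDerivAt_eval (hα 0 ⟨by linarith, by linarith⟩) u).continuousAt
  have hu0 : eval (α 0) u ≠ 0 := by
    rw [hα0, eval_affCoords j hud]
    exact mul_ne_zero (pow_ne_zero _ (inv_ne_zero hpj)) hp
  obtain ⟨δ, hδ, hδu⟩ := Metric.eventually_nhds_iff.1 (hcont.eventually_ne hu0)
  -- Up to time `T` the solution exists and `u` stays nonzero on it, so the path avoids the singular
  -- set and the hyperplane `X_j = 0`.
  have hT : 0 < min (ε / 2) (δ / 2) := lt_min (by linarith) (by linarith)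
  generalize hTdef : min (ε / 2) (δ / 2) = T at hT
  have hTε : T ≤ ε / 2 := hTdef ▸ min_le_left _ _
  have hTδ : T ≤ δ / 2 := hTdef ▸ min_le_right _ _
  have hder : ∀ t ∈ Set.Icc 0 T, HasDerivAt α (fun i => eval (α t) (P i)) t := fun t ht =>
    hα t ⟨by linarith [ht.1], by linarith [ht.2]⟩
  -- The kernel is the ideal of the affine chart of `X`. It is stable under `polyDer P`, which
  -- induces the derivation `v` on `ℂ(X)`, so the flow in affine space stays on `X`.
  have hzero := eval_eq_zero_of_flow (I := RingHom.ker (aeval (R := ℂ) (V.aff j))) (P := P)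
    (fun g hg => by
      rw [RingHom.mem_ker] at hg ⊢
      rw [h.aeval_polyDer, hg, map_zero]) hder
    (fun g hg => by rw [hα0]; exact eval_affCoords_eq_zero hpj hg)
  have hpt : ∀ t, ∃ q : V.Point, t ∈ Set.Icc 0 T →
      q.coords j ≠ 0 ∧ q.affCoords j = α t := fun t => by
    by_cases ht : t ∈ Set.Icc 0 T
    · obtain ⟨q, hq⟩ := exists_point_of_affCoords hj (x := α t) fun g hg => hzero t ht g hg
      exact ⟨q, fun _ => hq⟩
    · exact ⟨p, fun h => absurd h ht⟩
  choose γ hγ using hpt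
  have hγu : ∀ t ∈ Set.Icc 0 T, eval (γ t).coords u ≠ 0 := fun t ht h0 => by
    refine hδu (y := t) ?_ ?_
    · rw [Real.dist_eq, sub_zero, abs_of_nonneg ht.1]
      linarith [ht.2]
    · rw [← (hγ t ht).2, eval_affCoords j hud, h0, mul_zero]
  have h0T : (0 : ℝ) ∈ Set.Icc 0 T := ⟨le_rfl, hT.le⟩
  have hγ0 : γ 0 = p := Point.eq_of_affCoords_eq (hγ 0 h0T).1 ((hγ 0 h0T).2.trans hα0)
  refine ⟨α, T, hT, hα0, hder, fun t ht => ⟨γ t, hγu t ht, (hγ t ht).2, ?_⟩⟩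
  have := (h.smul (t : ℂ)).tangentPath (γ := fun s => γ (t * s)) (α := fun s => α (t * s))
    fun s hs => ?_
  · rwa [mul_zero, mul_one, hγ0] at this
  · have hts : t * s ∈ Set.Icc 0 T :=
      ⟨mul_nonneg ht.1 hs.1, (mul_le_of_le_one_right ht.1 hs.2).trans ht.2⟩
    refine ⟨(hu _ (hγu _ hts)).1, (hγ _ hts).1, (hγ _ hts).2, ?_⟩
    have h1 := (hder _ hts).scomp s ((hasDerivAt_id s).const_mul t)
    refine h1.congr_deriv (funext fun i => ?_)
    simp

/-- The flow from `y` remains in the leaf for a short time, so `g` vanishes along it, and the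
one-sided derivative at time `0` is the derivative of `g` along the field. -/
lemma eval_polyDer_eq_zero_of_leaf
    (hj : (MvPolynomial.X j : MvPolynomial (Fin (N + 1)) ℂ) ∉ V.ideal) {v : V.VF}
    {P : Fin (N + 1) → MvPolynomial (Fin (N + 1)) ℂ} (h : G.IsPolyTangent j v P)
    {d : ℕ} {u : MvPolynomial (Fin (N + 1)) ℂ} (hud : u.IsHomogeneous d)
    (hu : ∀ q : V.Point, eval q.coords u ≠ 0 → ¬ G.IsSingularAt q ∧ q.coords j ≠ 0) {x : V.Point}
    {g : MvPolynomial (Fin (N + 1)) ℂ}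
    (hg : ∀ y ∈ G.leaf x, eval y.coords u ≠ 0 → eval (y.affCoords j) g = 0) :
    ∀ y ∈ G.leaf x, eval y.coords u ≠ 0 → eval (y.affCoords j) (polyDer P g) = 0 := by
  intro y hy hyu
  obtain ⟨α, T, hT, hα0, hder, hq⟩ := h.exists_flow hj hud hu hyu
  have h0T : (0 : ℝ) ∈ Set.Icc 0 T := ⟨le_rfl, hT.le⟩
  have hz : ∀ t ∈ Set.Icc 0 T, eval (α t) g = 0 := fun t ht => by
    obtain ⟨q, hqu, hqα, hpath⟩ := hq t ht
    rw [← hqα]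
    exact hg q (Relation.ReflTransGen.tail hy hpath) hqu
  have h1 := (hasDerivAt_eval (hder 0 h0T) g).hasDerivWithinAt (s := Set.Icc 0 T)
  have h2 : HasDerivWithinAt (fun s => eval (α s) g) 0 (Set.Icc 0 T) 0 :=
    (hasDerivWithinAt_const (0 : ℝ) (Set.Icc 0 T) (0 : ℂ)).congr hz (hz 0 h0T)
  rw [← hα0]
  exact (uniqueDiffOn_Icc hT 0 h0T).eq_deriv _ h1 h2

/-- If all rational first integrals are constant, then the general leaf is Zariski dense. -/
lemma generalLeafZariskiDense (hk : ∀ h ∈ G.firstIntegrals, ∃ c : ℂ, algebraMap ℂ V.K c = h) :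
    G.GeneralLeafZariskiDense := by
  obtain ⟨j, hj⟩ := V.nonempty
  obtain ⟨d₀, u, hud, hu0, hu⟩ := (eventually_generic V).1
    (G.generic_not_isSingularAt.and (generic_coords_ne_zero hj))
  have hbasis : ∀ d : ℕ, ∃ (m : ℕ) (g : Fin m → MvPolynomial (Fin (N + 1)) ℂ),
      (∀ i, (g i).IsHomogeneous d) ∧ (LinearIndependent ℂ fun i => aeval (V.aff j) (g i)) ∧
      ∀ a : MvPolynomial (Fin (N + 1)) ℂ, a.IsHomogeneous d →
        ∃ c : Fin m → ℂ, aeval (V.aff j) a = aeval (V.aff j) (∑ i, c i • g i) := fun d => by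
    let W := (homogeneousSubmodule (Fin (N + 1)) ℂ d).map (aeval (R := ℂ) (V.aff j)).toLinearMap
    have : Module.Finite ℂ W :=
      Module.Finite.iff_fg.2 ((homogeneousSubmodule_fg (Fin (N + 1)) ℂ d).map _)
    let b := Module.finBasis ℂ W
    choose g hg hgb using fun i => (b i).2
    refine ⟨_, g, hg, ?_, fun a ha => ⟨fun i => b.repr ⟨_, a, ha, rfl⟩ i, ?_⟩⟩
    · have := b.linearIndependent.map' W.subtype W.ker_subtype
      rwa [← show (fun i => aeval (V.aff j) (g i)) = W.subtype ∘ b from funext hgb] at this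
    · have := congrArg Subtype.val (b.sum_repr ⟨_, a, ha, rfl⟩)
      rw [map_sum]
      refine this.symm.trans ?_
      rw [Submodule.coe_sum]
      refine Finset.sum_congr rfl fun i _ => ?_
      rw [map_smul, Submodule.coe_smul, ← hgb]
      rfl
  choose m g hg hli hspan using hbasis
  choose e h he hh0 hh using fun d => (eventually_generic V).1
    (generic_eq_zero_of_isDerivedTuple hj hk (hli d))
  -- Index `0` carries the singular locus and the hyperplane `X_j = 0`; index `d + 1` carries the
  -- locus where the Wronskian argument in degree `d` may fail.
  refine ⟨fun n => Nat.casesOn n u h, fun n => ?_, fun x hx hxh d a ha hleaf => ?_⟩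
  · cases n with
    | zero => exact ⟨⟨d₀, hud⟩, hu0⟩
    | succ n => exact ⟨⟨e n, he n⟩, hh0 n⟩
  have hxu : eval x.coords u ≠ 0 := hxh 0
  obtain ⟨c, hc⟩ := hspan d a ha
  -- Vanishing on the leaf propagates to all derived tuples with the same coefficients `c`; at `x`
  -- this forces `c = 0`.
  have hder : ∀ f, G.IsDerivedTuple j (g d) f → ∀ y ∈ G.leaf x, eval y.coords u ≠ 0 →
      eval (y.affCoords j) (∑ i, c i • f i) = 0 := fun f hf => by
    induction hf with
    | base =>
      intro y hy hyu
      have hyj := (hu y hyu).2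
      rw [← value_aeval_aff hyj, ← hc, value_aeval_aff hyj, eval_affCoords j ha, hleaf y hy,
        mul_zero]
    | step hf hP ih =>
      have := eval_polyDer_eq_zero_of_leaf hj hP hud hu ih
      simpa only [map_sum, Derivation.map_smul] using this
  have hc0 : c = 0 := hh d x (hxh (d + 1)) c fun f hf => by
    simpa only [map_sum, smul_eval] using hder f hf x .refl hxu
  rw [← V.aeval_aff_eq_zero_iff hj ha, hc, hc0]
  simp

end Foliation

end ProjVariety

end

/-! ### The trichotomy by transcendence degree. -/

theorem theoremT {N : ℕ} (X : ProjVariety N) (hX : X.IsSmooth)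
    (G : X.Foliation) (hG : G.codim = 2)
    (η : G.LeafForm) (hη : G.GeneratedBy η) :
    (G.IsPullbackFromSurface ∨ G.IsAffineOverFirstIntegrals η ∨ G.IsAffineWithDenseLeaves η) ∧
    (¬ G.LogExact η → G.IsAffineWithDenseLeaves η) := by
  obtain ⟨ω, hω⟩ := ProjVariety.Foliation.exists_isEigenbasis hG hη
  obtain ⟨n, hn, z, hz, hli⟩ := G.exists_isTranscendenceBasis_firstIntegrals hG
  -- Any transcendental first integral makes `η` log-exact, so the last claim concerns `n = 0` only.
  have hlog : ∀ i : Fin n, G.LogExact η := fun i => hω.logExact (z i).2 (hli.ne_zero i)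
  interval_cases n
  · have hk := fun h hh => ProjVariety.Foliation.firstIntegrals_eq_const hz (h := h) hh
    have htr : Algebra.trdeg ℂ G.firstIntegrals = 0 := by
      rw [← hz.cardinalMk_eq_trdeg]; simp
    have main : G.IsAffineWithDenseLeaves η :=
      ⟨htr, ProjVariety.Foliation.generalLeafZariskiDense hk,
        fun F hF => ProjVariety.Foliation.transverselyAffine_of_const hω hk hF,
        hω.parametrizedByP1 ℂ (algebraMap ℂ X.K) (fun c α => (algebraMap_smul X.K c α).symm)
          fun f => ⟨hk f, by rintro ⟨c, rfl⟩; exact G.firstIntegrals.algebraMap_mem c⟩⟩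
    exact ⟨.inr (.inr main), fun _ => main⟩
  · refine ⟨.inr (.inl ?_), fun h => absurd (hlog 0) h⟩
    rw [show z = fun _ => z 0 from funext fun i => congrArg z (Subsingleton.elim i 0)] at hz
    exact ProjVariety.Foliation.isAffineOverFirstIntegrals hG hω hz (hli.ne_zero 0)
  · exact ⟨.inl (ProjVariety.Foliation.isPullbackFromSurface hG hz hli),
      fun h => absurd (hlog 0) h⟩
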